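/- Link diagrams are considered on the sphere $S^2$, up to isotopy. The Reidemeister moves that decrease the number of crossings are $\Omega_1^{\downarrow}$ (removing a kink) and $\Omega_2^{\downarrow}$ (removing a bigon), their inverses are $\Omega_1^{\uparrow}$ and $\Omega_2^{\uparrow}$, and the $\Omega_3$-type moves pass a strand across a crossing, with any admissible choice of over- and under-crossings at the triangle. A diagram is reduced if it has no nugatory crossing. Let $c(L)$ be the crossing number of a link $L$. A hard diagram of $L$ is a reduced diagram of $L$ with more than $c(L)$ crossings such that every sequence of Reidemeister moves from it to a diagram of $L$ with $c(L)$ crossings uses at least one move $\Omega_1^{\uparrow}$ or $\Omega_2^{\uparrow}$. A hard diagram is shaky if an $\Omega_3$-type move can be made on it, and rigid otherwise. A diagram with crossings is prime if it is connected and is not a connected sum, on the sphere, of two diagrams with crossings. Theorem (shaky hard diagrams of the unknot and unlinks). For every $n\ge 1$ there exists a shaky hard diagram of the unlink with $n$ components (the unknot, if $n=1$). More precisely, there are a prime shaky hard diagram $K$ of the unknot with $10$ crossings and a prime rigid hard diagram $H$ of the two-component unlink with $8$ crossings such that for every $n\ge 1$ some diagram obtained from $K$ by $n$ successive connected sums with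 copies of $H$ is a shaky hard diagram of the unlink with $n+1$ components. -/

import Mathlib

/-- A (nonempty, unoriented) link diagram on the oriented sphere, given by its combinatorial map.

A *dart* is an end of an edge of the diagram.  At a crossing four darts meet, and `rot` sends a
dart to the next one counterclockwise around its crossing; `inv` sends a dart to the other end of
its edge.  A closed component without crossings (a *free circle*) is drawn with one auxiliary
marked point on it: it is a pair of darts exchanged by both `rot` and `inv`.
A dart is a crossing dart when `rot (rot x) ≠ x`; then `rot (rot x)` is the dart opposite to `x`
on the same strand, and `isOver x` says that the strand of `x` is the upper one there.

`Region` is the set of connected components of the complement of the diagram in the sphere, and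
`region x` is the one on the left of `x` (looking along the edge, away from the end `x`), that is,
the one containing the corner between `x` and `rot x`.  Since a diagram may be disconnected, a
region need not be a disk, so the regions are part of the data.

`connected` and `euler` say that the surface is a connected one and that it is the sphere:
`V - E + R = 1 + C` for the numbers of vertices, edges, regions, and connected components. -/
structure LinkDiagram where
  Dart : Type
  Region : Type
  finite_dart : Finite Dart
  rot : Equiv.Perm Dart
  inv : Equiv.Perm Dart
  isOver : Dart → Bool
  region : Dart → Region
  inv_inv : ∀ x, inv (inv x) = x
  inv_ne : ∀ x, inv x ≠ x
  rot_four : ∀ x, rot (rot (rot (rot x))) = x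
  free_circle : ∀ x, rot (rot x) = x → rot x = inv x
  isOver_rot : ∀ x, rot (rot x) ≠ x → isOver (rot x) = !(isOver x)
  isOver_free : ∀ x, rot (rot x) = x → isOver x = false
  region_surjective : Function.Surjective region
  region_edge : ∀ x, region (inv (rot x)) = region x
  connected : ∀ x y, Relation.EqvGen
    (fun a b => b = rot a ∨ b = inv a ∨ region a = region b) x y
  euler : Nat.card (Quot fun a b => b = rot a) + Nat.card Region
    = Nat.card (Quot fun a b => b = inv a)
      + Nat.card (Quot fun a b => b = rot a ∨ b = inv a) + 1

namespace LinkDiagram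

/-- The dart `x` ends at a crossing (as opposed to lying on a free circle). -/
def IsCrossing (D : LinkDiagram) (x : D.Dart) : Prop := D.rot (D.rot x) ≠ x

/-- The darts at the vertex of `x`. -/
def vertex (D : LinkDiagram) (x : D.Dart) : Set D.Dart :=
  {x, D.rot x, D.rot (D.rot x), D.rot (D.rot (D.rot x))}

/-- The number of crossings; each crossing has exactly four darts. -/
noncomputable def crossingCount (D : LinkDiagram) : ℕ := Nat.card {x : D.Dart // D.IsCrossing x} / 4

/-- Two darts lie on the same component of the link: one goes from one end of an edge to the
other one, and straight on through crossings. -/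
def SameComponent (D : LinkDiagram) : D.Dart → D.Dart → Prop :=
  Relation.EqvGen fun a b => b = D.inv a ∨ b = D.rot (D.rot a)

/-- The number of components of the link. -/
noncomputable def componentCount (D : LinkDiagram) : ℕ :=
  Nat.card (Quot D.SameComponent)

/-- Isotopy of diagrams on the oriented sphere: isomorphism of the combinatorial data. -/
def Isotopic (D D' : LinkDiagram) : Prop :=
  ∃ e : D.Dart ≃ D'.Dart,
    (∀ x, e (D.rot x) = D'.rot (e x)) ∧
    (∀ x, e (D.inv x) = D'.inv (e x)) ∧
    (∀ x, D'.isOver (e x) = D.isOver x) ∧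
    (∀ x y, D'.region (e x) = D'.region (e y) ↔ D.region x = D.region y)

/-! ### Reidemeister moves -/

/-- `D.Travels S x y`: leaving along the edge of `x` and going straight on through any number of
crossings that belong to `S`, one arrives at the dart `y`. -/
inductive Travels (D : LinkDiagram) (S : Set D.Dart) (x : D.Dart) : D.Dart → Prop
  | edge : Travels D S x (D.inv x)
  | pass {y : D.Dart} : Travels D S x y → y ∈ S → Travels D S x (D.inv (D.rot (D.rot y)))

/-- `D'` arises from `D` by removing the crossings with darts in `S`, every strand being continued
straight on, and by uniting the regions of the darts `u` and `v`; all other regions of `D` that are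
still adjacent to a surviving dart are unchanged.  The surviving darts are identified with darts of
`D` by `ι`.  A component of `D` all of whose crossings belong to `S` becomes a free circle; it is
represented by one of its edges in `D` without an end in `I`. -/
structure Erases (D D' : LinkDiagram) (S I : Set D.Dart) (u v : D.Dart)
    (ι : D'.Dart → D.Dart) : Prop where
  injective : Function.Injective ι
  crossing : ∀ x, D'.IsCrossing x →
    D.IsCrossing (ι x) ∧ ι x ∉ S ∧ ι (D'.rot x) = D.rot (ι x) ∧ D'.isOver x = D.isOver (ι x) ∧
      D.Travels S (ι x) (ι (D'.inv x))
  circle : ∀ x, ¬ D'.IsCrossing x →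
    (D.IsCrossing (ι x) → ι x ∈ S) ∧ ι x ∉ I ∧ ι (D'.inv x) = D.inv (ι x) ∧
      ∀ y, D.SameComponent (ι x) (ι y) → y = x ∨ y = D'.inv x
  surviving : ∀ x, D.IsCrossing x → x ∉ S → ∃ x', ι x' = x
  components : ∀ x, ∃ x', D.SameComponent x (ι x')
  regions : ∀ x y, D'.region x = D'.region y ↔
    D.region (ι x) = D.region (ι y) ∨
    ((D.region (ι x) = D.region u ∨ D.region (ι x) = D.region v) ∧
      (D.region (ι y) = D.region u ∨ D.region (ι y) = D.region v))

/-- The move `Ω₁↓`: a kink, that is, a crossing with a region that is a disk bounded by a single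
edge (the region at the corner between `t` and `rot t`), is removed. -/
def Omega1Down (D D' : LinkDiagram) : Prop :=
  ∃ t : D.Dart, D.IsCrossing t ∧ D.inv t = D.rot t ∧
    (∀ x, D.region x = D.region t ↔ x = t) ∧
    ∃ ι, D.Erases D' (D.vertex t) {t, D.rot t} (D.rot t) (D.rot t) ι

/-- The move `Ω₂↓`: two crossings with a region that is a disk bounded by two edges (with corners
between `t` and `rot t` and between `s` and `rot s`) are removed, where one of the two edges is over
the other one at both of its ends.  The regions at the two corners opposite to those of the bigon
are united. -/
def Omega2Down (D D' : LinkDiagram) : Prop :=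
  ∃ t s : D.Dart, D.IsCrossing t ∧ D.IsCrossing s ∧ s ∉ D.vertex t ∧
    D.inv t = D.rot s ∧ D.inv s = D.rot t ∧
    (∀ x, D.region x = D.region t ↔ x = t ∨ x = s) ∧
    D.isOver t = D.isOver (D.rot s) ∧
    ∃ ι, D.Erases D' (D.vertex t ∪ D.vertex s) {t, D.rot t, s, D.rot s}
      (D.rot (D.rot t)) (D.rot (D.rot s)) ι

/-- The corners `t 0`, `t 1`, `t 2` (each between `t i` and `rot (t i)`) are those of a region that
is a triangular disk with three different crossings as vertices, and the three strands bounding it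
are not in cyclic position: one of them is above the two other ones, and one is below them.
These are exactly the triangles at which an `Ω₃`-type move is possible. -/
structure IsOmega3Triangle (D : LinkDiagram) (t : Fin 3 → D.Dart) : Prop where
  crossing : ∀ i, D.IsCrossing (t i)
  distinct : ∀ i j, i ≠ j → t j ∉ D.vertex (t i)
  edge : ∀ i, D.inv (t i) = D.rot (t (i + 1))
  disk : ∀ x, D.region x = D.region (t 0) ↔ ∃ i, x = t i
  not_cyclic : ¬ (D.isOver (t 0) = D.isOver (t 1) ∧ D.isOver (t 1) = D.isOver (t 2))

/-- The `Ω₃`-type moves.  Each of the three strands has two crossings at the triangle, and meets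
them in the opposite order after the move.  The crossings and their darts are kept (via `e`); on
each strand `ρ` exchanges the two darts pointing in one direction along the strand, and the two
pointing in the other direction.  The corner `x` of `D'` lies in the region that had the corner
`π x` in `D`, the new triangle being in place of the old one. -/
def Omega3 (D D' : LinkDiagram) : Prop :=
  ∃ (t : Fin 3 → D.Dart) (e : D.Dart ≃ D'.Dart) (ρ π : D.Dart → D.Dart),
    D.IsOmega3Triangle t ∧
    (∀ i, ρ (t i) = D.rot (D.rot (D.rot (t (i + 1)))) ∧
      ρ (D.rot (D.rot (D.rot (t (i + 1))))) = t i ∧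
      ρ (D.rot (D.rot (t i))) = D.rot (t (i + 1)) ∧
      ρ (D.rot (t (i + 1))) = D.rot (D.rot (t i))) ∧
    (∀ i, π (t i) = D.rot (D.rot (D.rot (t (i + 1)))) ∧
      π (D.rot (t i)) = D.rot (D.rot (t (i + 2))) ∧
      π (D.rot (D.rot (t i))) = t i ∧
      π (D.rot (D.rot (D.rot (t i)))) = D.rot (D.rot (t (i + 1)))) ∧
    (∀ x, (∀ i, x ∉ D.vertex (t i)) → ρ x = x ∧ π x = x) ∧
    (∀ x, D'.rot (e x) = e (D.rot x)) ∧
    (∀ x, D'.inv (e x) = e (ρ (D.inv (ρ x)))) ∧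
    (∀ x, D'.isOver (e x) = D.isOver x) ∧
    (∀ x y, D'.region (e x) = D'.region (e y) ↔ D.region (π x) = D.region (π y))

/-- An isotopy, or a Reidemeister move that does not increase the number of crossings. -/
def NonincreasingMove (D D' : LinkDiagram) : Prop :=
  D.Isotopic D' ∨ D.Omega1Down D' ∨ D.Omega2Down D' ∨ D.Omega3 D'

/-- Two diagrams represent the same link: they are connected by a finite sequence of isotopies on
the sphere and Reidemeister moves, where `Ω₁↓` and `Ω₂↓` may be used in both directions. -/
def SameLink : LinkDiagram → LinkDiagram → Prop := Relation.EqvGen NonincreasingMove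

/-- `D` can be transformed into `D'` by Reidemeister moves none of which increases the number of
crossings. -/
def ReducesTo : LinkDiagram → LinkDiagram → Prop := Relation.ReflTransGen NonincreasingMove

/-! ### Hard diagrams -/

/-- The crossing number of the link represented by `D`. -/
noncomputable def crossingNumber (D : LinkDiagram) : ℕ :=
  sInf {c | ∃ E : LinkDiagram, D.SameLink E ∧ E.crossingCount = c}

/-- `E` is a minimal diagram of the link represented by `D`. -/
def IsMinimalDiagramOf (E D : LinkDiagram) : Prop :=
  D.SameLink E ∧ E.crossingCount = D.crossingNumber

/-- `D` is reduced: it has no nugatory crossing, that is, opposite corners of a crossing never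
belong to the same region. -/
def IsReduced (D : LinkDiagram) : Prop :=
  ∀ x, D.IsCrossing x → D.region x ≠ D.region (D.rot (D.rot x))

/-- A hard diagram: a reduced diagram with more crossings than the crossing number of its link,
from which no minimal diagram of the link is obtained without a move `Ω₁↑` or `Ω₂↑`. -/
def IsHard (D : LinkDiagram) : Prop :=
  D.IsReduced ∧ D.crossingNumber < D.crossingCount ∧
    ∀ E : LinkDiagram, E.IsMinimalDiagramOf D → ¬ D.ReducesTo E

/-- A hard diagram is shaky if an `Ω₃`-type move can be made on it. -/
def IsShakyHard (D : LinkDiagram) : Prop := D.IsHard ∧ ∃ D', D.Omega3 D'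

/-- A hard diagram is rigid if no `Ω₃`-type move can be made on it. -/
def IsRigidHard (D : LinkDiagram) : Prop := D.IsHard ∧ ¬ ∃ D', D.Omega3 D'

/-- `D` is a diagram of the unlink with `n` components, the link that is represented by `n` disjoint
circles without crossings.  For `n = 1` it is the unknot. -/
def IsUnlinkDiagram (n : ℕ) (D : LinkDiagram) : Prop :=
  ∃ U : LinkDiagram, U.crossingCount = 0 ∧ U.componentCount = n ∧ D.SameLink U

/-! ### Connected sums -/

/-- The projection of the link is connected. -/
def IsConnected (D : LinkDiagram) : Prop :=
  ∀ x y, Relation.EqvGen (fun a b => b = D.rot a ∨ b = D.inv a) x y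

/-- `D` is a connected sum on the sphere of `D₁` and `D₂`, made along the edges of the crossing
darts `x₁` and `x₂`: both edges are cut, and the dart `x₁` is joined to the end `inv x₂`, and `x₂`
to `inv x₁`.  The regions to the left of `x₁` and `x₂` are united, and so are those to the right. -/
def IsConnectedSum (D₁ D₂ D : LinkDiagram) : Prop :=
  ∃ (x₁ : D₁.Dart) (x₂ : D₂.Dart) (e : D₁.Dart ⊕ D₂.Dart ≃ D.Dart),
    D₁.IsCrossing x₁ ∧ D₂.IsCrossing x₂ ∧
    (∀ x, D.rot (e (.inl x)) = e (.inl (D₁.rot x))) ∧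
    (∀ x, D.rot (e (.inr x)) = e (.inr (D₂.rot x))) ∧
    (∀ x, D.isOver (e (.inl x)) = D₁.isOver x) ∧
    (∀ x, D.isOver (e (.inr x)) = D₂.isOver x) ∧
    D.inv (e (.inl x₁)) = e (.inr (D₂.inv x₂)) ∧
    D.inv (e (.inr x₂)) = e (.inl (D₁.inv x₁)) ∧
    (∀ x, x ≠ x₁ → x ≠ D₁.inv x₁ → D.inv (e (.inl x)) = e (.inl (D₁.inv x))) ∧
    (∀ x, x ≠ x₂ → x ≠ D₂.inv x₂ → D.inv (e (.inr x)) = e (.inr (D₂.inv x))) ∧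
    (∀ x y, D.region (e (.inl x)) = D.region (e (.inl y)) ↔ D₁.region x = D₁.region y) ∧
    (∀ x y, D.region (e (.inr x)) = D.region (e (.inr y)) ↔ D₂.region x = D₂.region y) ∧
    (∀ x y, D.region (e (.inl x)) = D.region (e (.inr y)) ↔
      (D₁.region x = D₁.region x₁ ∧ D₂.region y = D₂.region x₂) ∨
      (D₁.region x = D₁.region (D₁.inv x₁) ∧ D₂.region y = D₂.region (D₂.inv x₂)))

/-- A prime diagram: a connected diagram with crossings that is not a connected sum of two diagrams
with crossings (the connected sum with a trivial circle does not change a diagram). -/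
def IsPrime (D : LinkDiagram) : Prop :=
  D.IsConnected ∧ 0 < D.crossingCount ∧ ¬ ∃ D₁ D₂ : LinkDiagram, IsConnectedSum D₁ D₂ D

/-- `IsIteratedSum K H n D`: the diagram `D` is obtained from `K` by `n` successive connected sums
with the diagram `H`, along arbitrary edges. -/
inductive IsIteratedSum (K H : LinkDiagram) : ℕ → LinkDiagram → Prop
  | zero : IsIteratedSum K H 0 K
  | succ {n : ℕ} {D D' : LinkDiagram} : IsIteratedSum K H n D → IsConnectedSum D H D' →
      IsIteratedSum K H (n + 1) D'

end LinkDiagram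

/-! Hardness is proved by an invariant family. Suppose that a set of diagrams is closed under
`Ω₃`-type moves and that no member has a removable kink or bigon. Then moves that do not increase
the number of crossings never leave the set, up to isotopy. If all members have crossings, no
diagram without crossings is reached, although one exists when the link is an unlink
(`IsStable.isHard`). For the 8-crossing diagram `unlink0` no `Ω₃`-type move is possible, and the
family is a single diagram. For the 10-crossing diagram `unknot0` the family is a pair: every such
move leads to `unknotSlid`, and every such move on `unknotSlid` leads back.

This closedness survives connected sums with `unlink0` along a marked edge. A region next to one of
the two joining edges has at least two corners in each summand, hence at least four in all
(`four_le_ncard_of_region_eq`). The regions at which moves take place have at most three corners, so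
each of them lies inside one summand, where the possible moves are already known
(`IsStable.image_markedGlue`). The `Ω₃`-type triangle of `unknot0` persists in all sums because it
stays away from the marked edge.

To recognize the sums as unlinks, the simplification of each summand has to be carried out inside
the sum. For this, moves are required to keep the marked edge, where the other summand is inserted,
and not to take place in a region next to it (`TrackedMove`). Such a move on a summand is a move on
the sum (`trackedMove_glue`); its core is `erases_glue`, the compatibility of removing crossings
with gluing. After one temporary kink, explicit tracked sequences take `unknot0` to a circle with
one kink, and `unlink0` to two overlapping circles with two crossings. In a sum with the overlapping
circles, an `Ω₂↓` move sets the unmarked circle free (`trackedMove_glue_overlapping`). By induction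
the `n`-fold sum becomes one kinked circle with `n` free circles, and a last `Ω₁↓` gives `n + 1`
free circles.

The concrete diagrams are tables of darts, whose moves and regions are checked by computation.
Primeness holds because the two joining edges of a connected sum would have the same pair of regions
on their sides, and no two edges of these diagrams do. -/

/-! ### Counting classes of relations -/

/-- A finset with a fixed-point-free involution has an even number of elements. -/
theorem Finset.even_card_of_involution {α : Type*} (s : Finset α) (g : α → α)
    (hs : ∀ a ∈ s, g a ∈ s) (hg : ∀ a ∈ s, g (g a) = a) (hne : ∀ a ∈ s, g a ≠ a) :
    Even s.card := by
  -- Count modulo 2: the terms cancel in pairs under the involution.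
  have h : ∑ _a ∈ s, (1 : ZMod 2) = 0 :=
    Finset.sum_involution (fun a _ => g a) (fun _ _ => by decide) (fun a ha _ => hne a ha)
      (fun a ha => hs a ha) (fun a ha => hg a ha)
  rw [Finset.sum_const, nsmul_eq_mul, mul_one] at h
  exact (ZMod.natCast_eq_zero_iff_even).1 h

/-- A fixed-point-free involution has half as many orbits as there are points. -/
theorem card_eq_two_mul_card_quot {α : Type*} [Finite α] (f : α → α) (hf : ∀ a, f (f a) = a)
    (hne : ∀ a, f a ≠ a) : Nat.card α = 2 * Nat.card (Quot fun a b => b = f a) := by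
  classical
  have := Fintype.ofFinite α
  let q : α → Quot fun a b => b = f a := Quot.mk _
  have hq : ∀ a b, q a = q b → b = a ∨ b = f a := by
    intro a b h
    have h' := Quot.eqvGen_exact h
    clear h
    induction h' with
    | rel x y h => exact Or.inr h
    | refl x => exact Or.inl rfl
    | symm x y _ ih => rcases ih with rfl | rfl <;> simp [hf]
    | trans x y z _ _ ih ih' => rcases ih with rfl | rfl <;> rcases ih' with rfl | rfl <;> simp [hf]
  have e := Nat.card_congr (Equiv.sigmaFiberEquiv q)
  have hfin : Finite (Quot fun a b => b = f a) := Quot.finite _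
  have := Fintype.ofFinite (Quot fun a b => b = f a)
  rw [← e, Nat.card_sigma]
  have : ∀ c, Nat.card {a // q a = c} = 2 := by
    intro c
    induction c using Quot.inductionOn with | _ a
    have hset : {b | q b = Quot.mk _ a} = {a, f a} := by
      ext b
      constructor
      · intro h
        rcases hq a b (Eq.symm h) with h | h <;> simp [h]
      · rintro (rfl | rfl)
        · rfl
        · exact (Quot.sound (r := fun a b => b = f a) (a := a) rfl).symm
    change Nat.card ({b | q b = Quot.mk _ a} : Set α) = 2
    rw [hset, Nat.card_coe_set_eq, Set.ncard_pair (hne a).symm]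
  rw [Finset.sum_congr rfl fun c _ => this c, Finset.sum_const, Finset.card_univ,
    Nat.card_eq_fintype_card, smul_eq_mul, mul_comm]

/-- The classes of a relation on a sum that does not relate the two summands. -/
theorem card_quot_sum {α β : Type*} [Finite α] [Finite β] {r : α → α → Prop} {s : β → β → Prop}
    {t : α ⊕ β → α ⊕ β → Prop} (h : ∀ a b, t a b ↔ Sum.LiftRel r s a b) :
    Nat.card (Quot t) = Nat.card (Quot r) + Nat.card (Quot s) := by
  have : Finite (Quot r) := Quot.finite _
  have : Finite (Quot s) := Quot.finite _
  rw [← Nat.card_sum]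
  refine Nat.card_congr ⟨Quot.lift (Sum.map (Quot.mk r) (Quot.mk s)) ?_,
    Sum.elim (Quot.map Sum.inl fun a b hab => (h _ _).2 (.inl hab))
      (Quot.map Sum.inr fun a b hab => (h _ _).2 (.inr hab)), ?_, ?_⟩
  · intro a b hab
    rcases (h a b).1 hab with hab' | hab'
    · exact congrArg Sum.inl (Quot.sound hab')
    · exact congrArg Sum.inr (Quot.sound hab')
  · rintro ⟨a | b⟩ <;> rfl
  · rintro (⟨⟨a⟩⟩ | ⟨⟨b⟩⟩) <;> rfl

theorem quot_eq_of_eqvGen {α : Type*} {r : α → α → Prop} {a b : α} (h : Relation.EqvGen r a b) :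
    Quot.mk r a = Quot.mk r b := Quot.eqvGen_sound h

/-- The classes of a relation on a sum that unites one class of the first summand with one of the
second. -/
theorem card_quot_sum_glued {α β : Type*} [Finite α] [Finite β] {r : α → α → Prop}
    {s : β → β → Prop} {t : α ⊕ β → α ⊕ β → Prop} (a₀ : α) (b₀ : β)
    (hr : ∀ a b, r a b → Relation.EqvGen t (.inl a) (.inl b))
    (hs : ∀ a b, s a b → Relation.EqvGen t (.inr a) (.inr b))
    (h₀ : Relation.EqvGen t (.inl a₀) (.inr b₀))
    (hll : ∀ a b, t (.inl a) (.inl b) → Relation.EqvGen r a b)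
    (hrr : ∀ a b, t (.inr a) (.inr b) → Relation.EqvGen s a b)
    (hlr : ∀ a b, t (.inl a) (.inr b) → Relation.EqvGen r a a₀ ∧ Relation.EqvGen s b b₀)
    (hrl : ∀ a b, t (.inr b) (.inl a) → Relation.EqvGen r a a₀ ∧ Relation.EqvGen s b b₀) :
    Nat.card (Quot t) + 1 = Nat.card (Quot r) + Nat.card (Quot s) := by
  classical
  have : Finite (Quot r) := Quot.finite _
  have : Finite (Quot s) := Quot.finite _
  let F : β → Quot r ⊕ {q : Quot s // q ≠ Quot.mk s b₀} := fun b =>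
    if hb : Quot.mk s b = Quot.mk s b₀ then .inl (Quot.mk r a₀) else .inr ⟨Quot.mk s b, hb⟩
  have hF : ∀ b, Relation.EqvGen s b b₀ → F b = .inl (Quot.mk r a₀) := fun b hb => by
    simp only [F, quot_eq_of_eqvGen hb, dite_true]
  -- A class of `t` is either a class of `r` or a class of `s` other than that of `b₀`, which is
  -- absorbed by the class of `a₀`.
  have e : Quot t ≃ Quot r ⊕ {q : Quot s // q ≠ Quot.mk s b₀} := by
    refine ⟨Quot.lift (Sum.elim (fun a => .inl (Quot.mk r a)) F) ?_,
      Sum.elim (Quot.lift (fun a => Quot.mk t (.inl a)) fun a b hab =>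
        quot_eq_of_eqvGen (hr a b hab))
      (fun q => Quot.lift (fun b => Quot.mk t (.inr b))
        (fun a b hab => quot_eq_of_eqvGen (hs a b hab)) q.1), ?_, ?_⟩
    · rintro (a | a) (b | b) hab
      · exact congrArg Sum.inl (quot_eq_of_eqvGen (hll a b hab))
      · obtain ⟨h1, h2⟩ := hlr a b hab
        simp only [Sum.elim_inl, Sum.elim_inr, hF b h2, quot_eq_of_eqvGen h1]
      · obtain ⟨h1, h2⟩ := hrl b a hab
        simp only [Sum.elim_inl, Sum.elim_inr, hF a h2, quot_eq_of_eqvGen h1]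
      · have := quot_eq_of_eqvGen (hrr a b hab)
        simp only [Sum.elim_inr, F, this]
    · rintro ⟨a | b⟩
      · rfl
      · simp only [Sum.elim_inr, F]
        split_ifs with hb
        · simp only [Sum.elim_inl]
          rw [quot_eq_of_eqvGen h₀]
          have := congrArg (Quot.lift (fun b => Quot.mk t (.inr b))
            (fun a b hab => quot_eq_of_eqvGen (hs a b hab))) hb
          exact this.symm
        · rfl
    · rintro (⟨⟨a⟩⟩ | ⟨⟨b⟩, hb⟩)
      · rfl
      · exact dif_neg hb
  rw [Nat.card_congr e, Nat.card_sum, add_assoc]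
  congr 1
  have h1 := Set.ncard_add_ncard_compl ({Quot.mk s b₀} : Set (Quot s))
  rw [Set.ncard_singleton, add_comm] at h1
  rw [← h1, ← Nat.card_coe_set_eq]
  rfl

/-- A relation whose classes are the fibres of a surjection. -/
theorem card_quot_eq_of_surjective {α β : Type*} {r : α → α → Prop} (f : α → β)
    (hf : Function.Surjective f) (hr : ∀ a b, r a b → f a = f b)
    (hinj : ∀ a b, f a = f b → Relation.EqvGen r a b) : Nat.card (Quot r) = Nat.card β := by
  refine Nat.card_congr (Equiv.ofBijective (Quot.lift f hr) ⟨?_, ?_⟩)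
  · rintro ⟨a⟩ ⟨b⟩ h
    exact quot_eq_of_eqvGen (hinj a b h)
  · intro b
    obtain ⟨a, rfl⟩ := hf b
    exact ⟨Quot.mk r a, rfl⟩

theorem Relation.EqvGen.map {α β : Type*} {r : α → α → Prop} {s : β → β → Prop} (f : α → β)
    (h : ∀ a b, r a b → Relation.EqvGen s (f a) (f b)) {a b : α} (hab : Relation.EqvGen r a b) :
    Relation.EqvGen s (f a) (f b) := by
  induction hab with
  | rel x y hxy => exact h x y hxy
  | refl x => exact .refl _
  | symm x y _ ih => exact .symm _ _ ih
  | trans x y z _ _ ih ih' => exact .trans _ _ _ ih ih'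

/-- A set that is closed under a relation in both directions contains the classes of its
elements. -/
theorem Relation.EqvGen.mem_iff {α : Type*} {r : α → α → Prop} {P : α → Prop}
    (h : ∀ a b, r a b → (P a ↔ P b)) {a b : α} (hab : Relation.EqvGen r a b) : P a ↔ P b := by
  induction hab with
  | rel x y hxy => exact h x y hxy
  | refl x => exact Iff.rfl
  | symm x y _ ih => exact ih.symm
  | trans x y z _ _ ih ih' => exact ih.trans ih'

namespace LinkDiagram

/-! ### Basic facts about diagrams -/

theorem isCrossing_rot {D : LinkDiagram} {x : D.Dart} :
    D.IsCrossing (D.rot x) ↔ D.IsCrossing x :=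
  not_congr D.rot.injective.eq_iff

/-- A free circle is a pair of darts exchanged by both permutations, so no edge joins it to a
crossing. -/
theorem isCrossing_inv {D : LinkDiagram} {x : D.Dart} :
    D.IsCrossing (D.inv x) ↔ D.IsCrossing x := by
  have key : ∀ y, D.rot (D.rot y) = y → D.rot (D.rot (D.inv y)) = D.inv y := by
    intro y hy
    rw [← D.free_circle y hy, hy]
  refine not_congr ⟨fun h => ?_, key x⟩
  have := key _ h
  rwa [D.inv_inv] at this

theorem mem_vertex_self (D : LinkDiagram) (x : D.Dart) : x ∈ D.vertex x := Or.inl rfl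

theorem rot_mem_vertex {D : LinkDiagram} {x y : D.Dart} (h : y ∈ D.vertex x) :
    D.rot y ∈ D.vertex x := by
  rcases h with rfl | rfl | rfl | rfl
  · exact .inr (.inl rfl)
  · exact .inr (.inr (.inl rfl))
  · exact .inr (.inr (.inr rfl))
  · exact .inl (D.rot_four x)

theorem isCrossing_of_mem_vertex {D : LinkDiagram} {x y : D.Dart} (h : y ∈ D.vertex x) :
    D.IsCrossing y ↔ D.IsCrossing x := by
  rcases h with rfl | rfl | rfl | rfl <;> simp [isCrossing_rot]

/-- Gives a second corner of the region to the left of an edge, the one at its far end. -/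
theorem region_symm_rot_inv (D : LinkDiagram) (x : D.Dart) :
    D.region (D.rot.symm (D.inv x)) = D.region x := by
  rw [← D.region_edge, Equiv.apply_symm_apply, D.inv_inv]

theorem finite_region (D : LinkDiagram) : Finite D.Region :=
  have := D.finite_dart
  Finite.of_surjective _ D.region_surjective

theorem card_dart_eq (D : LinkDiagram) :
    Nat.card D.Dart = 2 * Nat.card (Quot fun a b => b = D.inv a) :=
  have := D.finite_dart
  card_eq_two_mul_card_quot D.inv D.inv_inv D.inv_ne

/-- The count is a division by four rounded down, so four different darts have to be exhibited. -/
theorem crossingCount_pos {D : LinkDiagram} {x : D.Dart} (h : D.IsCrossing x) :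
    0 < D.crossingCount := by
  have := D.finite_dart
  have h1 : D.rot x ≠ x := fun h' => h (by rw [h', h'])
  have h3 : D.rot (D.rot (D.rot x)) ≠ x := fun h' => h1 (by
    have := D.rot_four x
    rwa [h'] at this)
  have hle : 4 ≤ ({x | D.IsCrossing x} : Set D.Dart).ncard := by
    classical
    have h4 :
        ({x, D.rot x, D.rot (D.rot x), D.rot (D.rot (D.rot x))} : Finset D.Dart).card = 4 := by
      have h2 : D.rot (D.rot x) ≠ x := h
      rw [Finset.card_insert_of_notMem, Finset.card_insert_of_notMem, Finset.card_pair] <;>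
        simp [D.rot.injective.eq_iff, h2.symm, h1.symm, h3.symm]
    rw [← h4, ← Set.ncard_coe_finset]
    refine Set.ncard_le_ncard ?_ (Set.toFinite _)
    intro z hz
    have hz' : z ∈ D.vertex x := by simpa [vertex] using hz
    exact (isCrossing_of_mem_vertex hz').2 h
  have : 4 ≤ Nat.card {x : D.Dart // D.IsCrossing x} := by
    rwa [← Nat.card_coe_set_eq] at hle
  exact Nat.div_pos this (by norm_num)

theorem crossingCount_eq_zero {D : LinkDiagram} (h : ∀ x, ¬ D.IsCrossing x) :
    D.crossingCount = 0 := by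
  have : IsEmpty {x : D.Dart // D.IsCrossing x} := ⟨fun x => h x.1 x.2⟩
  simp [crossingCount]

theorem Isotopic.refl (D : LinkDiagram) : D.Isotopic D :=
  ⟨Equiv.refl _, fun _ => rfl, fun _ => rfl, fun _ => rfl, fun _ _ => Iff.rfl⟩

theorem Isotopic.trans {D D' D'' : LinkDiagram} :
    D.Isotopic D' → D'.Isotopic D'' → D.Isotopic D'' := by
  rintro ⟨e, h1, h2, h3, h4⟩ ⟨e', h1', h2', h3', h4'⟩
  refine ⟨e.trans e', fun x => ?_, fun x => ?_, fun x => ?_, fun x y => ?_⟩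
  · simp [h1, h1']
  · simp [h2, h2']
  · simp [h3, h3']
  · simp [h4, h4']

/-- An edge with an end at a crossing does not separate its two ends: following the strand through
`y` from one end of the edge one returns to the other end without using the edge. -/
theorem eqvGen_strand (D : LinkDiagram) {y : D.Dart} (hy : D.IsCrossing y) :
    Relation.EqvGen (fun a b => b = D.rot (D.rot a) ∨ (b = D.inv a ∧ a ≠ y ∧ a ≠ D.inv y))
      y (D.inv y) := by
  classical
  have := D.finite_dart
  have := Fintype.ofFinite D.Dart
  by_contra hcon
  set r := fun a b => b = D.rot (D.rot a) ∨ (b = D.inv a ∧ a ≠ y ∧ a ≠ D.inv y) with hr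
  -- `A` is the class of `y`. The map `rot²` pairs off all its darts, while `inv` pairs off all of
  -- them except `y` if `inv y` is missing; the two parities contradict each other.
  let A : Finset D.Dart := Finset.univ.filter fun z => Relation.EqvGen r y z
  have hA : ∀ z, z ∈ A ↔ Relation.EqvGen r y z := fun z => by simp [A]
  have hcr : ∀ z ∈ A, D.IsCrossing z := fun z hz => by
    refine (Relation.EqvGen.mem_iff (P := D.IsCrossing) ?_ ((hA z).1 hz)).1 hy
    rintro a b (rfl | ⟨rfl, -⟩)
    · simp [isCrossing_rot]
    · simp [isCrossing_inv]
  have h1 : Even A.card := by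
    refine A.even_card_of_involution (fun z => D.rot (D.rot z)) (fun z hz => ?_)
      (fun z _ => D.rot_four z) hcr
    exact (hA _).2 (.trans _ _ _ ((hA z).1 hz) (.rel _ _ (Or.inl rfl)))
  have hyA : y ∈ A := (hA y).2 (.refl _)
  have hiA : D.inv y ∉ A := fun h => hcon ((hA _).1 h)
  have h2 : Even (A.erase y).card := by
    refine (A.erase y).even_card_of_involution D.inv (fun z hz => ?_)
      (fun z _ => D.inv_inv z) (fun z _ => D.inv_ne z)
    obtain ⟨hzy, hzA⟩ := Finset.mem_erase.1 hz
    refine Finset.mem_erase.2 ⟨fun h => hiA ?_, ?_⟩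
    · rw [← h, D.inv_inv]; exact hzA
    · refine (hA _).2 (.trans _ _ _ ((hA z).1 hzA) (.rel _ _ (Or.inr ⟨rfl, hzy, ?_⟩)))
      rintro rfl; exact hiA hzA
  have h3 := Finset.card_erase_add_one hyA
  rw [← h3] at h1
  exact (Nat.even_add_one.1 h1) h2

end LinkDiagram

/-! ### Sums of diagrams along marked edges -/

/-- A diagram with a marked edge that ends at a crossing and has different regions on its two
sides. -/
structure MarkedDiagram where
  diagram : LinkDiagram
  mark : diagram.Dart
  crossing : diagram.IsCrossing mark
  separating : diagram.region mark ≠ diagram.region (diagram.inv mark)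

namespace MarkedDiagram

open LinkDiagram Classical

variable (X Y : MarkedDiagram)

/-- The other end of the marked edge. -/
abbrev mark' : X.diagram.Dart := X.diagram.inv X.mark

theorem inv_mark' : X.diagram.inv X.mark' = X.mark := X.diagram.inv_inv _

theorem mark'_ne : X.mark' ≠ X.mark := X.diagram.inv_ne _

theorem inv_eq_mark_iff {x : X.diagram.Dart} : X.diagram.inv x = X.mark ↔ x = X.mark' := by
  rw [← X.diagram.inv.injective.eq_iff, X.diagram.inv_inv]

theorem inv_eq_mark'_iff {x : X.diagram.Dart} : X.diagram.inv x = X.mark' ↔ x = X.mark :=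
  X.diagram.inv.injective.eq_iff

/-- The edges of a sum of two marked diagrams, which joins the two marks, and their other ends. -/
noncomputable def glueInvFun : X.diagram.Dart ⊕ Y.diagram.Dart → X.diagram.Dart ⊕ Y.diagram.Dart
  | .inl x => if x = X.mark then .inr Y.mark else if x = X.mark' then .inr Y.mark'
      else .inl (X.diagram.inv x)
  | .inr z => if z = Y.mark then .inl X.mark else if z = Y.mark' then .inl X.mark'
      else .inr (Y.diagram.inv z)

theorem glueInvFun_involutive : Function.Involutive (glueInvFun X Y) := by
  rintro (x | z)
  · by_cases h1 : x = X.mark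
    · simp [glueInvFun, h1]
    by_cases h2 : x = X.mark'
    · simp [glueInvFun, h2, X.mark'_ne, Y.mark'_ne]
    have h3 : X.diagram.inv x ≠ X.mark := mt X.inv_eq_mark_iff.1 h2
    have h4 : X.diagram.inv x ≠ X.mark' := mt X.inv_eq_mark'_iff.1 h1
    simp [glueInvFun, h1, h2, h3, h4, X.diagram.inv_inv]
  · by_cases h1 : z = Y.mark
    · simp [glueInvFun, h1]
    by_cases h2 : z = Y.mark'
    · simp [glueInvFun, h2, X.mark'_ne, Y.mark'_ne]
    have h3 : Y.diagram.inv z ≠ Y.mark := mt Y.inv_eq_mark_iff.1 h2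
    have h4 : Y.diagram.inv z ≠ Y.mark' := mt Y.inv_eq_mark'_iff.1 h1
    simp [glueInvFun, h1, h2, h3, h4, Y.diagram.inv_inv]

/-- The regions of a sum: the regions of the second diagram on the two sides of the marked edge are
united with regions of the first one. -/
noncomputable def glueRegion : X.diagram.Dart ⊕ Y.diagram.Dart →
    X.diagram.Region ⊕ {r : Y.diagram.Region //
      r ∉ ({Y.diagram.region Y.mark, Y.diagram.region Y.mark'} : Set Y.diagram.Region)}
  | .inl x => .inl (X.diagram.region x)
  | .inr z => if h : Y.diagram.region z = Y.diagram.region Y.mark then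
        .inl (X.diagram.region X.mark')
      else if h' : Y.diagram.region z = Y.diagram.region Y.mark' then
        .inl (X.diagram.region X.mark)
      else .inr ⟨Y.diagram.region z, by simp [h, h']⟩

/-- A relation that contains all edges of a sum except the marked edge of the first diagram, but
contains the strands of the second diagram, connects the ends of the former. -/
theorem eqvGen_mark_left
    {t : X.diagram.Dart ⊕ Y.diagram.Dart → X.diagram.Dart ⊕ Y.diagram.Dart → Prop}
    (hrot : ∀ z, Relation.EqvGen t (.inr z) (.inr (Y.diagram.rot (Y.diagram.rot z))))
    (hinv : ∀ w, Relation.EqvGen t w (glueInvFun X Y w)) :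
    Relation.EqvGen t (.inl X.mark) (.inl X.mark') := by
  have h1 : Relation.EqvGen t (.inl X.mark) (.inr Y.mark) := by
    simpa [glueInvFun] using hinv (.inl X.mark)
  have h2 : Relation.EqvGen t (.inr Y.mark') (.inl X.mark') := by
    simpa [glueInvFun, Y.mark'_ne] using hinv (.inr Y.mark')
  refine h1.trans _ _ _ (.trans _ _ _ ?_ h2)
  refine Relation.EqvGen.map Sum.inr ?_ (Y.diagram.eqvGen_strand Y.crossing)
  rintro a b (rfl | ⟨rfl, h3, h4⟩)
  · exact hrot a
  · simpa [glueInvFun, h3, h4] using hinv (.inr a)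

theorem eqvGen_mark_right
    {t : X.diagram.Dart ⊕ Y.diagram.Dart → X.diagram.Dart ⊕ Y.diagram.Dart → Prop}
    (hrot : ∀ x, Relation.EqvGen t (.inl x) (.inl (X.diagram.rot (X.diagram.rot x))))
    (hinv : ∀ w, Relation.EqvGen t w (glueInvFun X Y w)) :
    Relation.EqvGen t (.inr Y.mark) (.inr Y.mark') := by
  have h1 : Relation.EqvGen t (.inr Y.mark) (.inl X.mark) := by
    simpa [glueInvFun] using hinv (.inr Y.mark)
  have h2 : Relation.EqvGen t (.inl X.mark') (.inr Y.mark') := by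
    simpa [glueInvFun, X.mark'_ne] using hinv (.inl X.mark')
  refine h1.trans _ _ _ (.trans _ _ _ ?_ h2)
  refine Relation.EqvGen.map Sum.inl ?_ (X.diagram.eqvGen_strand X.crossing)
  rintro a b (rfl | ⟨rfl, h3, h4⟩)
  · exact hrot a
  · simpa [glueInvFun, h3, h4] using hinv (.inl a)

/-- Only the marked edge of the first summand is cut, and its ends stay connected through the second
one. Since `hrot` asks just for straight passage through crossings, this serves both connectedness
and the components of the link. -/
theorem eqvGen_inl {t : X.diagram.Dart ⊕ Y.diagram.Dart → X.diagram.Dart ⊕ Y.diagram.Dart → Prop}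
    (hrot : ∀ z, Relation.EqvGen t (.inr z) (.inr (Y.diagram.rot (Y.diagram.rot z))))
    (hinv : ∀ w, Relation.EqvGen t w (glueInvFun X Y w)) (x : X.diagram.Dart) :
    Relation.EqvGen t (.inl x) (.inl (X.diagram.inv x)) := by
  have hm := eqvGen_mark_left X Y hrot hinv
  by_cases h1 : x = X.mark
  · rwa [h1]
  by_cases h2 : x = X.mark'
  · rw [h2, X.inv_mark']; exact hm.symm
  simpa [glueInvFun, h1, h2] using hinv (.inl x)

theorem eqvGen_inr {t : X.diagram.Dart ⊕ Y.diagram.Dart → X.diagram.Dart ⊕ Y.diagram.Dart → Prop}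
    (hrot : ∀ x, Relation.EqvGen t (.inl x) (.inl (X.diagram.rot (X.diagram.rot x))))
    (hinv : ∀ w, Relation.EqvGen t w (glueInvFun X Y w)) (z : Y.diagram.Dart) :
    Relation.EqvGen t (.inr z) (.inr (Y.diagram.inv z)) := by
  have hm := eqvGen_mark_right X Y hrot hinv
  by_cases h1 : z = Y.mark
  · rwa [h1]
  by_cases h2 : z = Y.mark'
  · rw [h2, Y.inv_mark']; exact hm.symm
  simpa [glueInvFun, h1, h2] using hinv (.inr z)

/-- The two marks face each other on the new edge, so the left side of one is the right side of the
other. This is why the regions at the marks are identified crosswise. -/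
theorem glueRegion_edge (w : X.diagram.Dart ⊕ Y.diagram.Dart) :
    glueRegion X Y (glueInvFun X Y (Sum.map X.diagram.rot Y.diagram.rot w)) = glueRegion X Y w := by
  have hX := X.diagram.region_edge
  have hY := Y.diagram.region_edge
  rcases w with x | z
  · have := hX x
    simp only [Sum.map_inl, glueInvFun]
    split_ifs with h1 h2
    · rw [h1] at this
      simp [glueRegion, this]
    · rw [h2, X.inv_mark'] at this
      simp [glueRegion, this, Y.separating.symm]
    · simp [glueRegion, this]
  · have := hY z
    simp only [Sum.map_inr, glueInvFun]
    split_ifs with h1 h2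
    · rw [h1] at this
      simp [glueRegion, ← this, Y.separating.symm]
    · rw [h2, Y.inv_mark'] at this
      simp [glueRegion, ← this]
    · simp [glueRegion, this]

/-- The sum of two marked diagrams along the marked edges. -/
noncomputable def glue : LinkDiagram where
  Dart := X.diagram.Dart ⊕ Y.diagram.Dart
  Region := X.diagram.Region ⊕ {r : Y.diagram.Region //
      r ∉ ({Y.diagram.region Y.mark, Y.diagram.region Y.mark'} : Set Y.diagram.Region)}
  finite_dart := by
    have := X.diagram.finite_dart
    have := Y.diagram.finite_dart
    infer_instance
  rot := Equiv.sumCongr X.diagram.rot Y.diagram.rot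
  inv := Function.Involutive.toPerm _ (glueInvFun_involutive X Y)
  isOver := Sum.elim X.diagram.isOver Y.diagram.isOver
  region := glueRegion X Y
  inv_inv := glueInvFun_involutive X Y
  inv_ne := by
    rintro (x | z)
    · by_cases h1 : x = X.mark
      · simp [glueInvFun, h1]
      by_cases h2 : x = X.mark'
      · simp [glueInvFun, h2, X.mark'_ne]
      simp [glueInvFun, h1, h2, X.diagram.inv_ne]
    · by_cases h1 : z = Y.mark
      · simp [glueInvFun, h1]
      by_cases h2 : z = Y.mark'
      · simp [glueInvFun, h2, Y.mark'_ne]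
      simp [glueInvFun, h1, h2, Y.diagram.inv_ne]
  rot_four := by
    rintro (x | z)
    · simp [X.diagram.rot_four]
    · simp [Y.diagram.rot_four]
  free_circle := by
    rintro (x | z) h
    · have h' : X.diagram.rot (X.diagram.rot x) = x := by simpa using h
      have h1 : x ≠ X.mark := fun e => X.crossing (e ▸ h')
      have h2 : x ≠ X.mark' := fun e => isCrossing_inv.2 X.crossing (by rwa [e] at h')
      simp [glueInvFun, h1, h2, X.diagram.free_circle x h']
    · have h' : Y.diagram.rot (Y.diagram.rot z) = z := by simpa using h
      have h1 : z ≠ Y.mark := fun e => Y.crossing (e ▸ h')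
      have h2 : z ≠ Y.mark' := fun e => isCrossing_inv.2 Y.crossing (by rwa [e] at h')
      simp [glueInvFun, h1, h2, Y.diagram.free_circle z h']
  isOver_rot := by
    rintro (x | z) h
    · exact X.diagram.isOver_rot x fun h' => h (congrArg Sum.inl h')
    · exact Y.diagram.isOver_rot z fun h' => h (congrArg Sum.inr h')
  isOver_free := by
    rintro (x | z) h
    · exact X.diagram.isOver_free x (Sum.inl_injective h)
    · exact Y.diagram.isOver_free z (Sum.inr_injective h)
  region_surjective := by
    rintro (r | ⟨r, hr⟩)
    · obtain ⟨x, rfl⟩ := X.diagram.region_surjective r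
      exact ⟨.inl x, rfl⟩
    · obtain ⟨z, rfl⟩ := Y.diagram.region_surjective r
      simp only [Set.mem_insert_iff, Set.mem_singleton_iff, not_or] at hr
      exact ⟨.inr z, by simp [glueRegion, hr.1, hr.2]⟩
  region_edge w := by
    rcases w with x | z
    · exact glueRegion_edge X Y (.inl x)
    · exact glueRegion_edge X Y (.inr z)
  connected := by
    set t := fun a b : X.diagram.Dart ⊕ Y.diagram.Dart =>
      b = Equiv.sumCongr X.diagram.rot Y.diagram.rot a ∨
        b = Function.Involutive.toPerm _ (glueInvFun_involutive X Y) a ∨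
        glueRegion X Y a = glueRegion X Y b with ht
    have hrl : ∀ x, Relation.EqvGen t (.inl x) (.inl (X.diagram.rot x)) :=
      fun x => .rel _ _ (.inl rfl)
    have hrr : ∀ z, Relation.EqvGen t (.inr z) (.inr (Y.diagram.rot z)) :=
      fun z => .rel _ _ (.inl rfl)
    have hinv : ∀ w, Relation.EqvGen t w (glueInvFun X Y w) :=
      fun w => .rel _ _ (.inr (.inl rfl))
    have hl : ∀ x x', Relation.EqvGen t (.inl x) (.inl x') := fun x x' => by
      refine Relation.EqvGen.map Sum.inl ?_ (X.diagram.connected x x')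
      rintro a b (rfl | rfl | h)
      · exact hrl a
      · exact eqvGen_inl X Y (fun z => .trans _ _ _ (hrr _) (hrr _)) hinv a
      · exact .rel _ _ (.inr (.inr (congrArg Sum.inl h)))
    have hr : ∀ z z', Relation.EqvGen t (.inr z) (.inr z') := fun z z' => by
      refine Relation.EqvGen.map Sum.inr ?_ (Y.diagram.connected z z')
      rintro a b (rfl | rfl | h)
      · exact hrr a
      · exact eqvGen_inr X Y (fun z => .trans _ _ _ (hrl _) (hrl _)) hinv a
      · exact .rel _ _ (.inr (.inr (by simp [glueRegion, h])))
    have h0 : Relation.EqvGen t (.inl X.mark) (.inr Y.mark) := by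
      simpa [glueInvFun] using hinv (.inl X.mark)
    rintro (x | z) (x' | z')
    · exact hl x x'
    · exact (hl x X.mark).trans _ _ _ (h0.trans _ _ _ (hr _ _))
    · exact (hr z Y.mark).trans _ _ _ (h0.symm.trans _ _ _ (hl _ _))
    · exact hr z z'
  euler := by
    have := X.diagram.finite_dart
    have := Y.diagram.finite_dart
    have := X.diagram.finite_region
    have := Y.diagram.finite_region
    have hV : Nat.card (Quot fun a b : X.diagram.Dart ⊕ Y.diagram.Dart =>
          b = Equiv.sumCongr X.diagram.rot Y.diagram.rot a)
        = Nat.card (Quot fun a b => b = X.diagram.rot a)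
          + Nat.card (Quot fun a b => b = Y.diagram.rot a) := by
      refine card_quot_sum ?_
      rintro (a | a) (b | b) <;> simp
    have hE := card_eq_two_mul_card_quot (Function.Involutive.toPerm _ (glueInvFun_involutive X Y))
      (glueInvFun_involutive X Y) (by
        rintro (x | z)
        · by_cases h1 : x = X.mark
          · simp [glueInvFun, h1]
          by_cases h2 : x = X.mark'
          · simp [glueInvFun, h2, X.mark'_ne]
          simp [glueInvFun, h1, h2, X.diagram.inv_ne]
        · by_cases h1 : z = Y.mark
          · simp [glueInvFun, h1]
          by_cases h2 : z = Y.mark'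
          · simp [glueInvFun, h2, Y.mark'_ne]
          simp [glueInvFun, h1, h2, Y.diagram.inv_ne])
    rw [Nat.card_sum, X.diagram.card_dart_eq, Y.diagram.card_dart_eq] at hE
    have hR : Nat.card {r : Y.diagram.Region //
        r ∉ ({Y.diagram.region Y.mark, Y.diagram.region Y.mark'} : Set Y.diagram.Region)} + 2
        = Nat.card Y.diagram.Region := by
      have h1 := Set.ncard_add_ncard_compl
        ({Y.diagram.region Y.mark, Y.diagram.region Y.mark'} : Set Y.diagram.Region)
      rw [Set.ncard_pair Y.separating] at h1
      rw [← h1, add_comm, ← Nat.card_coe_set_eq]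
      rfl
    have hC : Nat.card (Quot fun a b : X.diagram.Dart ⊕ Y.diagram.Dart =>
          b = Equiv.sumCongr X.diagram.rot Y.diagram.rot a ∨
          b = Function.Involutive.toPerm _ (glueInvFun_involutive X Y) a) + 1
        = Nat.card (Quot fun a b => b = X.diagram.rot a ∨ b = X.diagram.inv a)
          + Nat.card (Quot fun a b => b = Y.diagram.rot a ∨ b = Y.diagram.inv a) := by
      set t := fun a b : X.diagram.Dart ⊕ Y.diagram.Dart =>
        b = Equiv.sumCongr X.diagram.rot Y.diagram.rot a ∨
        b = Function.Involutive.toPerm _ (glueInvFun_involutive X Y) a with ht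
      have hrl : ∀ x, Relation.EqvGen t (.inl x) (.inl (X.diagram.rot x)) :=
        fun x => .rel _ _ (.inl rfl)
      have hrr : ∀ z, Relation.EqvGen t (.inr z) (.inr (Y.diagram.rot z)) :=
        fun z => .rel _ _ (.inl rfl)
      have hinv : ∀ w, Relation.EqvGen t w (glueInvFun X Y w) :=
        fun w => .rel _ _ (.inr rfl)
      have hXm : Relation.EqvGen (fun a b => b = X.diagram.rot a ∨ b = X.diagram.inv a)
        X.mark' X.mark := .rel _ _ (.inr X.inv_mark'.symm)
      have hYm : Relation.EqvGen (fun a b => b = Y.diagram.rot a ∨ b = Y.diagram.inv a)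
        Y.mark' Y.mark := .rel _ _ (.inr Y.inv_mark'.symm)
      refine card_quot_sum_glued X.mark Y.mark ?_ ?_ ?_ ?_ ?_ ?_ ?_
      · rintro a b (rfl | rfl)
        · exact hrl a
        · exact eqvGen_inl X Y (fun z => .trans _ _ _ (hrr _) (hrr _)) hinv a
      · rintro a b (rfl | rfl)
        · exact hrr a
        · exact eqvGen_inr X Y (fun z => .trans _ _ _ (hrl _) (hrl _)) hinv a
      · simpa [glueInvFun] using hinv (.inl X.mark)
      · rintro a b (h | h)
        · exact .rel _ _ (.inl (Sum.inl_injective h))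
        · simp only [Function.Involutive.coe_toPerm, glueInvFun] at h
          split_ifs at h with h1 h2
          exact .rel _ _ (.inr (Sum.inl_injective h))
      · rintro a b (h | h)
        · exact .rel _ _ (.inl (Sum.inr_injective h))
        · simp only [Function.Involutive.coe_toPerm, glueInvFun] at h
          split_ifs at h with h1 h2
          exact .rel _ _ (.inr (Sum.inr_injective h))
      · rintro a b (h | h)
        · simp at h
        · simp only [Function.Involutive.coe_toPerm, glueInvFun] at h
          split_ifs at h with h1 h2
          · rw [h1, Sum.inr_injective h]; exact ⟨.refl _, .refl _⟩
          · rw [h2, Sum.inr_injective h]; exact ⟨hXm, hYm⟩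
      · rintro a b (h | h)
        · simp at h
        · simp only [Function.Involutive.coe_toPerm, glueInvFun] at h
          split_ifs at h with h1 h2
          · rw [h1, Sum.inl_injective h]; exact ⟨.refl _, .refl _⟩
          · rw [h2, Sum.inl_injective h]; exact ⟨hXm, hYm⟩
    have eX := X.diagram.euler
    have eY := Y.diagram.euler
    -- Vertices and edges add up, while two regions and one connected component are lost, so the two
    -- Euler relations combine to the required one.
    rw [hV, Nat.card_sum]
    omega

/-! ### The structure of a sum -/

/-- A dart of the first summand in the sum. -/
def inl (x : X.diagram.Dart) : (glue X Y).Dart := Sum.inl x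

/-- A dart of the second summand in the sum. -/
def inr (z : Y.diagram.Dart) : (glue X Y).Dart := Sum.inr z

variable {X Y}

@[elab_as_elim]
theorem glue_cases {P : (glue X Y).Dart → Prop} (hl : ∀ x, P (inl X Y x)) (hr : ∀ z, P (inr X Y z))
    (w : (glue X Y).Dart) : P w := by
  rcases w with x | z
  exacts [hl x, hr z]

@[simp] theorem inl_inj {x x' : X.diagram.Dart} : inl X Y x = inl X Y x' ↔ x = x' :=
  Sum.inl_injective.eq_iff

@[simp] theorem inr_inj {z z' : Y.diagram.Dart} : inr X Y z = inr X Y z' ↔ z = z' :=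
  Sum.inr_injective.eq_iff

@[simp] theorem inl_ne_inr {x : X.diagram.Dart} {z : Y.diagram.Dart} : inl X Y x ≠ inr X Y z :=
  Sum.inl_ne_inr

@[simp] theorem inr_ne_inl {x : X.diagram.Dart} {z : Y.diagram.Dart} : inr X Y z ≠ inl X Y x :=
  Sum.inr_ne_inl

@[simp] theorem glue_rot_inl (x : X.diagram.Dart) :
    (glue X Y).rot (inl X Y x) = inl X Y (X.diagram.rot x) := rfl

@[simp] theorem glue_rot_inr (z : Y.diagram.Dart) :
    (glue X Y).rot (inr X Y z) = inr X Y (Y.diagram.rot z) := rfl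

@[simp] theorem glue_isOver_inl (x : X.diagram.Dart) :
    (glue X Y).isOver (inl X Y x) = X.diagram.isOver x := rfl

@[simp] theorem glue_isOver_inr (z : Y.diagram.Dart) :
    (glue X Y).isOver (inr X Y z) = Y.diagram.isOver z := rfl

@[simp] theorem glue_inv_inl_mark : (glue X Y).inv (inl X Y X.mark) = inr X Y Y.mark :=
  if_pos rfl

@[simp] theorem glue_inv_inl_mark' : (glue X Y).inv (inl X Y X.mark') = inr X Y Y.mark' :=
  (if_neg X.mark'_ne).trans (if_pos rfl)

@[simp] theorem glue_inv_inr_mark : (glue X Y).inv (inr X Y Y.mark) = inl X Y X.mark :=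
  if_pos rfl

@[simp] theorem glue_inv_inr_mark' : (glue X Y).inv (inr X Y Y.mark') = inl X Y X.mark' :=
  (if_neg Y.mark'_ne).trans (if_pos rfl)

theorem glue_inv_inl {x : X.diagram.Dart} (h : x ≠ X.mark) (h' : x ≠ X.mark') :
    (glue X Y).inv (inl X Y x) = inl X Y (X.diagram.inv x) :=
  (if_neg h).trans (if_neg h')

theorem glue_inv_inr {z : Y.diagram.Dart} (h : z ≠ Y.mark) (h' : z ≠ Y.mark') :
    (glue X Y).inv (inr X Y z) = inr X Y (Y.diagram.inv z) :=
  (if_neg h).trans (if_neg h')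

@[simp] theorem glue_isCrossing_inl {x : X.diagram.Dart} :
    (glue X Y).IsCrossing (inl X Y x) ↔ X.diagram.IsCrossing x := by
  simp [IsCrossing]

@[simp] theorem glue_isCrossing_inr {z : Y.diagram.Dart} :
    (glue X Y).IsCrossing (inr X Y z) ↔ Y.diagram.IsCrossing z := by
  simp [IsCrossing]

@[simp] theorem glue_region_inl_inl {x x' : X.diagram.Dart} :
    (glue X Y).region (inl X Y x) = (glue X Y).region (inl X Y x') ↔
      X.diagram.region x = X.diagram.region x' :=
  Sum.inl_injective.eq_iff

theorem glue_region_inr_of_eq_mark {z : Y.diagram.Dart}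
    (h : Y.diagram.region z = Y.diagram.region Y.mark) :
    (glue X Y).region (inr X Y z) = (glue X Y).region (inl X Y X.mark') :=
  dif_pos h

theorem glue_region_inr_of_eq_mark' {z : Y.diagram.Dart}
    (h : Y.diagram.region z = Y.diagram.region Y.mark') :
    (glue X Y).region (inr X Y z) = (glue X Y).region (inl X Y X.mark) :=
  (dif_neg fun h' => Y.separating (h'.symm.trans h)).trans (dif_pos h)

theorem glue_region_inr_of_ne {z : Y.diagram.Dart}
    (h : Y.diagram.region z ≠ Y.diagram.region Y.mark)
    (h' : Y.diagram.region z ≠ Y.diagram.region Y.mark') (x : X.diagram.Dart) :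
    (glue X Y).region (inr X Y z) ≠ (glue X Y).region (inl X Y x) := by
  have : (glue X Y).region (inr X Y z) = Sum.inr ⟨Y.diagram.region z, by simp [h, h']⟩ :=
    (dif_neg h).trans (dif_neg h')
  rw [this]
  exact Sum.inr_ne_inl

-- The two regions of `Y` at the mark are united with two different regions of `X`, as the mark of
-- `X` is separating; hence no two regions of `Y` become one.
@[simp] theorem glue_region_inr_inr {z z' : Y.diagram.Dart} :
    (glue X Y).region (inr X Y z) = (glue X Y).region (inr X Y z') ↔
      Y.diagram.region z = Y.diagram.region z' := by
  constructor
  · intro h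
    by_cases h1 : Y.diagram.region z = Y.diagram.region Y.mark
    · rw [glue_region_inr_of_eq_mark h1] at h
      by_cases h2 : Y.diagram.region z' = Y.diagram.region Y.mark
      · rw [h1, h2]
      by_cases h3 : Y.diagram.region z' = Y.diagram.region Y.mark'
      · rw [glue_region_inr_of_eq_mark' h3, glue_region_inl_inl] at h
        exact absurd h.symm X.separating
      · exact absurd h.symm (glue_region_inr_of_ne h2 h3 _)
    by_cases h1' : Y.diagram.region z = Y.diagram.region Y.mark'
    · rw [glue_region_inr_of_eq_mark' h1'] at h
      by_cases h2 : Y.diagram.region z' = Y.diagram.region Y.mark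
      · rw [glue_region_inr_of_eq_mark h2, glue_region_inl_inl] at h
        exact absurd h X.separating
      by_cases h3 : Y.diagram.region z' = Y.diagram.region Y.mark'
      · rw [h1', h3]
      · exact absurd h.symm (glue_region_inr_of_ne h2 h3 _)
    by_cases h2 : Y.diagram.region z' = Y.diagram.region Y.mark
    · rw [glue_region_inr_of_eq_mark h2] at h
      exact absurd h (glue_region_inr_of_ne h1 h1' _)
    by_cases h3 : Y.diagram.region z' = Y.diagram.region Y.mark'
    · rw [glue_region_inr_of_eq_mark' h3] at h
      exact absurd h (glue_region_inr_of_ne h1 h1' _)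
    have e1 : (glue X Y).region (inr X Y z) = Sum.inr ⟨Y.diagram.region z, by simp [h1, h1']⟩ :=
      (dif_neg h1).trans (dif_neg h1')
    have e2 : (glue X Y).region (inr X Y z') = Sum.inr ⟨Y.diagram.region z', by simp [h2, h3]⟩ :=
      (dif_neg h2).trans (dif_neg h3)
    rw [e1, e2] at h
    exact congrArg Subtype.val (Sum.inr_injective h)
  · intro h
    change glueRegion X Y (.inr z) = glueRegion X Y (.inr z')
    simp only [glueRegion, h]

theorem glue_region_inl_inr {x : X.diagram.Dart} {z : Y.diagram.Dart} :
    (glue X Y).region (inl X Y x) = (glue X Y).region (inr X Y z) ↔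
      (X.diagram.region x = X.diagram.region X.mark ∧
        Y.diagram.region z = Y.diagram.region Y.mark') ∨
      (X.diagram.region x = X.diagram.region X.mark' ∧
        Y.diagram.region z = Y.diagram.region Y.mark) := by
  by_cases h1 : Y.diagram.region z = Y.diagram.region Y.mark
  · simp [glue_region_inr_of_eq_mark h1, h1, Y.separating]
  by_cases h2 : Y.diagram.region z = Y.diagram.region Y.mark'
  · simp [glue_region_inr_of_eq_mark' h2, h2, Y.separating.symm]
  · simp [h1, h2, (glue_region_inr_of_ne h1 h2 x).symm]

/-- The sum, with the mark on one of the two edges that join the summands. -/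
noncomputable def markedGlue (X Y : MarkedDiagram) : MarkedDiagram where
  diagram := glue X Y
  mark := inl X Y X.mark
  crossing := glue_isCrossing_inl.2 X.crossing
  separating := by
    rw [glue_inv_inl_mark, Ne, glue_region_inl_inr]
    simp [X.separating, Y.separating]

/-- In `IsConnectedSum` the dart `x₁` is joined to the far end of `x₂`. Here the two marks are
joined, so `x₂` has to be `Y.mark'`. -/
theorem isConnectedSum_glue (X Y : MarkedDiagram) :
    IsConnectedSum X.diagram Y.diagram (glue X Y) := by
  refine ⟨X.mark, Y.mark', Equiv.refl _, X.crossing, isCrossing_inv.2 Y.crossing, fun _ => rfl,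
    fun _ => rfl, fun _ => rfl, fun _ => rfl, ?_, glue_inv_inr_mark', ?_, ?_, ?_, ?_, ?_⟩
  · rw [Y.inv_mark']
    exact glue_inv_inl_mark
  · exact fun x h h' => glue_inv_inl h h'
  · intro z h h'
    rw [Y.inv_mark'] at h'
    exact glue_inv_inr h' h
  · exact fun x y => glue_region_inl_inl
  · exact fun x y => glue_region_inr_inr
  · intro x z
    rw [Y.inv_mark']
    exact glue_region_inl_inr

end MarkedDiagram

namespace LinkDiagram

/-! ### Moves that keep track of a dart -/

/-- The regions of `a` and `b` are equal after uniting those of `u` and `v`. -/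
def United (D : LinkDiagram) (u v a b : D.Dart) : Prop :=
  D.region a = D.region b ∨
    ((D.region a = D.region u ∨ D.region a = D.region v) ∧
      (D.region b = D.region u ∨ D.region b = D.region v))

theorem United.symm {D : LinkDiagram} {u v a b : D.Dart} (h : D.United u v a b) :
    D.United u v b a :=
  h.imp Eq.symm And.symm

theorem united_comm {D : LinkDiagram} {u v a b : D.Dart} :
    D.United u v a b ↔ D.United u v b a :=
  ⟨United.symm, United.symm⟩

/-- The corner between `t` and `rot t` is that of a kink that can be removed. -/
def IsOmega1Site (D : LinkDiagram) (t : D.Dart) : Prop :=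
  D.IsCrossing t ∧ D.inv t = D.rot t ∧ ∀ x, D.region x = D.region t ↔ x = t

/-- The corners at `t` and `s` are those of a bigon that can be removed. -/
def IsOmega2Site (D : LinkDiagram) (t s : D.Dart) : Prop :=
  D.IsCrossing t ∧ D.IsCrossing s ∧ s ∉ D.vertex t ∧ D.inv t = D.rot s ∧ D.inv s = D.rot t ∧
    (∀ x, D.region x = D.region t ↔ x = t ∨ x = s) ∧ D.isOver t = D.isOver (D.rot s)

/-- `D'` arises from `D` by the `Ω₃`-type move at the triangle `t`, with the given identifications
of darts and corners. -/
def Omega3With (D D' : LinkDiagram) (t : Fin 3 → D.Dart) (e : D.Dart ≃ D'.Dart)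
    (ρ π : D.Dart → D.Dart) : Prop :=
  D.IsOmega3Triangle t ∧
    (∀ i, ρ (t i) = D.rot (D.rot (D.rot (t (i + 1)))) ∧
      ρ (D.rot (D.rot (D.rot (t (i + 1))))) = t i ∧
      ρ (D.rot (D.rot (t i))) = D.rot (t (i + 1)) ∧
      ρ (D.rot (t (i + 1))) = D.rot (D.rot (t i))) ∧
    (∀ i, π (t i) = D.rot (D.rot (D.rot (t (i + 1)))) ∧
      π (D.rot (t i)) = D.rot (D.rot (t (i + 2))) ∧
      π (D.rot (D.rot (t i))) = t i ∧
      π (D.rot (D.rot (D.rot (t i)))) = D.rot (D.rot (t (i + 1)))) ∧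
    (∀ x, (∀ i, x ∉ D.vertex (t i)) → ρ x = x ∧ π x = x) ∧
    (∀ x, D'.rot (e x) = e (D.rot x)) ∧
    (∀ x, D'.inv (e x) = e (ρ (D.inv (ρ x)))) ∧
    (∀ x, D'.isOver (e x) = D.isOver x) ∧
    (∀ x y, D'.region (e x) = D'.region (e y) ↔ D.region (π x) = D.region (π y))

/-- The edge of the dart `m` of `D` becomes that of the dart `m'` of `D'` under the removal of
crossings given by `ι`, and it does not bound the removed region, that of `t`. -/
structure Tracks (D D' : LinkDiagram) (u v t : D.Dart) (ι : D'.Dart → D.Dart) (m : D.Dart)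
    (m' : D'.Dart) : Prop where
  mark : ι m' = m
  far : ∀ x, D'.region x = D'.region (D'.inv m') ↔ D.United u v (ι x) (D.inv m)
  left : D.region t ≠ D.region m
  right : D.region t ≠ D.region (D.inv m)

/-- A move that does not increase the number of crossings and turns the edge of `m` into the edge
of `m'`. -/
inductive TrackedMove (D : LinkDiagram) (m : D.Dart) (D' : LinkDiagram) (m' : D'.Dart) : Prop
  | isotopy (e : D.Dart ≃ D'.Dart) (hrot : ∀ x, e (D.rot x) = D'.rot (e x))
      (hinv : ∀ x, e (D.inv x) = D'.inv (e x)) (hover : ∀ x, D'.isOver (e x) = D.isOver x)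
      (hregion : ∀ x y, D'.region (e x) = D'.region (e y) ↔ D.region x = D.region y)
      (hm : e m = m')
  | omega1 (t : D.Dart) (ι : D'.Dart → D.Dart) (ht : D.IsOmega1Site t)
      (hι : D.Erases D' (D.vertex t) {t, D.rot t} (D.rot t) (D.rot t) ι)
      (hm : Tracks D D' (D.rot t) (D.rot t) t ι m m')
  | omega2 (t s : D.Dart) (ι : D'.Dart → D.Dart) (ht : D.IsOmega2Site t s)
      (hι : D.Erases D' (D.vertex t ∪ D.vertex s) {t, D.rot t, s, D.rot s}
        (D.rot (D.rot t)) (D.rot (D.rot s)) ι)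
      (hm : Tracks D D' (D.rot (D.rot t)) (D.rot (D.rot s)) t ι m m')
  | omega3 (t : Fin 3 → D.Dart) (e : D.Dart ≃ D'.Dart) (ρ π : D.Dart → D.Dart)
      (h : D.Omega3With D' t e ρ π) (hm : e m = m') (hl : ∀ i, m ∉ D.vertex (t i))
      (hr : ∀ i, D.inv m ∉ D.vertex (t i))

theorem TrackedMove.nonincreasingMove {D D' : LinkDiagram} {m : D.Dart} {m' : D'.Dart}
    (h : TrackedMove D m D' m') : NonincreasingMove D D' := by
  cases h with
  | isotopy e h1 h2 h3 h4 => exact .inl ⟨e, h1, h2, h3, h4⟩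
  | omega1 t ι ht hι => exact .inr (.inl ⟨t, ht.1, ht.2.1, ht.2.2, ι, hι⟩)
  | omega2 t s ι ht hι =>
    obtain ⟨h1, h2, h3, h4, h5, h6, h7⟩ := ht
    exact .inr (.inr (.inl ⟨t, s, h1, h2, h3, h4, h5, h6, h7, ι, hι⟩))
  | omega3 t e ρ π h => exact .inr (.inr (.inr ⟨t, e, ρ, π, h⟩))

/-- An edge both of whose ends survive is tracked. -/
theorem Erases.tracks {D D' : LinkDiagram} {S I : Set D.Dart} {u v t : D.Dart}
    {ι : D'.Dart → D.Dart} (h : D.Erases D' S I u v ι) {m : D.Dart} {m' : D'.Dart}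
    (hm : ι m' = m) (hm' : ι (D'.inv m') = D.inv m) (hl : D.region t ≠ D.region m)
    (hr : D.region t ≠ D.region (D.inv m)) : Tracks D D' u v t ι m m' :=
  ⟨hm, fun x => by rw [h.regions, hm']; rfl, hl, hr⟩

/-- Outside of the triangle, `ρ` does not meet its vertices. -/
theorem Omega3With.exists_mem_vertex {D D' : LinkDiagram} {t : Fin 3 → D.Dart}
    {e : D.Dart ≃ D'.Dart} {ρ π : D.Dart → D.Dart} (h : D.Omega3With D' t e ρ π) {x : D.Dart}
    (hx : ∃ i, x ∈ D.vertex (t i)) :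
    (∃ i, ρ x ∈ D.vertex (t i)) ∧ ∃ i, π x ∈ D.vertex (t i) := by
  obtain ⟨-, h1, h2, -⟩ := h
  obtain ⟨i, hi⟩ := hx
  have hv : ∀ j, t j ∈ D.vertex (t j) ∧ D.rot (t j) ∈ D.vertex (t j) ∧
      D.rot (D.rot (t j)) ∈ D.vertex (t j) ∧ D.rot (D.rot (D.rot (t j))) ∈ D.vertex (t j) :=
    fun j => ⟨.inl rfl, .inr (.inl rfl), .inr (.inr (.inl rfl)), .inr (.inr (.inr rfl))⟩
  -- The values of `ρ` at `rot (t i)` and at `rot³ (t i)` are listed under the preceding corner,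
  -- which is `i + 2` in `Fin 3`.
  have h12 : i + 2 + 1 = i := by rw [add_assoc]; simp
  have h3 := h1 (i + 2)
  rw [h12] at h3
  rcases hi with rfl | rfl | rfl | rfl
  · exact ⟨⟨i + 1, by rw [(h1 i).1]; exact (hv _).2.2.2⟩,
      ⟨i + 1, by rw [(h2 i).1]; exact (hv _).2.2.2⟩⟩
  · exact ⟨⟨i + 2, by rw [h3.2.2.2]; exact (hv _).2.2.1⟩,
      ⟨i + 2, by rw [(h2 i).2.1]; exact (hv _).2.2.1⟩⟩
  · exact ⟨⟨i + 1, by rw [(h1 i).2.2.1]; exact (hv _).2.1⟩,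
      ⟨i, by rw [(h2 i).2.2.1]; exact (hv _).1⟩⟩
  · exact ⟨⟨i + 2, by rw [h3.2.1]; exact (hv _).1⟩,
      ⟨i + 1, by rw [(h2 i).2.2.2]; exact (hv _).2.2.1⟩⟩

end LinkDiagram

/-! ### Removal of crossings in a summand -/

namespace MarkedDiagram

open LinkDiagram

variable {X X' Y : MarkedDiagram}

/-- The identification of darts of a sum induced by one of the first summand. -/
def glueMap (ι : X'.diagram.Dart → X.diagram.Dart) (w : (glue X' Y).Dart) : (glue X Y).Dart :=
  Sum.map ι id w

@[simp] theorem glueMap_inl (ι : X'.diagram.Dart → X.diagram.Dart) (x : X'.diagram.Dart) :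
    glueMap ι (inl X' Y x) = inl X Y (ι x) := rfl

@[simp] theorem glueMap_inr (ι : X'.diagram.Dart → X.diagram.Dart) (z : Y.diagram.Dart) :
    glueMap ι (inr X' Y z) = inr X Y z := rfl

theorem glue_vertex_inl (x : X.diagram.Dart) :
    (glue X Y).vertex (inl X Y x) = inl X Y '' X.diagram.vertex x := by
  simp [vertex, Set.image_insert_eq]

theorem glue_vertex_inr (z : Y.diagram.Dart) :
    (glue X Y).vertex (inr X Y z) = inr X Y '' Y.diagram.vertex z := by
  simp [vertex, Set.image_insert_eq]

@[simp] theorem inl_mem_image {S : Set X.diagram.Dart} {x : X.diagram.Dart} :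
    inl X Y x ∈ inl X Y '' S ↔ x ∈ S :=
  Sum.inl_injective.mem_set_image

@[simp] theorem inr_notMem_image {S : Set X.diagram.Dart} {z : Y.diagram.Dart} :
    inr X Y z ∉ inl X Y '' S := by
  rintro ⟨x, -, h⟩
  exact inl_ne_inr h

/-- A strand of the first summand through crossings that do not contain the mark, in the sum. -/
theorem travels_glue {S : Set X.diagram.Dart} (hS : ∀ x ∈ S, X.diagram.rot x ∈ S)
    (hm : X.mark ∉ S) {x w : X.diagram.Dart} (h : X.diagram.Travels S x w) (hx : x ≠ X.mark) :
    (w = X.mark ∧ (glue X Y).Travels (inl X Y '' S) (inl X Y x) (inr X Y Y.mark')) ∨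
      (w ≠ X.mark ∧ (glue X Y).Travels (inl X Y '' S) (inl X Y x) (inl X Y w)) := by
  induction h with
  | edge =>
    by_cases h' : x = X.mark'
    · refine .inl ⟨by rw [h', X.inv_mark'], ?_⟩
      rw [← glue_inv_inl_mark', ← h']
      exact .edge
    · refine .inr ⟨mt X.inv_eq_mark_iff.1 h', ?_⟩
      rw [← glue_inv_inl hx h']
      exact .edge
  | @pass y _ hy ih =>
    rcases ih with ⟨rfl, -⟩ | ⟨-, ih⟩
    · exact absurd hy hm
    have h2 := hS _ (hS _ hy)
    have h2' : X.diagram.rot (X.diagram.rot y) ≠ X.mark := fun h => hm (h ▸ h2)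
    have hp := Travels.pass ih (inl_mem_image.2 hy)
    simp only [glue_rot_inl] at hp
    by_cases h' : X.diagram.rot (X.diagram.rot y) = X.mark'
    · refine .inl ⟨by rw [h', X.inv_mark'], ?_⟩
      rwa [h', glue_inv_inl_mark'] at hp
    · refine .inr ⟨mt X.inv_eq_mark_iff.1 h', ?_⟩
      rwa [glue_inv_inl h2' h'] at hp

/-- In the sum, the edge of `X.mark` is cut, and the rest of a strand leaving there is entered from
`Y.mark'`. The exceptional case is a strand that closes up at `X.mark`. -/
theorem travels_glue_mark {S : Set X.diagram.Dart} (hS : ∀ x ∈ S, X.diagram.rot x ∈ S)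
    (hm : X.mark ∉ S) {w : X.diagram.Dart} (h : X.diagram.Travels S X.mark w) :
    w = X.mark ∨ (glue X Y).Travels (inl X Y '' S) (inr X Y Y.mark') (inl X Y w) := by
  induction h with
  | edge =>
    right
    have h := Travels.edge (D := glue X Y) (S := inl X Y '' S) (x := inr X Y Y.mark')
    rwa [glue_inv_inr_mark'] at h
  | @pass y _ hy ih =>
    rcases ih with rfl | ih
    · exact absurd hy hm
    have h2 := hS _ (hS _ hy)
    have h2' : X.diagram.rot (X.diagram.rot y) ≠ X.mark := fun h => hm (h ▸ h2)
    have hp := Travels.pass ih (inl_mem_image.2 hy)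
    simp only [glue_rot_inl] at hp
    by_cases h' : X.diagram.rot (X.diagram.rot y) = X.mark'
    · exact .inl (by rw [h', X.inv_mark'])
    · rw [glue_inv_inl h2' h'] at hp
      exact .inr hp

theorem sameComponent_inl {x x' : X.diagram.Dart} (h : X.diagram.SameComponent x x') :
    (glue X Y).SameComponent (inl X Y x) (inl X Y x') := by
  refine Relation.EqvGen.map (inl X Y) ?_ h
  rintro a b (rfl | rfl)
  · exact eqvGen_inl X Y (fun z => .rel _ _ (.inr rfl)) (fun w => .rel _ _ (.inl rfl)) a
  · exact .rel _ _ (.inr rfl)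

/-- The dart of the mark survives, so the second summand is inserted in front of all removed
crossings that the marked edge runs through. The far end of the marked edge may become another dart;
only the region on its side has to be controlled, by `hfar`. -/
theorem erases_glue {S I : Set X.diagram.Dart} {u v : X.diagram.Dart}
    {ι : X'.diagram.Dart → X.diagram.Dart} (h : X.diagram.Erases X'.diagram S I u v ι)
    (hS : ∀ x ∈ S, X.diagram.rot x ∈ S) (hm : ι X'.mark = X.mark)
    (hfar : ∀ x, X'.diagram.region x = X'.diagram.region X'.mark' ↔
      X.diagram.United u v (ι x) X.mark') :
    (glue X Y).Erases (glue X' Y) (inl X Y '' S) (inl X Y '' I) (inl X Y u) (inl X Y v)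
      (glueMap ι) := by
  have hmS : X.mark ∉ S := hm ▸ (h.crossing _ X'.crossing).2.1
  constructor
  · exact Sum.map_injective.2 ⟨h.injective, Function.injective_id⟩
  · intro w
    induction w using glue_cases with
    | hl x =>
      intro hx
      obtain ⟨h1, h2, h3, h4, h5⟩ := h.crossing x (glue_isCrossing_inl.1 hx)
      refine ⟨glue_isCrossing_inl.2 h1, by simpa using h2, by simp [h3], by simp [h4], ?_⟩
      by_cases hx1 : x = X'.mark
      · rw [hx1, glue_inv_inl_mark, glueMap_inl, glueMap_inr, hm, ← glue_inv_inl_mark]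
        exact .edge
      have hx1' : ι x ≠ X.mark := fun h' => hx1 (h.injective (h'.trans hm.symm))
      by_cases hx2 : x = X'.mark'
      · rw [hx2, glue_inv_inl_mark', glueMap_inl, glueMap_inr, ← hx2]
        rw [hx2, X'.inv_mark', hm, ← hx2] at h5
        rcases travels_glue hS hmS h5 hx1' with h6 | h6
        · exact h6.2
        · exact absurd rfl h6.1
      · rw [glue_inv_inl hx1 hx2, glueMap_inl, glueMap_inl]
        rcases travels_glue hS hmS h5 hx1' with h6 | h6
        · exact absurd (X'.inv_eq_mark_iff.1 (h.injective (h6.1.trans hm.symm))) hx2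
        · exact h6.2
    | hr z =>
      intro hz
      refine ⟨glue_isCrossing_inr.2 (glue_isCrossing_inr.1 hz), by simp, rfl, rfl, ?_⟩
      by_cases hz1 : z = Y.mark
      · rw [hz1, glue_inv_inr_mark, glueMap_inl, glueMap_inr, hm, ← glue_inv_inr_mark]
        exact .edge
      by_cases hz2 : z = Y.mark'
      · rw [hz2, glue_inv_inr_mark', glueMap_inl, glueMap_inr]
        have h5 := (h.crossing _ X'.crossing).2.2.2.2
        rw [hm] at h5
        rcases travels_glue_mark hS hmS h5 with h6 | h6
        · exact absurd (h.injective (h6.trans hm.symm)) X'.mark'_ne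
        · exact h6
      · rw [glue_inv_inr hz1 hz2, glueMap_inr, glueMap_inr, ← glue_inv_inr hz1 hz2]
        exact .edge
  · intro w
    induction w using glue_cases with
    | hl x =>
      intro hx
      have hx' : ¬ X'.diagram.IsCrossing x := fun h' => hx (glue_isCrossing_inl.2 h')
      obtain ⟨h1, h2, h3, h4⟩ := h.circle x hx'
      have hx1 : x ≠ X'.mark := fun h' => hx' (h' ▸ X'.crossing)
      have hx2 : x ≠ X'.mark' := fun h' => hx' (by rw [h']; exact isCrossing_inv.2 X'.crossing)
      -- A component that becomes a free circle cannot contain the mark, which still ends at a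
      -- crossing.
      have hnc : ¬ X.diagram.SameComponent (ι x) X.mark := fun h' => by
        rw [← hm] at h'
        rcases h4 _ h' with h5 | h5
        · exact hx1 h5.symm
        · exact hx2 (X'.inv_eq_mark_iff.1 h5.symm)
      have hnc' : ¬ X.diagram.SameComponent (ι x) X.mark' := fun h' =>
        hnc (h'.trans _ _ _ (.rel _ _ (.inl X.inv_mark'.symm)))
      refine ⟨fun h' => by simpa using h1 (glue_isCrossing_inl.1 h'), by simpa using h2, ?_, ?_⟩
      · rw [glue_inv_inl hx1 hx2, glueMap_inl, glueMap_inl, glue_inv_inl, h3]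
        · exact fun h' => hnc (h' ▸ .refl _)
        · exact fun h' => hnc' (by rw [h']; exact .refl _)
      · intro w hw
        have key : ∃ a, glueMap ι w = inl X Y a ∧ X.diagram.SameComponent (ι x) a := by
          refine (Relation.EqvGen.mem_iff
            (P := fun w => ∃ a, w = inl X Y a ∧ X.diagram.SameComponent (ι x) a) ?_ hw).1
            ⟨ι x, rfl, .refl _⟩
          have hstep : ∀ a b, ((b = (glue X Y).inv a) ∨ b = (glue X Y).rot ((glue X Y).rot a)) →
              (∃ c, a = inl X Y c ∧ X.diagram.SameComponent (ι x) c) →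
              ∃ c, b = inl X Y c ∧ X.diagram.SameComponent (ι x) c := by
            rintro a b (rfl | rfl) ⟨c, rfl, hc⟩
            · refine ⟨X.diagram.inv c, glue_inv_inl ?_ ?_, hc.trans _ _ _ (.rel _ _ (.inl rfl))⟩
              · rintro rfl; exact hnc hc
              · rintro rfl; exact hnc' hc
            · exact ⟨_, rfl, hc.trans _ _ _ (.rel _ _ (.inr rfl))⟩
          intro a b hab
          refine ⟨hstep a b hab, hstep b a ?_⟩
          rcases hab with rfl | rfl
          · exact .inl ((glue X Y).inv_inv a).symm
          · exact .inr ((glue X Y).rot_four a).symm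
        obtain ⟨a, ha, hc⟩ := key
        induction w using glue_cases with
        | hl y =>
          have hya : ι y = a := inl_inj.1 ha
          rw [glue_inv_inl hx1 hx2, inl_inj, inl_inj]
          exact h4 y (by rw [hya]; exact hc)
        | hr z => exact absurd ha inr_ne_inl
    | hr z =>
      intro hz
      have hz' : ¬ Y.diagram.IsCrossing z := fun h' => hz (glue_isCrossing_inr.2 h')
      have hz0 : Y.diagram.rot (Y.diagram.rot z) = z := not_not.1 hz'
      have hz1 : z ≠ Y.mark := fun h' => hz' (h' ▸ Y.crossing)
      have hz2 : z ≠ Y.mark' := fun h' => hz' (by rw [h']; exact isCrossing_inv.2 Y.crossing)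
      have hz3 : Y.diagram.inv z ≠ Y.mark := mt Y.inv_eq_mark_iff.1 hz2
      have hz4 : Y.diagram.inv z ≠ Y.mark' := mt Y.inv_eq_mark'_iff.1 hz1
      refine ⟨fun h' => absurd (glue_isCrossing_inr.1 h') hz', by simp, ?_, ?_⟩
      · rw [glue_inv_inr hz1 hz2, glueMap_inr, glueMap_inr, glue_inv_inr hz1 hz2]
      · intro w hw
        rw [glueMap_inr] at hw
        have key : glueMap ι w = inr X Y z ∨ glueMap ι w = inr X Y (Y.diagram.inv z) := by
          refine (Relation.EqvGen.mem_iff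
            (P := fun w => w = inr X Y z ∨ w = inr X Y (Y.diagram.inv z)) ?_ hw).1 (.inl rfl)
          have hr' : Y.diagram.rot (Y.diagram.rot (Y.diagram.inv z)) = Y.diagram.inv z := by
            rw [← Y.diagram.free_circle z hz0, hz0]
          have hstep : ∀ a b, ((b = (glue X Y).inv a) ∨ b = (glue X Y).rot ((glue X Y).rot a)) →
              (a = inr X Y z ∨ a = inr X Y (Y.diagram.inv z)) →
              (b = inr X Y z ∨ b = inr X Y (Y.diagram.inv z)) := by
            rintro a b (rfl | rfl) (rfl | rfl)
            · exact .inr (glue_inv_inr hz1 hz2)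
            · rw [glue_inv_inr hz3 hz4, Y.diagram.inv_inv]; exact .inl rfl
            · rw [glue_rot_inr, glue_rot_inr, hz0]; exact .inl rfl
            · rw [glue_rot_inr, glue_rot_inr, hr']; exact .inr rfl
          intro a b hab
          refine ⟨hstep a b hab, hstep b a ?_⟩
          rcases hab with rfl | rfl
          · exact .inl ((glue X Y).inv_inv a).symm
          · exact .inr ((glue X Y).rot_four a).symm
        induction w using glue_cases with
        | hl y => simp at key
        | hr z' => simpa [glue_inv_inr hz1 hz2] using key
  · intro w
    induction w using glue_cases with
    | hl x =>
      intro hx hxS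
      obtain ⟨x', hx'⟩ := h.surviving x (glue_isCrossing_inl.1 hx) (by simpa using hxS)
      exact ⟨inl X' Y x', by rw [glueMap_inl, hx']⟩
    | hr z => exact fun _ _ => ⟨inr X' Y z, rfl⟩
  · intro w
    induction w using glue_cases with
    | hl x =>
      obtain ⟨x', hx'⟩ := h.components x
      exact ⟨inl X' Y x', sameComponent_inl hx'⟩
    | hr z => exact ⟨inr X' Y z, .refl _⟩
  · have hreg := h.regions
    have hll : ∀ a b, (glue X' Y).region (inl X' Y a) = (glue X' Y).region (inl X' Y b) ↔
        (glue X Y).United (inl X Y u) (inl X Y v) (inl X Y (ι a)) (inl X Y (ι b)) := by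
      intro a b
      simp only [United, glue_region_inl_inl]
      exact hreg a b
    have hlf : ∀ a, (glue X' Y).region (inl X' Y a) = (glue X' Y).region (inl X' Y X'.mark') ↔
        (glue X Y).United (inl X Y u) (inl X Y v) (inl X Y (ι a)) (inl X Y X.mark') := by
      intro a
      simp only [United, glue_region_inl_inl]
      exact hfar a
    have hlm : ∀ a, (glue X' Y).region (inl X' Y a) = (glue X' Y).region (inl X' Y X'.mark) ↔
        (glue X Y).United (inl X Y u) (inl X Y v) (inl X Y (ι a)) (inl X Y X.mark) := by
      intro a
      rw [hll, hm]
    -- Otherwise the marked edge of `X'` would have the same region on both sides.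
    have hmm' : ¬ (glue X Y).United (inl X Y u) (inl X Y v) (inl X Y X.mark) (inl X Y X.mark') := by
      rw [← hm, ← hlf, glue_region_inl_inl]
      exact X'.separating
    have hun : ∀ {a b a' b' : (glue X Y).Dart}, (glue X Y).region a = (glue X Y).region a' →
        (glue X Y).region b = (glue X Y).region b' →
        ((glue X Y).United (inl X Y u) (inl X Y v) a b ↔
          (glue X Y).United (inl X Y u) (inl X Y v) a' b') := by
      intro a b a' b' h1 h2
      simp only [United, h1, h2]
    have hlr : ∀ a z, (glue X' Y).region (inl X' Y a) = (glue X' Y).region (inr X' Y z) ↔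
        (glue X Y).United (inl X Y u) (inl X Y v) (inl X Y (ι a)) (inr X Y z) := by
      intro a z
      by_cases h1 : Y.diagram.region z = Y.diagram.region Y.mark
      · rw [glue_region_inr_of_eq_mark h1, hlf, hun rfl (glue_region_inr_of_eq_mark h1)]
      by_cases h2 : Y.diagram.region z = Y.diagram.region Y.mark'
      · rw [glue_region_inr_of_eq_mark' h2, hlm, hun rfl (glue_region_inr_of_eq_mark' h2)]
      · have h3 := fun x => glue_region_inr_of_ne (X := X) h1 h2 x
        simp only [United, h3, and_false, or_false, (h3 _).symm,
          (glue_region_inr_of_ne h1 h2 a).symm]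
    intro w w'
    change _ ↔ (glue X Y).United _ _ _ _
    induction w using glue_cases with
    | hl a =>
      induction w' using glue_cases with
      | hl b => exact hll a b
      | hr z => exact hlr a z
    | hr z =>
      induction w' using glue_cases with
      | hl b => rw [eq_comm, united_comm]; exact hlr b z
      | hr z' =>
        rw [glue_region_inr_inr, glueMap_inr, glueMap_inr]
        constructor
        · exact fun h' => .inl (glue_region_inr_inr.2 h')
        · rintro (h' | ⟨h1, h2⟩)
          · exact glue_region_inr_inr.1 h'
          · have hp : ∀ z, ((glue X Y).region (inr X Y z) = (glue X Y).region (inl X Y u) ∨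
                (glue X Y).region (inr X Y z) = (glue X Y).region (inl X Y v)) →
                Y.diagram.region z = Y.diagram.region Y.mark ∧
                  ((glue X Y).region (inl X Y X.mark') = (glue X Y).region (inl X Y u) ∨
                  (glue X Y).region (inl X Y X.mark') = (glue X Y).region (inl X Y v)) ∨
                Y.diagram.region z = Y.diagram.region Y.mark' ∧
                  ((glue X Y).region (inl X Y X.mark) = (glue X Y).region (inl X Y u) ∨
                  (glue X Y).region (inl X Y X.mark) = (glue X Y).region (inl X Y v)) := by
              intro z hz
              by_cases h1 : Y.diagram.region z = Y.diagram.region Y.mark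
              · rw [glue_region_inr_of_eq_mark h1] at hz
                exact .inl ⟨h1, hz⟩
              by_cases h2 : Y.diagram.region z = Y.diagram.region Y.mark'
              · rw [glue_region_inr_of_eq_mark' h2] at hz
                exact .inr ⟨h2, hz⟩
              · simp [glue_region_inr_of_ne h1 h2] at hz
            rcases hp z h1 with ⟨e1, f1⟩ | ⟨e1, f1⟩ <;> rcases hp z' h2 with ⟨e2, f2⟩ | ⟨e2, f2⟩
            · rw [e1, e2]
            · exact absurd (.inr ⟨f2, f1⟩) hmm'
            · exact absurd (.inr ⟨f1, f2⟩) hmm'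
            · rw [e1, e2]

end MarkedDiagram

/-! ### Reidemeister moves on a summand as moves on the sum -/

namespace MarkedDiagram

open LinkDiagram

variable {X X' Y : MarkedDiagram}

theorem glue_inv_inl_eq {x x' : X.diagram.Dart} (h : X.diagram.inv x = x') (h₁ : x ≠ X.mark)
    (h₂ : x ≠ X.mark') : (glue X Y).inv (inl X Y x) = inl X Y x' := by
  rw [glue_inv_inl h₁ h₂, h]

theorem ne_mark_of_region_ne {t : X.diagram.Dart}
    (h : X.diagram.region t ≠ X.diagram.region X.mark) : t ≠ X.mark :=
  fun e => h (by rw [e])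

theorem ne_mark'_of_region_ne {t : X.diagram.Dart}
    (h : X.diagram.region t ≠ X.diagram.region X.mark') : t ≠ X.mark' :=
  fun e => h (by rw [e])

/-- A region of the first summand that is not adjacent to the mark does not change. -/
theorem glue_region_inr_ne_inl {t : X.diagram.Dart}
    (h : X.diagram.region t ≠ X.diagram.region X.mark)
    (h' : X.diagram.region t ≠ X.diagram.region X.mark') (z : Y.diagram.Dart) :
    (glue X Y).region (inr X Y z) ≠ (glue X Y).region (inl X Y t) := by
  rw [ne_comm, Ne, glue_region_inl_inr]
  simp [h, h']

/-- Since the disk of the kink is not adjacent to the marked edge, its boundary is not cut and it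
acquires no corners of the second summand. The same reason works for bigons. -/
theorem isOmega1Site_glue {t : X.diagram.Dart} (ht : X.diagram.IsOmega1Site t)
    (h : X.diagram.region t ≠ X.diagram.region X.mark)
    (h' : X.diagram.region t ≠ X.diagram.region X.mark') :
    (glue X Y).IsOmega1Site (inl X Y t) := by
  obtain ⟨h1, h2, h3⟩ := ht
  refine ⟨glue_isCrossing_inl.2 h1,
    glue_inv_inl_eq h2 (ne_mark_of_region_ne h) (ne_mark'_of_region_ne h'), fun w => ?_⟩
  induction w using glue_cases with
  | hl x => simp [h3]
  | hr z => simp [glue_region_inr_ne_inl h h']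

theorem isOmega2Site_glue {t s : X.diagram.Dart} (ht : X.diagram.IsOmega2Site t s)
    (h : X.diagram.region t ≠ X.diagram.region X.mark)
    (h' : X.diagram.region t ≠ X.diagram.region X.mark') :
    (glue X Y).IsOmega2Site (inl X Y t) (inl X Y s) := by
  obtain ⟨h1, h2, h3, h4, h5, h6, h7⟩ := ht
  have hs : X.diagram.region s = X.diagram.region t := (h6 s).2 (.inr rfl)
  refine ⟨glue_isCrossing_inl.2 h1, glue_isCrossing_inl.2 h2,
    by rw [glue_vertex_inl]; simpa using h3,
    glue_inv_inl_eq h4 (ne_mark_of_region_ne h) (ne_mark'_of_region_ne h'),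
    glue_inv_inl_eq h5 (ne_mark_of_region_ne (hs ▸ h)) (ne_mark'_of_region_ne (hs ▸ h')),
    fun w => ?_, h7⟩
  induction w using glue_cases with
  | hl x => simp [h6]
  | hr z => simp [glue_region_inr_ne_inl h h']

/-- Both ends of a joining edge are tracked: the one in `X` for moves on the first summand, the one
in `Y` for moves on the second summand, after an exchange of the two. -/
theorem tracks_glue {S I : Set X.diagram.Dart} {u v t : X.diagram.Dart}
    {ι : X'.diagram.Dart → X.diagram.Dart}
    (hE : (glue X Y).Erases (glue X' Y) (inl X Y '' S) (inl X Y '' I) (inl X Y u) (inl X Y v)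
      (glueMap ι))
    (hT : Tracks X.diagram X'.diagram u v t ι X.mark X'.mark) :
    Tracks (glue X Y) (glue X' Y) (inl X Y u) (inl X Y v) (inl X Y t) (glueMap ι)
        (inl X Y X.mark) (inl X' Y X'.mark) ∧
      Tracks (glue X Y) (glue X' Y) (inl X Y u) (inl X Y v) (inl X Y t) (glueMap ι)
        (inr X Y Y.mark) (inr X' Y Y.mark) := by
  have h1 : (glue X Y).region (inl X Y t) ≠ (glue X Y).region (inl X Y X.mark) := by
    rw [Ne, glue_region_inl_inl]
    exact hT.left
  have h2 := (glue_region_inr_ne_inl (Y := Y) hT.left hT.right Y.mark).symm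
  constructor
  · exact hE.tracks (by rw [glueMap_inl, hT.mark])
      (by rw [glue_inv_inl_mark, glueMap_inr, glue_inv_inl_mark]) h1
      (by rw [glue_inv_inl_mark]; exact h2)
  · exact hE.tracks (by rw [glueMap_inr])
      (by rw [glue_inv_inr_mark, glueMap_inl, glue_inv_inr_mark, hT.mark]) h2
      (by rw [glue_inv_inr_mark]; exact h1)

/-- The identification of darts of a sum induced by one of the first summand, as a bijection. -/
def glueEquiv (Y : MarkedDiagram) (e : X.diagram.Dart ≃ X'.diagram.Dart) :
    (glue X Y).Dart ≃ (glue X' Y).Dart :=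
  Equiv.sumCongr e (Equiv.refl _)

@[simp] theorem glueEquiv_inl (e : X.diagram.Dart ≃ X'.diagram.Dart) (x : X.diagram.Dart) :
    glueEquiv Y e (inl X Y x) = inl X' Y (e x) := rfl

@[simp] theorem glueEquiv_inr (e : X.diagram.Dart ≃ X'.diagram.Dart) (z : Y.diagram.Dart) :
    glueEquiv Y e (inr X Y z) = inr X' Y z := rfl

/-- Comparing regions of different summands involves only the two sides of the mark, which `e` and
`π` respect. Isotopies use `π = id`, and `Ω₃`-type moves use their map on corners. -/
theorem region_glueEquiv {e : X.diagram.Dart ≃ X'.diagram.Dart}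
    {π : X.diagram.Dart → X.diagram.Dart}
    (h : ∀ x y, X'.diagram.region (e x) = X'.diagram.region (e y) ↔
      X.diagram.region (π x) = X.diagram.region (π y))
    (he : e X.mark = X'.mark) (he' : e X.mark' = X'.mark') (hπ : π X.mark = X.mark)
    (hπ' : π X.mark' = X.mark') (w w' : (glue X Y).Dart) :
    (glue X' Y).region (glueEquiv Y e w) = (glue X' Y).region (glueEquiv Y e w') ↔
      (glue X Y).region (glueMap π w) = (glue X Y).region (glueMap π w') := by
  have key : ∀ x z, (glue X' Y).region (inl X' Y (e x)) = (glue X' Y).region (inr X' Y z) ↔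
      (glue X Y).region (inl X Y (π x)) = (glue X Y).region (inr X Y z) := by
    intro x z
    rw [glue_region_inl_inr, glue_region_inl_inr, ← he, ← he', h, h, hπ, hπ']
  induction w using glue_cases with
  | hl x =>
    induction w' using glue_cases with
    | hl y => simpa using h x y
    | hr z => exact key x z
  | hr z =>
    induction w' using glue_cases with
    | hl y => rw [eq_comm, eq_comm (a := (glue X Y).region _)]; exact key y z
    | hr z' => simp

/-- The region of a triangle has no corners besides the three `t i`. If no end of the mark is among
them, the triangle is not adjacent to the marked edge. -/
theorem isOmega3Triangle_glue {t : Fin 3 → X.diagram.Dart} (h : X.diagram.IsOmega3Triangle t)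
    (hm : ∀ i, X.mark ∉ X.diagram.vertex (t i)) (hm' : ∀ i, X.mark' ∉ X.diagram.vertex (t i)) :
    (glue X Y).IsOmega3Triangle fun i => inl X Y (t i) := by
  have ne : ∀ i, t i ≠ X.mark ∧ t i ≠ X.mark' := fun i =>
    ⟨fun h => hm i (h ▸ X.diagram.mem_vertex_self _),
      fun h => hm' i (h ▸ X.diagram.mem_vertex_self _)⟩
  have r1 : X.diagram.region (t 0) ≠ X.diagram.region X.mark := fun h' => by
    obtain ⟨i, hi⟩ := (h.disk _).1 h'.symm
    exact (ne i).1 hi.symm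
  have r2 : X.diagram.region (t 0) ≠ X.diagram.region X.mark' := fun h' => by
    obtain ⟨i, hi⟩ := (h.disk _).1 h'.symm
    exact (ne i).2 hi.symm
  refine ⟨fun i => glue_isCrossing_inl.2 (h.crossing i), fun i j hij => ?_,
    fun i => glue_inv_inl_eq (h.edge i) (ne i).1 (ne i).2, fun w => ?_, h.not_cyclic⟩
  · rw [glue_vertex_inl]
    simpa using h.distinct i j hij
  · induction w using glue_cases with
    | hl x => simp [h.disk]
    | hr z => simp [glue_region_inr_ne_inl r1 r2]

theorem omega3With_glue {t : Fin 3 → X.diagram.Dart} {e : X.diagram.Dart ≃ X'.diagram.Dart}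
    {ρ π : X.diagram.Dart → X.diagram.Dart} (h : X.diagram.Omega3With X'.diagram t e ρ π)
    (he : e X.mark = X'.mark) (hm : ∀ i, X.mark ∉ X.diagram.vertex (t i))
    (hm' : ∀ i, X.mark' ∉ X.diagram.vertex (t i)) :
    (glue X Y).Omega3With (glue X' Y) (fun i => inl X Y (t i)) (glueEquiv Y e)
      (glueMap ρ) (glueMap π) := by
  have hv := @h.exists_mem_vertex
  obtain ⟨h1, h2, h3, h4, h5, h6, h7, h8⟩ := h
  obtain ⟨ρm, πm⟩ := h4 _ hm
  obtain ⟨ρm', πm'⟩ := h4 _ hm'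
  -- `ρ` sends the darts at the triangle to darts at the triangle and fixes all others, so nothing
  -- else is sent to an end of the mark.
  have ρ_eq : ∀ {x m}, (∀ i, m ∉ X.diagram.vertex (t i)) → (ρ x = m ↔ x = m) := by
    intro x m hm
    by_cases hx : ∃ i, x ∈ X.diagram.vertex (t i)
    · refine iff_of_false (fun h => ?_) fun h => ?_
      · obtain ⟨i, hi⟩ := (hv hx).1
        exact hm i (h ▸ hi)
      · obtain ⟨i, hi⟩ := hx
        exact hm i (h ▸ hi)
    · rw [(h4 x (not_exists.1 hx)).1]
  have he' : e X.mark' = X'.mark' := by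
    have := h6 X.mark
    rw [ρm, ρm', he] at this
    exact this.symm
  refine ⟨isOmega3Triangle_glue h1 hm hm', fun i => ?_, fun i => ?_, fun w hw => ?_, fun w => ?_,
    fun w => ?_, fun w => ?_, region_glueEquiv h8 he he' πm πm'⟩
  · simp [h2 i]
  · simp [h3 i]
  · induction w using glue_cases with
    | hl x =>
      have := h4 x fun i => by simpa [glue_vertex_inl] using hw i
      simp [this]
    | hr z => simp
  · induction w using glue_cases with
    | hl x => simp [h5]
    | hr z => simp
  · induction w using glue_cases with
    | hl x =>
      by_cases hx : x = X.mark
      · rw [hx, glueEquiv_inl, he, glue_inv_inl_mark, glueMap_inl, ρm, glue_inv_inl_mark]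
        rfl
      by_cases hx' : x = X.mark'
      · rw [hx', glueEquiv_inl, he', glue_inv_inl_mark', glueMap_inl, ρm', glue_inv_inl_mark']
        rfl
      · rw [glueEquiv_inl, glue_inv_inl, glueMap_inl, glue_inv_inl, glueMap_inl, glueEquiv_inl, h6]
        · rwa [Ne, ρ_eq hm]
        · rwa [Ne, ρ_eq hm']
        · rwa [Ne, ← he, e.injective.eq_iff]
        · rwa [Ne, ← he', e.injective.eq_iff]
    | hr z =>
      by_cases hz : z = Y.mark
      · rw [hz, glueEquiv_inr, glue_inv_inr_mark, glueMap_inr, glue_inv_inr_mark, glueMap_inl, ρm,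
          glueEquiv_inl, he]
      by_cases hz' : z = Y.mark'
      · rw [hz', glueEquiv_inr, glue_inv_inr_mark', glueMap_inr, glue_inv_inr_mark', glueMap_inl,
          ρm', glueEquiv_inl, he']
      · rw [glueEquiv_inr, glue_inv_inr hz hz', glueMap_inr, glue_inv_inr hz hz']
        rfl
  · induction w using glue_cases with
    | hl x => simp [h7]
    | hr z => simp

/-- A move of one summand that keeps the mark is a move of the sum. -/
theorem trackedMove_glue (h : TrackedMove X.diagram X.mark X'.diagram X'.mark) :
    TrackedMove (glue X Y) (inl X Y X.mark) (glue X' Y) (inl X' Y X'.mark) ∧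
      TrackedMove (glue X Y) (inr X Y Y.mark) (glue X' Y) (inr X' Y Y.mark) := by
  cases h with
  | isotopy e hrot hinv hover hregion hm =>
    have hm' : e X.mark' = X'.mark' := by rw [mark', hinv, hm]
    have h1 : ∀ w, glueEquiv Y e ((glue X Y).rot w) = (glue X' Y).rot (glueEquiv Y e w) := by
      intro w
      induction w using glue_cases with
      | hl x => simp [hrot]
      | hr z => simp
    have h2 : ∀ w, glueEquiv Y e ((glue X Y).inv w) = (glue X' Y).inv (glueEquiv Y e w) := by
      intro w
      induction w using glue_cases with
      | hl x =>
        by_cases hx : x = X.mark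
        · rw [hx, glueEquiv_inl, hm, glue_inv_inl_mark, glue_inv_inl_mark]; rfl
        by_cases hx' : x = X.mark'
        · rw [hx', glueEquiv_inl, hm', glue_inv_inl_mark', glue_inv_inl_mark']; rfl
        · rw [glueEquiv_inl, glue_inv_inl hx hx', glue_inv_inl, glueEquiv_inl, hinv]
          · rwa [Ne, ← hm, e.injective.eq_iff]
          · rwa [Ne, ← hm', e.injective.eq_iff]
      | hr z =>
        by_cases hz : z = Y.mark
        · rw [hz, glueEquiv_inr, glue_inv_inr_mark, glue_inv_inr_mark, glueEquiv_inl, hm]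
        by_cases hz' : z = Y.mark'
        · rw [hz', glueEquiv_inr, glue_inv_inr_mark', glue_inv_inr_mark', glueEquiv_inl, hm']
        · rw [glueEquiv_inr, glue_inv_inr hz hz', glue_inv_inr hz hz']; rfl
    have h3 : ∀ w, (glue X' Y).isOver (glueEquiv Y e w) = (glue X Y).isOver w := by
      intro w
      induction w using glue_cases with
      | hl x => simp [hover]
      | hr z => simp
    have h4 : ∀ w w', (glue X' Y).region (glueEquiv Y e w) = (glue X' Y).region (glueEquiv Y e w') ↔
        (glue X Y).region w = (glue X Y).region w' := by
      intro w w'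
      rw [region_glueEquiv (π := id) hregion hm hm' rfl rfl]
      have : ∀ w : (glue X Y).Dart, glueMap (X' := X) id w = w := fun w => by
        induction w using glue_cases <;> rfl
      rw [this, this]
    exact ⟨.isotopy _ h1 h2 h3 h4 (by simp [hm]), .isotopy _ h1 h2 h3 h4 (by simp)⟩
  | omega1 t ι ht hι hm =>
    have hE := erases_glue (Y := Y) hι (fun x hx => rot_mem_vertex hx) hm.mark hm.far
    have hs := isOmega1Site_glue (Y := Y) ht hm.left hm.right
    have hT := tracks_glue hE hm
    rw [← glue_vertex_inl, Set.image_pair] at hE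
    exact ⟨.omega1 _ _ hs hE hT.1, .omega1 _ _ hs hE hT.2⟩
  | omega2 t s ι ht hι hm =>
    have hE := erases_glue (Y := Y) hι
      (fun x hx => hx.imp (fun h => rot_mem_vertex h) fun h => rot_mem_vertex h) hm.mark hm.far
    have hs := isOmega2Site_glue (Y := Y) ht hm.left hm.right
    have hT := tracks_glue hE hm
    rw [Set.image_union, ← glue_vertex_inl, ← glue_vertex_inl, Set.image_insert_eq,
      Set.image_insert_eq, Set.image_pair] at hE
    exact ⟨.omega2 _ _ _ hs hE hT.1, .omega2 _ _ _ hs hE hT.2⟩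
  | omega3 t e ρ π h hm hl hr =>
    have hO := omega3With_glue (Y := Y) h hm hl hr
    constructor
    · exact .omega3 _ _ _ _ hO (by simp [hm]) (fun i => by simpa [glue_vertex_inl] using hl i)
        (fun i => by simp [glue_vertex_inl])
    · exact .omega3 _ _ _ _ hO (by simp) (fun i => by simp [glue_vertex_inl])
        (fun i => by simpa [glue_vertex_inl] using hl i)

/-- The identification of the darts of a sum after exchanging the summands. -/
def glueComm (X Y : MarkedDiagram) : (glue X Y).Dart ≃ (glue Y X).Dart :=
  Equiv.sumComm _ _

/-- Exchanging the summands is an isotopy. -/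
theorem isotopic_glueComm (X Y : MarkedDiagram) :
    (∀ w, glueComm X Y ((glue X Y).rot w) = (glue Y X).rot (glueComm X Y w)) ∧
    (∀ w, glueComm X Y ((glue X Y).inv w) = (glue Y X).inv (glueComm X Y w)) ∧
    (∀ w, (glue Y X).isOver (glueComm X Y w) = (glue X Y).isOver w) ∧
    ∀ w w', (glue Y X).region (glueComm X Y w) = (glue Y X).region (glueComm X Y w') ↔
      (glue X Y).region w = (glue X Y).region w' := by
  refine ⟨fun w => ?_, fun w => ?_, fun w => ?_, fun w w' => ?_⟩
  all_goals
    have hl : ∀ x, glueComm X Y (inl X Y x) = inr Y X x := fun _ => rfl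
    have hr : ∀ z, glueComm X Y (inr X Y z) = inl Y X z := fun _ => rfl
  · induction w using glue_cases with
    | hl x => rfl
    | hr z => rfl
  · induction w using glue_cases with
    | hl x =>
      by_cases hx : x = X.mark
      · rw [hx, glue_inv_inl_mark, hr, hl, glue_inv_inr_mark]
      by_cases hx' : x = X.mark'
      · rw [hx', glue_inv_inl_mark', hr, hl, glue_inv_inr_mark']
      · rw [glue_inv_inl hx hx', hl, hl, glue_inv_inr hx hx']
    | hr z =>
      by_cases hz : z = Y.mark
      · rw [hz, glue_inv_inr_mark, hr, hl, glue_inv_inl_mark]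
      by_cases hz' : z = Y.mark'
      · rw [hz', glue_inv_inr_mark', hr, hl, glue_inv_inl_mark']
      · rw [glue_inv_inr hz hz', hr, hr, glue_inv_inl hz hz']
  · induction w using glue_cases with
    | hl x => rfl
    | hr z => rfl
  · have key : ∀ x z, (glue Y X).region (inr Y X x) = (glue Y X).region (inl Y X z) ↔
        (glue X Y).region (inl X Y x) = (glue X Y).region (inr X Y z) := by
      intro x z
      rw [eq_comm, glue_region_inl_inr, glue_region_inl_inr]
      tauto
    induction w using glue_cases with
    | hl x =>
      induction w' using glue_cases with
      | hl y => rw [hl, hl, glue_region_inl_inl, glue_region_inr_inr]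
      | hr z => exact key x z
    | hr z =>
      induction w' using glue_cases with
      | hl y => rw [eq_comm, eq_comm (a := (glue X Y).region _)]; exact key y z
      | hr z' => rw [hr, hr, glue_region_inl_inl, glue_region_inr_inr]

theorem trackedMove_swap (X Y : MarkedDiagram) :
    TrackedMove (glue X Y) (inl X Y X.mark) (glue Y X) (inr Y X X.mark) :=
  have h := isotopic_glueComm X Y
  .isotopy (glueComm X Y) h.1 h.2.1 h.2.2.1 h.2.2.2 rfl

/-! ### Equivalence of marked diagrams -/

/-- Marked diagrams are equivalent if they are connected by moves that keep the mark. -/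
def Equivalent : MarkedDiagram → MarkedDiagram → Prop :=
  Relation.EqvGen fun X X' => TrackedMove X.diagram X.mark X'.diagram X'.mark

theorem Equivalent.sameLink (h : Equivalent X X') : SameLink X.diagram X'.diagram :=
  Relation.EqvGen.map diagram (fun _ _ h => .rel _ _ h.nonincreasingMove) h

theorem Equivalent.glue_left (h : Equivalent X X') (Y : MarkedDiagram) :
    Equivalent (markedGlue X Y) (markedGlue X' Y) :=
  Relation.EqvGen.map (markedGlue · Y) (fun _ _ h => .rel _ _ (trackedMove_glue h).1) h

/-- The sum with the summands exchanged. -/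
noncomputable def markedGlueSwap (X Y : MarkedDiagram) : MarkedDiagram where
  diagram := glue Y X
  mark := inr Y X X.mark
  crossing := glue_isCrossing_inr.2 X.crossing
  separating := by
    rw [glue_inv_inr_mark, ne_comm, Ne, glue_region_inl_inr]
    simp [X.separating, Y.separating]

/-- After an exchange of the summands, the moving one is the first, and the tracked dart belongs to
the one at rest. -/
theorem Equivalent.glue_right (X : MarkedDiagram) {Y Y' : MarkedDiagram} (h : Equivalent Y Y') :
    Equivalent (markedGlue X Y) (markedGlue X Y') := by
  have hs : ∀ Y, Equivalent (markedGlue X Y) (markedGlueSwap X Y) :=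
    fun Y => .rel _ _ (trackedMove_swap X Y)
  refine (hs Y).trans _ _ _ (.trans _ _ _ ?_ (hs Y').symm)
  exact Relation.EqvGen.map (markedGlueSwap X ·) (fun _ _ h => .rel _ _ (trackedMove_glue h).2) h

end MarkedDiagram

namespace LinkDiagram

/-! ### Hardness -/

/-- Stated from the copy back to the original: a move made on an isotopic copy has to be found on
the given diagram. The two analogues below serve the same purpose. -/
theorem Isotopic.isOmega1Site {D D' : LinkDiagram} {e : D.Dart ≃ D'.Dart}
    (hrot : ∀ x, e (D.rot x) = D'.rot (e x)) (hinv : ∀ x, e (D.inv x) = D'.inv (e x))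
    (hregion : ∀ x y, D'.region (e x) = D'.region (e y) ↔ D.region x = D.region y) {t : D.Dart}
    (h : D'.IsOmega1Site (e t)) : D.IsOmega1Site t := by
  obtain ⟨h1, h2, h3⟩ := h
  refine ⟨fun h' => h1 ?_, ?_, fun x => ?_⟩
  · rw [← hrot, ← hrot, h']
  · rwa [← hrot, ← hinv, e.injective.eq_iff] at h2
  · rw [← hregion, h3, e.injective.eq_iff]

theorem Isotopic.mem_vertex {D D' : LinkDiagram} {e : D.Dart ≃ D'.Dart}
    (hrot : ∀ x, e (D.rot x) = D'.rot (e x)) {x y : D.Dart} :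
    e y ∈ D'.vertex (e x) ↔ y ∈ D.vertex x := by
  simp [vertex, ← hrot]

theorem Isotopic.isOmega2Site {D D' : LinkDiagram} {e : D.Dart ≃ D'.Dart}
    (hrot : ∀ x, e (D.rot x) = D'.rot (e x)) (hinv : ∀ x, e (D.inv x) = D'.inv (e x))
    (hover : ∀ x, D'.isOver (e x) = D.isOver x)
    (hregion : ∀ x y, D'.region (e x) = D'.region (e y) ↔ D.region x = D.region y) {t s : D.Dart}
    (h : D'.IsOmega2Site (e t) (e s)) : D.IsOmega2Site t s := by
  obtain ⟨h1, h2, h3, h4, h5, h6, h7⟩ := h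
  refine ⟨fun h' => h1 ?_, fun h' => h2 ?_, ?_, ?_, ?_, fun x => ?_, ?_⟩
  · rw [← hrot, ← hrot, h']
  · rw [← hrot, ← hrot, h']
  · rwa [Isotopic.mem_vertex hrot] at h3
  · rwa [← hrot, ← hinv, e.injective.eq_iff] at h4
  · rwa [← hrot, ← hinv, e.injective.eq_iff] at h5
  · rw [← hregion, h6, e.injective.eq_iff, e.injective.eq_iff]
  · rwa [← hrot, hover, hover] at h7

theorem Isotopic.isOmega3Triangle {D D' : LinkDiagram} {e : D.Dart ≃ D'.Dart}
    (hrot : ∀ x, e (D.rot x) = D'.rot (e x)) (hinv : ∀ x, e (D.inv x) = D'.inv (e x))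
    (hover : ∀ x, D'.isOver (e x) = D.isOver x)
    (hregion : ∀ x y, D'.region (e x) = D'.region (e y) ↔ D.region x = D.region y)
    {t : Fin 3 → D.Dart} (h : D'.IsOmega3Triangle fun i => e (t i)) : D.IsOmega3Triangle t := by
  obtain ⟨h1, h2, h3, h4, h5⟩ := h
  refine ⟨fun i h' => h1 i ?_, fun i j hij => ?_, fun i => ?_, fun x => ?_, ?_⟩
  · rw [← hrot, ← hrot, h']
  · have := h2 i j hij
    rwa [Isotopic.mem_vertex hrot] at this
  · have := h3 i
    rwa [← hrot, ← hinv, e.injective.eq_iff] at this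
  · rw [← hregion, h4]
    simp
  · simpa only [hover] using h5

/-- The result of an `Ω₃`-type move at a given triangle is unique up to isotopy. -/
theorem Omega3With.isotopic {D D₁ E E₁ : LinkDiagram} {f : D.Dart ≃ E.Dart}
    (hrot : ∀ x, f (D.rot x) = E.rot (f x)) (hinv : ∀ x, f (D.inv x) = E.inv (f x))
    (hover : ∀ x, E.isOver (f x) = D.isOver x)
    (hregion : ∀ x y, E.region (f x) = E.region (f y) ↔ D.region x = D.region y)
    {t : Fin 3 → D.Dart} {e : D.Dart ≃ D₁.Dart} {ρ π : D.Dart → D.Dart}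
    (h : D.Omega3With D₁ t e ρ π) {e' : E.Dart ≃ E₁.Dart} {ρ' π' : E.Dart → E.Dart}
    (h' : E.Omega3With E₁ (fun i => f (t i)) e' ρ' π') : D₁.Isotopic E₁ := by
  obtain ⟨-, h1, h2, h3, h4, h5, h6, h7⟩ := h
  obtain ⟨-, h1', h2', h3', h4', h5', h6', h7'⟩ := h'
  -- `ρ` and `π` are prescribed at all darts of the three vertices of the triangle and are the
  -- identity elsewhere, so the isotopy `f` carries them to `ρ'` and `π'`.
  have key : ∀ x, f (ρ x) = ρ' (f x) ∧ f (π x) = π' (f x) := by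
    intro x
    by_cases hx : ∃ i, x ∈ D.vertex (t i)
    · obtain ⟨i, hi⟩ := hx
      have h12 : i + 2 + 1 = i := by rw [add_assoc]; simp
      have a := h1 (i + 2)
      have a' := h1' (i + 2)
      rw [h12] at a a'
      rcases hi with rfl | rfl | rfl | rfl
      · rw [(h1 i).1, (h1' i).1, (h2 i).1, (h2' i).1]; simp [hrot]
      · simp only [hrot]
        rw [a.2.2.2, a'.2.2.2, (h2 i).2.1, (h2' i).2.1]; simp [hrot]
      · simp only [hrot]
        rw [(h1 i).2.2.1, (h1' i).2.2.1, (h2 i).2.2.1, (h2' i).2.2.1]; simp [hrot]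
      · simp only [hrot]
        rw [a.2.1, a'.2.1, (h2 i).2.2.2, (h2' i).2.2.2]; simp [hrot]
    · have hx1 := h3 x (not_exists.1 hx)
      have hx2 := h3' (f x) fun i => by
        rw [Isotopic.mem_vertex hrot]
        exact not_exists.1 hx i
      rw [hx1.1, hx1.2, hx2.1, hx2.2]
      exact ⟨rfl, rfl⟩
  refine ⟨e.symm.trans (f.trans e'), fun x => ?_, fun x => ?_, fun x => ?_, fun x y => ?_⟩
  all_goals obtain ⟨x, rfl⟩ := e.surjective x
  · rw [h4]; simp [hrot, h4']
  · rw [h5]; simp [hinv, h5', key]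
  · rw [h6]; simp [hover, h6']
  · obtain ⟨y, rfl⟩ := e.surjective y
    rw [h7]
    simp [h7', ← key, hregion]

end LinkDiagram

/-! ### Stable families and their sums -/

namespace MarkedDiagram

open LinkDiagram

/-- A set of marked diagrams that is closed under `Ω₃`-type moves, where these moves do not involve
the marked edge, and on which no moves removing crossings are possible. -/
structure IsStable (𝒮 : Set MarkedDiagram) : Prop where
  not_omega1 : ∀ X ∈ 𝒮, ∀ t, ¬ X.diagram.IsOmega1Site t
  not_omega2 : ∀ X ∈ 𝒮, ∀ t s, ¬ X.diagram.IsOmega2Site t s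
  mark_notMem : ∀ X ∈ 𝒮, ∀ t, X.diagram.IsOmega3Triangle t →
    ∀ i, X.mark ∉ X.diagram.vertex (t i) ∧ X.mark' ∉ X.diagram.vertex (t i)
  omega3 : ∀ X ∈ 𝒮, ∀ t, X.diagram.IsOmega3Triangle t → ∃ X' ∈ 𝒮, ∃ e ρ π,
    X.diagram.Omega3With X'.diagram t e ρ π ∧ e X.mark = X'.mark
  mark_ne : ∀ X ∈ 𝒮, X.mark' ≠ X.diagram.rot X.mark ∧ X.mark ≠ X.diagram.rot X.mark'

/-- A place for removing crossings would exist on the member `X` as well, which is excluded. An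
`Ω₃`-type move on the copy is matched by the move inside `𝒮` at the same triangle, and the results
are isotopic. -/
theorem IsStable.nonincreasingMove {𝒮 : Set MarkedDiagram} (h𝒮 : IsStable 𝒮) {E E' : LinkDiagram}
    (hE : ∃ X ∈ 𝒮, X.diagram.Isotopic E) (h : NonincreasingMove E E') :
    ∃ X ∈ 𝒮, X.diagram.Isotopic E' := by
  obtain ⟨X, hX, hXE⟩ := hE
  have hXE' := hXE
  obtain ⟨f, hrot, hinv, hover, hregion⟩ := hXE
  rcases h with h | h | h | h
  · exact ⟨X, hX, hXE'.trans h⟩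
  · obtain ⟨t, h1, h2, h3, -⟩ := h
    obtain ⟨t, rfl⟩ := f.surjective t
    exact absurd (Isotopic.isOmega1Site hrot hinv hregion ⟨h1, h2, h3⟩) (h𝒮.not_omega1 X hX t)
  · obtain ⟨t, s, h1, h2, h3, h4, h5, h6, h7, -⟩ := h
    obtain ⟨t, rfl⟩ := f.surjective t
    obtain ⟨s, rfl⟩ := f.surjective s
    exact absurd (Isotopic.isOmega2Site hrot hinv hover hregion ⟨h1, h2, h3, h4, h5, h6, h7⟩)
      (h𝒮.not_omega2 X hX t s)
  · obtain ⟨t', e', ρ', π', h'⟩ := h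
    obtain ⟨t, rfl⟩ : ∃ t : Fin 3 → X.diagram.Dart, (fun i => f (t i)) = t' :=
      ⟨fun i => f.symm (t' i), by simp⟩
    obtain ⟨X', hX', e, ρ, π, h, -⟩ := h𝒮.omega3 X hX t
      (Isotopic.isOmega3Triangle hrot hinv hover hregion h'.1)
    exact ⟨X', hX', Omega3With.isotopic hrot hinv hover hregion h h'⟩

/-- The diagram `U` makes the crossing number zero, whereas every diagram reached is isotopic to a
member of `𝒮`, which has a crossing at its mark. -/
theorem IsStable.isHard {𝒮 : Set MarkedDiagram} (h𝒮 : IsStable 𝒮) {X : MarkedDiagram} (hX : X ∈ 𝒮)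
    (hred : X.diagram.IsReduced) {U : LinkDiagram} (hU : U.crossingCount = 0)
    (hXU : SameLink X.diagram U) : X.diagram.IsHard := by
  have h0 : X.diagram.crossingNumber = 0 := Nat.sInf_eq_zero.2 (.inl ⟨U, hXU, hU⟩)
  refine ⟨hred, h0 ▸ crossingCount_pos X.crossing, fun E hE hr => ?_⟩
  have key : ∃ X ∈ 𝒮, X.diagram.Isotopic E := by
    clear hE
    induction hr with
    | refl => exact ⟨X, hX, .refl _⟩
    | tail _ h ih => exact h𝒮.nonincreasingMove ih h
  obtain ⟨X', hX', f, hrot, -⟩ := key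
  have hc : E.IsCrossing (f X'.mark) := fun h => X'.crossing (f.injective (by rw [hrot, hrot, h]))
  have := crossingCount_pos hc
  rw [hE.2, h0] at this
  exact lt_irrefl 0 this

variable {X Y : MarkedDiagram}

/-- The regions of a sum on the two sides of the marked edge have at least four corners. -/
theorem four_le_ncard_of_region_eq {x : X.diagram.Dart}
    (hX : X.mark' ≠ X.diagram.rot X.mark ∧ X.mark ≠ X.diagram.rot X.mark')
    (hY : Y.mark' ≠ Y.diagram.rot Y.mark ∧ Y.mark ≠ Y.diagram.rot Y.mark')
    (hx : X.diagram.region x = X.diagram.region X.mark ∨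
      X.diagram.region x = X.diagram.region X.mark') :
    4 ≤ {w | (glue X Y).region w = (glue X Y).region (inl X Y x)}.ncard := by
  classical
  have := (glue X Y).finite_dart
  have aux : ∀ (a b : X.diagram.Dart) (c d : Y.diagram.Dart), a ≠ b → c ≠ d →
      (∀ w ∈ ({inl X Y a, inl X Y b, inr X Y c, inr X Y d} : Finset (glue X Y).Dart),
        (glue X Y).region w = (glue X Y).region (inl X Y x)) →
      4 ≤ {w | (glue X Y).region w = (glue X Y).region (inl X Y x)}.ncard := by
    intro a b c d hab hcd h
    have h4 : ({inl X Y a, inl X Y b, inr X Y c, inr X Y d} : Finset (glue X Y).Dart).card = 4 := by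
      rw [Finset.card_insert_of_notMem, Finset.card_insert_of_notMem, Finset.card_pair] <;>
        simp [hab, hcd]
    rw [← h4, ← Set.ncard_coe_finset]
    exact Set.ncard_le_ncard h (Set.toFinite _)
  have ne_symm : ∀ (D : LinkDiagram) (a b : D.Dart), a ≠ D.rot b → b ≠ D.rot.symm a :=
    fun D a b h h' => h (by rw [h', Equiv.apply_symm_apply])
  have rX := X.diagram.region_symm_rot_inv X.mark
  have rX' := X.diagram.region_symm_rot_inv X.mark'
  have rY := Y.diagram.region_symm_rot_inv Y.mark
  have rY' := Y.diagram.region_symm_rot_inv Y.mark'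
  rw [X.inv_mark'] at rX'
  rw [Y.inv_mark'] at rY'
  rcases hx with hx | hx
  -- Each summand contributes the corners at both ends of its marked edge on the given side. They
  -- differ because the edge is not the loop of a kink on that side.
  · refine aux X.mark (X.diagram.rot.symm X.mark') Y.mark' (Y.diagram.rot.symm Y.mark)
      (ne_symm _ _ _ hX.1) (ne_symm _ _ _ hY.2) ?_
    simp only [Finset.mem_insert, Finset.mem_singleton]
    rintro w (rfl | rfl | rfl | rfl)
    · rw [glue_region_inl_inl, hx]
    · rw [glue_region_inl_inl, hx, rX]
    · rw [eq_comm, glue_region_inl_inr]; exact .inl ⟨hx, rfl⟩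
    · rw [eq_comm, glue_region_inl_inr]; exact .inl ⟨hx, rY'⟩
  · refine aux X.mark' (X.diagram.rot.symm X.mark) Y.mark (Y.diagram.rot.symm Y.mark')
      (ne_symm _ _ _ hX.2) (ne_symm _ _ _ hY.1) ?_
    simp only [Finset.mem_insert, Finset.mem_singleton]
    rintro w (rfl | rfl | rfl | rfl)
    · rw [glue_region_inl_inl, hx]
    · rw [glue_region_inl_inl, hx, rX']
    · rw [eq_comm, glue_region_inl_inr]; exact .inr ⟨hx, rfl⟩
    · rw [eq_comm, glue_region_inl_inr]; exact .inr ⟨hx, rY⟩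

/-- A region of a sum with a corner in the first summand and at most three corners is a region of
the first summand. -/
theorem region_ne_of_ncard_lt {x : X.diagram.Dart}
    (hX : X.mark' ≠ X.diagram.rot X.mark ∧ X.mark ≠ X.diagram.rot X.mark')
    (hY : Y.mark' ≠ Y.diagram.rot Y.mark ∧ Y.mark ≠ Y.diagram.rot Y.mark')
    (hx : {w | (glue X Y).region w = (glue X Y).region (inl X Y x)}.ncard < 4) :
    X.diagram.region x ≠ X.diagram.region X.mark ∧
      X.diagram.region x ≠ X.diagram.region X.mark' :=
  ⟨fun h => absurd (four_le_ncard_of_region_eq hX hY (.inl h)) (not_le.2 hx),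
    fun h => absurd (four_le_ncard_of_region_eq hX hY (.inr h)) (not_le.2 hx)⟩

/-- A triangle of a sum with a corner in the first summand is a triangle of that summand. -/
theorem isOmega3Triangle_of_glue
    (hX : X.mark' ≠ X.diagram.rot X.mark ∧ X.mark ≠ X.diagram.rot X.mark')
    (hY : Y.mark' ≠ Y.diagram.rot Y.mark ∧ Y.mark ≠ Y.diagram.rot Y.mark')
    {t : Fin 3 → (glue X Y).Dart} (ht : (glue X Y).IsOmega3Triangle t) {x : X.diagram.Dart}
    (hx : t 0 = inl X Y x) :
    ∃ s : Fin 3 → X.diagram.Dart, t = (fun i => inl X Y (s i)) ∧ X.diagram.IsOmega3Triangle s := by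
  obtain ⟨h1, h2, h3, h4, h5⟩ := ht
  -- Three corners are too few for a region next to a joining edge.
  have hc : {w | (glue X Y).region w = (glue X Y).region (inl X Y x)}.ncard < 4 := by
    have hset : {w | (glue X Y).region w = (glue X Y).region (inl X Y x)} = Set.range t := by
      ext w
      rw [Set.mem_ofPred_eq, ← hx, h4]
      exact exists_congr fun _ => eq_comm
    rw [hset, ← Set.image_univ]
    refine (Set.ncard_image_le).trans_lt ?_
    rw [Set.ncard_univ, Nat.card_eq_fintype_card, Fintype.card_fin]
    norm_num
  obtain ⟨r1, r2⟩ := region_ne_of_ncard_lt hX hY hc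
  have hex : ∀ i, ∃ s, t i = inl X Y s := by
    intro i
    have hi := (h4 (t i)).2 ⟨i, rfl⟩
    rw [hx] at hi
    rcases w : t i with s | z
    · exact ⟨s, rfl⟩
    · rw [w] at hi
      exact absurd hi (glue_region_inr_ne_inl r1 r2 z)
  choose s hs using hex
  obtain rfl : t = fun i => inl X Y (s i) := funext hs
  have hs0 : s 0 = x := inl_inj.1 hx
  have hreg : ∀ i, X.diagram.region (s i) = X.diagram.region x := fun i => by
    have := (h4 _).2 ⟨i, rfl⟩
    rwa [glue_region_inl_inl, hs0] at this
  refine ⟨s, rfl, fun i => glue_isCrossing_inl.1 (h1 i), fun i j hij => ?_, fun i => ?_,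
    fun y => ?_, h5⟩
  · have := h2 i j hij
    rwa [glue_vertex_inl, inl_mem_image] at this
  · have := h3 i
    rw [glue_inv_inl (ne_mark_of_region_ne (by rwa [hreg]))
      (ne_mark'_of_region_ne (by rwa [hreg]))] at this
    exact inl_inj.1 this
  · have := h4 (inl X Y y)
    rw [glue_region_inl_inl] at this
    rw [this]
    simp

theorem isOmega1Site_of_glue
    (hX : X.mark' ≠ X.diagram.rot X.mark ∧ X.mark ≠ X.diagram.rot X.mark')
    (hY : Y.mark' ≠ Y.diagram.rot Y.mark ∧ Y.mark ≠ Y.diagram.rot Y.mark') {t : X.diagram.Dart}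
    (ht : (glue X Y).IsOmega1Site (inl X Y t)) : X.diagram.IsOmega1Site t := by
  obtain ⟨h1, h2, h3⟩ := ht
  have hc : {w | (glue X Y).region w = (glue X Y).region (inl X Y t)}.ncard < 4 := by
    have hset : {w | (glue X Y).region w = (glue X Y).region (inl X Y t)} = {inl X Y t} :=
      Set.ext h3
    rw [hset, Set.ncard_singleton]
    norm_num
  obtain ⟨r1, r2⟩ := region_ne_of_ncard_lt hX hY hc
  refine ⟨glue_isCrossing_inl.1 h1, ?_, fun y => ?_⟩
  · rw [glue_inv_inl (ne_mark_of_region_ne r1) (ne_mark'_of_region_ne r2)] at h2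
    exact inl_inj.1 h2
  · simpa using h3 (inl X Y y)

theorem isOmega2Site_of_glue
    (hX : X.mark' ≠ X.diagram.rot X.mark ∧ X.mark ≠ X.diagram.rot X.mark')
    (hY : Y.mark' ≠ Y.diagram.rot Y.mark ∧ Y.mark ≠ Y.diagram.rot Y.mark') {t : X.diagram.Dart}
    {w : (glue X Y).Dart} (ht : (glue X Y).IsOmega2Site (inl X Y t) w) :
    ∃ s, X.diagram.IsOmega2Site t s := by
  obtain ⟨h1, h2, h3, h4, h5, h6, h7⟩ := ht
  have hc : {w | (glue X Y).region w = (glue X Y).region (inl X Y t)}.ncard < 4 := by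
    have hset : {w | (glue X Y).region w = (glue X Y).region (inl X Y t)} = {inl X Y t, w} :=
      Set.ext h6
    rw [hset]
    exact (Set.ncard_insert_le _ _).trans_lt (by rw [Set.ncard_singleton]; norm_num)
  obtain ⟨r1, r2⟩ := region_ne_of_ncard_lt hX hY hc
  induction w using glue_cases with
  | hl s =>
    have hs : X.diagram.region s = X.diagram.region t := by
      simpa using (h6 (inl X Y s)).2 (.inr rfl)
    refine ⟨s, glue_isCrossing_inl.1 h1, glue_isCrossing_inl.1 h2, ?_, ?_, ?_, fun y => ?_, h7⟩
    · rwa [glue_vertex_inl, inl_mem_image] at h3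
    · rw [glue_inv_inl (ne_mark_of_region_ne r1) (ne_mark'_of_region_ne r2)] at h4
      exact inl_inj.1 h4
    · rw [glue_inv_inl (ne_mark_of_region_ne (by rwa [hs]))
        (ne_mark'_of_region_ne (by rwa [hs]))] at h5
      exact inl_inj.1 h5
    · simpa using h6 (inl X Y y)
  | hr z => exact absurd ((h6 _).2 (.inr rfl)) (glue_region_inr_ne_inl r1 r2 z)

/-- Sums with a marked diagram without any places for moves preserve stability. -/
theorem IsStable.image_markedGlue {𝒮 : Set MarkedDiagram} (h𝒮 : IsStable 𝒮)
    (h1 : ∀ t, ¬ Y.diagram.IsOmega1Site t) (h2 : ∀ t s, ¬ Y.diagram.IsOmega2Site t s)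
    (h3 : ∀ t, ¬ Y.diagram.IsOmega3Triangle t)
    (hY : Y.mark' ≠ Y.diagram.rot Y.mark ∧ Y.mark ≠ Y.diagram.rot Y.mark') :
    IsStable ((markedGlue · Y) '' 𝒮) := by
  have tri : ∀ X ∈ 𝒮, ∀ t, (glue X Y).IsOmega3Triangle t →
      ∃ s : Fin 3 → X.diagram.Dart, t = (fun i => inl X Y (s i)) ∧
        X.diagram.IsOmega3Triangle s := by
    intro X hX t ht
    rcases hw : t 0 with x | z
    · exact isOmega3Triangle_of_glue (h𝒮.mark_ne X hX) hY ht hw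
    -- After an exchange of the summands, a triangle with a corner in `Y` would be a triangle of `Y`
    -- itself.
    · obtain ⟨g1, g2, g3, g4⟩ := isotopic_glueComm Y X
      obtain ⟨t, rfl⟩ : ∃ t' : Fin 3 → (glue Y X).Dart, (fun i => glueComm Y X (t' i)) = t :=
        ⟨fun i => (glueComm Y X).symm (t i), by simp⟩
      have h := Isotopic.isOmega3Triangle g1 g2 g3 g4 ht
      have hw' : t 0 = inl Y X z := (glueComm Y X).injective hw
      obtain ⟨s, -, hs⟩ := isOmega3Triangle_of_glue hY (h𝒮.mark_ne X hX) h hw'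
      exact absurd hs (h3 s)
  constructor
  · rintro _ ⟨X, hX, rfl⟩ (x | z) ht
    · exact h𝒮.not_omega1 X hX x (isOmega1Site_of_glue (h𝒮.mark_ne X hX) hY ht)
    · obtain ⟨g1, g2, g3, g4⟩ := isotopic_glueComm Y X
      exact h1 z (isOmega1Site_of_glue hY (h𝒮.mark_ne X hX)
        (Isotopic.isOmega1Site g1 g2 g4 (t := inl Y X z) ht))
  · rintro _ ⟨X, hX, rfl⟩ (x | z) w ht
    · obtain ⟨s, hs⟩ := isOmega2Site_of_glue (h𝒮.mark_ne X hX) hY ht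
      exact h𝒮.not_omega2 X hX x s hs
    · obtain ⟨g1, g2, g3, g4⟩ := isotopic_glueComm Y X
      obtain ⟨w, rfl⟩ := (glueComm Y X).surjective w
      obtain ⟨s, hs⟩ := isOmega2Site_of_glue hY (h𝒮.mark_ne X hX)
        (Isotopic.isOmega2Site g1 g2 g3 g4 (t := inl Y X z) ht)
      exact h2 z s hs
  · rintro _ ⟨X, hX, rfl⟩ t ht i
    obtain ⟨s, rfl, hs⟩ := tri X hX t ht
    change inl X Y X.mark ∉ (glue X Y).vertex _ ∧
      (glue X Y).inv (inl X Y X.mark) ∉ (glue X Y).vertex _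
    rw [glue_vertex_inl, glue_inv_inl_mark, inl_mem_image]
    -- The far end of the new marked edge lies in `Y`, while all triangles lie in `X`.
    exact ⟨(h𝒮.mark_notMem X hX s hs i).1, inr_notMem_image⟩
  · rintro _ ⟨X, hX, rfl⟩ t ht
    obtain ⟨s, rfl, hs⟩ := tri X hX t ht
    obtain ⟨X', hX', e, ρ, π, hO, he⟩ := h𝒮.omega3 X hX s hs
    have hm := h𝒮.mark_notMem X hX s hs
    exact ⟨markedGlue X' Y, ⟨X', hX', rfl⟩, _, _, _,
      omega3With_glue hO he (fun i => (hm i).1) (fun i => (hm i).2), congrArg Sum.inl he⟩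
  · rintro _ ⟨X, hX, rfl⟩
    change (glue X Y).inv (inl X Y X.mark) ≠ (glue X Y).rot (inl X Y X.mark) ∧
      inl X Y X.mark ≠ (glue X Y).rot ((glue X Y).inv (inl X Y X.mark))
    simp

/-- Opposite corners belong to the same summand, and gluing unites no two regions of one summand. -/
theorem isReduced_glue (hX : X.diagram.IsReduced) (hY : Y.diagram.IsReduced) :
    (glue X Y).IsReduced := by
  intro w hw
  induction w using glue_cases with
  | hl x => simpa using hX x (glue_isCrossing_inl.1 hw)
  | hr z => simpa using hY z (glue_isCrossing_inr.1 hw)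

end MarkedDiagram

/-! ### Diagrams given by tables -/

/-- A connected diagram with `n` crossings given by tables: the darts at the crossing `c` are
`4 * c + j` with `j < 4` in counterclockwise order.  The list `over` tells whether the dart `4 * c`
is over (`1`) or under (`0`).  From every crossing but the first one a spanning tree is followed
towards the first one by the edge of the dart `parent`. -/
structure PlanarCode (n : ℕ) where
  invTable : List ℕ
  overTable : List ℕ
  regionTable : List ℕ
  parentTable : List ℕ

namespace PlanarCode

variable {n n' : ℕ}

theorem mod_lt_of_fin (x : Fin (4 * n)) (k : ℕ) : k % (4 * n) < 4 * n := Nat.mod_lt _ x.pos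

/-- The next dart at the same crossing. -/
def rotFun (x : Fin (4 * n)) : Fin (4 * n) := ⟨x / 4 * 4 + (x + 1) % 4, by omega⟩

theorem rotFun_four (x : Fin (4 * n)) : rotFun (rotFun (rotFun (rotFun x))) = x := by
  ext
  simp only [rotFun]
  omega

theorem rotFun_rotFun_ne (x : Fin (4 * n)) : rotFun (rotFun x) ≠ x := by
  intro h
  have := congrArg Fin.val h
  simp only [rotFun] at this
  omega

theorem rotFun_div (x : Fin (4 * n)) : (rotFun x : ℕ) / 4 = x / 4 := by
  simp only [rotFun]
  omega

/-- The default value and the reduction modulo `4 * n` only make the function total. -/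
def invFun (D : PlanarCode n) (x : Fin (4 * n)) : Fin (4 * n) :=
  ⟨D.invTable.getD x 0 % (4 * n), mod_lt_of_fin x _⟩

def overFun (D : PlanarCode n) (x : Fin (4 * n)) : Bool :=
  (D.overTable.getD (x / 4) 0 + x) % 2 == 1

/-- By Euler's formula, a connected diagram with `n` crossings on the sphere has `n + 2` regions.
Surjectivity onto them is what certifies that a table is planar. -/
def regionFun (D : PlanarCode n) (x : Fin (4 * n)) : Fin (n + 2) :=
  ⟨D.regionTable.getD x 0 % (n + 2), Nat.mod_lt _ (by omega)⟩

/-- A dart at the crossing that follows on the way to the first one. -/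
def up (D : PlanarCode n) (x : Fin (4 * n)) : Fin (4 * n) :=
  if x.1 / 4 = 0 then x else D.invFun ⟨D.parentTable.getD (x / 4) 0 % (4 * n), mod_lt_of_fin x _⟩

/-- The tables are those of a diagram. -/
def Valid (D : PlanarCode n) : Prop :=
  0 < n ∧ (∀ x, D.invFun (D.invFun x) = x) ∧ (∀ x, D.invFun x ≠ x) ∧
    (∀ r, ∃ x, D.regionFun x = r) ∧ (∀ x, D.regionFun (D.invFun (rotFun x)) = D.regionFun x) ∧
    (∀ x : Fin (4 * n), x.1 / 4 = 0 ∨ D.parentTable.getD (x / 4) 0 % (4 * n) / 4 = x / 4) ∧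
    ∀ x, (D.up^[n] x : ℕ) / 4 = 0

instance (D : PlanarCode n) : Decidable D.Valid := by unfold Valid; infer_instance

/-- The rotation around the crossings. -/
def rot : Equiv.Perm (Fin (4 * n)) where
  toFun := rotFun
  invFun x := rotFun (rotFun (rotFun x))
  left_inv := rotFun_four
  right_inv := rotFun_four

theorem eq_of_div_eq {x y : Fin (4 * n)} (h : (x : ℕ) / 4 = y / 4) :
    y = x ∨ y = rotFun x ∨ y = rotFun (rotFun x) ∨ y = rotFun (rotFun (rotFun x)) := by
  simp only [Fin.ext_iff, rotFun]
  omega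

theorem eqvGen_of_div_eq {r : Fin (4 * n) → Fin (4 * n) → Prop} (hr : ∀ x, r x (rotFun x))
    {x y : Fin (4 * n)} (h : (x : ℕ) / 4 = y / 4) : Relation.EqvGen r x y := by
  have h1 : ∀ x, Relation.EqvGen r x (rotFun x) := fun x => .rel _ _ (hr x)
  rcases eq_of_div_eq h with rfl | rfl | rfl | rfl
  exacts [.refl _, h1 _, .trans _ _ _ (h1 _) (h1 _),
    .trans _ _ _ (h1 _) (.trans _ _ _ (h1 _) (h1 _))]

/-- By the last condition of validity, `n` steps along the spanning tree lead from any crossing to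
the first one, where all paths meet. -/
theorem Valid.eqvGen {D : PlanarCode n} (h : D.Valid) {r : Fin (4 * n) → Fin (4 * n) → Prop}
    (hr : ∀ x, r x (rotFun x)) (hi : ∀ x, r x (D.invFun x)) (x y : Fin (4 * n)) :
    Relation.EqvGen r x y := by
  obtain ⟨-, -, -, -, -, h1, h2⟩ := h
  have hup : ∀ x, Relation.EqvGen r x (D.up x) := by
    intro x
    unfold up
    split_ifs with h0
    · exact .refl _
    · refine .trans _ _ _ (eqvGen_of_div_eq hr ?_) (.rel _ _ (hi _))
      exact ((h1 x).resolve_left h0).symm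
  have hit : ∀ k x, Relation.EqvGen r x (D.up^[k] x) := by
    intro k
    induction k with
    | zero => exact fun x => .refl _
    | succ k ih => exact fun x => .trans _ _ _ (hup x) (ih _)
  exact (hit n x).trans _ _ _ (.trans _ _ _
    (eqvGen_of_div_eq hr ((h2 x).trans (h2 y).symm)) (hit n y).symm)

/-- The diagram with the given tables. -/
def diagram (D : PlanarCode n) (h : D.Valid) : LinkDiagram where
  Dart := Fin (4 * n)
  Region := Fin (n + 2)
  finite_dart := inferInstance
  rot := rot
  inv := Function.Involutive.toPerm D.invFun h.2.1
  isOver := D.overFun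
  region := D.regionFun
  inv_inv := h.2.1
  inv_ne := h.2.2.1
  rot_four := rotFun_four
  free_circle x hx := absurd hx (rotFun_rotFun_ne x)
  isOver_rot x _ := by
    have h1 : (rotFun x : ℕ) % 2 = (x + 1) % 2 := by simp only [rotFun]; omega
    change D.overFun (rotFun x) = !D.overFun x
    rw [Bool.eq_iff_iff]
    simp only [overFun, rotFun_div, beq_iff_eq, Bool.not_eq_true', beq_eq_false_iff_ne]
    omega
  isOver_free x hx := absurd hx (rotFun_rotFun_ne x)
  region_surjective := h.2.2.2.1
  region_edge := h.2.2.2.2.1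
  connected := h.eqvGen (fun _ => .inl rfl) fun _ => .inr (.inl rfl)
  euler := by
    have hV : Nat.card (Quot fun a b : Fin (4 * n) => b = rot a) = n := by
      rw [card_quot_eq_of_surjective (β := Fin n) fun x => ⟨x.1 / 4, by omega⟩]
      · simp
      · exact fun c => ⟨⟨4 * c, by omega⟩, by ext; simp⟩
      · rintro a b rfl
        ext
        exact (rotFun_div a).symm
      · intro a b hab
        exact eqvGen_of_div_eq (r := fun a b => b = rot a) (fun _ => rfl) (congrArg Fin.val hab)
    have hE := card_eq_two_mul_card_quot (Function.Involutive.toPerm D.invFun h.2.1) h.2.1 h.2.2.1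
    have hC : Nat.card (Quot fun a b : Fin (4 * n) => b = rot a ∨
        b = Function.Involutive.toPerm D.invFun h.2.1 a) = 1 := by
      rw [card_quot_eq_of_surjective (β := Unit) fun _ => ()]
      · simp
      · exact fun _ => ⟨⟨0, by have := h.1; omega⟩, rfl⟩
      · exact fun _ _ _ => rfl
      · exact fun a b _ => h.eqvGen (fun _ => .inl rfl) (fun _ => .inr rfl) a b
    -- There are `n` vertices, `2 * n` edges, `n + 2` regions, and one component.
    rw [hV, hC]
    simp only [Nat.card_eq_fintype_card, Fintype.card_fin] at hE ⊢
    omega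

theorem crossingCount_diagram (D : PlanarCode n) (h : D.Valid) :
    (D.diagram h).crossingCount = n := by
  have e : {x : (D.diagram h).Dart // (D.diagram h).IsCrossing x} ≃ Fin (4 * n) :=
    Equiv.subtypeUnivEquiv fun x => rotFun_rotFun_ne x
  rw [LinkDiagram.crossingCount, Nat.card_congr e, Nat.card_eq_fintype_card, Fintype.card_fin]
  omega

theorem isConnected_diagram (D : PlanarCode n) (h : D.Valid) : (D.diagram h).IsConnected :=
  h.eqvGen (fun _ => .inl rfl) fun _ => .inr rfl

theorem isCrossing_diagram (D : PlanarCode n) (h : D.Valid) (x : (D.diagram h).Dart) :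
    (D.diagram h).IsCrossing x := rotFun_rotFun_ne x

theorem mem_vertex_diagram {D : PlanarCode n} {h : D.Valid} {x y : Fin (4 * n)} :
    y ∈ (D.diagram h).vertex x ↔ (y : ℕ) / 4 = x / 4 := by
  constructor
  · rintro (rfl | rfl | rfl | rfl)
    · rfl
    · exact rotFun_div x
    · exact (rotFun_div _).trans (rotFun_div x)
    · exact (rotFun_div _).trans ((rotFun_div _).trans (rotFun_div x))
  · exact fun h => eq_of_div_eq h.symm

/-! ### Verification of moves -/

/-- The dart where one arrives from the end `y` of an edge, going straight on through at most `k`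
crossings in `S`. -/
def arrive (D : PlanarCode n) (S : Fin (4 * n) → Bool) : ℕ → Fin (4 * n) → Fin (4 * n)
  | 0, y => y
  | k + 1, y => if S y then arrive D S k (D.invFun (rotFun (rotFun y))) else y

theorem travels_arrive {D : PlanarCode n} {h : D.Valid} {S : Fin (4 * n) → Bool} {x : Fin (4 * n)}
    (k : ℕ) {y : Fin (4 * n)} (hy : (D.diagram h).Travels {z | S z} x y) :
    (D.diagram h).Travels {z | S z} x (D.arrive S k y) := by
  induction k generalizing y with
  | zero => exact hy
  | succ k ih =>
    unfold arrive
    split_ifs with hS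
    · exact ih (.pass hy hS)
    · exact hy

theorem sameComponent_arrive {D : PlanarCode n} {h : D.Valid} {S : Fin (4 * n) → Bool}
    (k : ℕ) (x : Fin (4 * n)) : (D.diagram h).SameComponent x (D.arrive S k x) := by
  induction k generalizing x with
  | zero => exact .refl _
  | succ k ih =>
    unfold arrive
    split_ifs with hS
    · exact .trans _ _ _ (.rel _ _ (.inr rfl)) (.trans _ _ _ (.rel _ _ (.inl rfl)) (ih _))
    · exact .refl _

/-- The regions of `a` and `b` are equal after uniting those of `u` and `v`. -/
def United (D : PlanarCode n) (u v a b : Fin (4 * n)) : Prop :=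
  D.regionFun a = D.regionFun b ∨
    ((D.regionFun a = D.regionFun u ∨ D.regionFun a = D.regionFun v) ∧
      (D.regionFun b = D.regionFun u ∨ D.regionFun b = D.regionFun v))

instance (D : PlanarCode n) (u v a b : Fin (4 * n)) : Decidable (D.United u v a b) := by
  unfold United; infer_instance

/-- The dart of a diagram from which crossings are removed, if `l` is the list of the remaining
ones. -/
def embed (l : List ℕ) (hn : 0 < 4 * n) (x : Fin (4 * n')) : Fin (4 * n) :=
  ⟨(4 * l.getD (x / 4) 0 + x % 4) % (4 * n), Nat.mod_lt _ hn⟩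

/-- Conditions for the removal of the crossings in `S` that keeps track of the edge of `m`. -/
def ErasesTo (D : PlanarCode n) (D' : PlanarCode n') (S : Fin (4 * n) → Bool) (u v t : Fin (4 * n))
    (ι : Fin (4 * n') → Fin (4 * n)) (m : Fin (4 * n)) (m' : Fin (4 * n')) : Prop :=
  (∀ x, S (ι x) = false ∧ ι (rotFun x) = rotFun (ι x) ∧ D'.overFun x = D.overFun (ι x) ∧
    D.arrive S 4 (D.invFun (ι x)) = ι (D'.invFun x)) ∧
  (∀ x y, ι x = ι y → x = y) ∧
  (∀ x, S x = false → ∃ x', ι x' = x) ∧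
  (∀ x, S (D.arrive S 4 x) = false) ∧
  (∀ x y, D'.regionFun x = D'.regionFun y ↔ D.United u v (ι x) (ι y)) ∧
  ι m' = m ∧
  (∀ x, D'.regionFun x = D'.regionFun (D'.invFun m') ↔ D.United u v (ι x) (D.invFun m)) ∧
  D.regionFun t ≠ D.regionFun m ∧ D.regionFun t ≠ D.regionFun (D.invFun m)

instance (D : PlanarCode n) (D' : PlanarCode n') (S : Fin (4 * n) → Bool) (u v t : Fin (4 * n))
    (ι : Fin (4 * n') → Fin (4 * n)) (m : Fin (4 * n)) (m' : Fin (4 * n')) :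
    Decidable (ErasesTo D D' S u v t ι m m') := by
  unfold ErasesTo; infer_instance

open LinkDiagram

/-- Four steps in `arrive` suffice for the moves: at most two crossings are removed, and a strand
passes each at most twice. The condition that every strand leaves `S` ensures that no component
becomes a free circle, so `I` plays no role here. -/
theorem ErasesTo.erases {D : PlanarCode n} {D' : PlanarCode n'} {S : Fin (4 * n) → Bool}
    {u v t : Fin (4 * n)} {ι : Fin (4 * n') → Fin (4 * n)} {m : Fin (4 * n)} {m' : Fin (4 * n')}
    (he : ErasesTo D D' S u v t ι m m') (h : D.Valid) (h' : D'.Valid) (I : Set (Fin (4 * n))) :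
    (D.diagram h).Erases (D'.diagram h') {z | S z} I u v ι := by
  obtain ⟨h1, h2, h3, h4, h5, -⟩ := he
  refine ⟨h2, fun x _ => ?_, fun x hx => absurd (isCrossing_diagram D' h' x) hx,
    fun x _ hx => h3 x (by simpa using hx), fun x => ?_, h5⟩
  · obtain ⟨g1, g2, g3, g4⟩ := h1 x
    refine ⟨isCrossing_diagram _ _ _, fun hS => ?_, g2, g3, ?_⟩
    · exact Bool.false_ne_true (g1.symm.trans hS)
    · have := travels_arrive (h := h) (S := S) 4 (.edge (x := ι x))
      rwa [show D.arrive S 4 ((D.diagram h).inv (ι x)) = ι (D'.invFun x) from g4] at this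
  · obtain ⟨x', hx'⟩ := h3 _ (h4 x)
    exact ⟨x', by rw [hx']; exact sameComponent_arrive 4 x⟩

theorem ErasesTo.tracks {D : PlanarCode n} {D' : PlanarCode n'} {S : Fin (4 * n) → Bool}
    {u v t : Fin (4 * n)} {ι : Fin (4 * n') → Fin (4 * n)} {m : Fin (4 * n)} {m' : Fin (4 * n')}
    (he : ErasesTo D D' S u v t ι m m') (h : D.Valid) (h' : D'.Valid) :
    Tracks (D.diagram h) (D'.diagram h') u v t ι m m' :=
  ⟨he.2.2.2.2.2.1, he.2.2.2.2.2.2.1, he.2.2.2.2.2.2.2.1, he.2.2.2.2.2.2.2.2⟩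

/-- Conditions for a move `Ω₁↓` at the corner `t`, where the crossings in the list `l` remain. -/
def Omega1To (D : PlanarCode n) (D' : PlanarCode n') (t : Fin (4 * n)) (l : List ℕ)
    (m : Fin (4 * n)) (m' : Fin (4 * n')) : Prop :=
  D.invFun t = rotFun t ∧ (∀ x, D.regionFun x = D.regionFun t ↔ x = t) ∧
    ErasesTo D D' (fun x => x.1 / 4 == t.1 / 4) (rotFun t) (rotFun t) t (embed l t.pos) m m'

instance (D : PlanarCode n) (D' : PlanarCode n') (t : Fin (4 * n)) (l : List ℕ)
    (m : Fin (4 * n)) (m' : Fin (4 * n')) : Decidable (Omega1To D D' t l m m') := by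
  unfold Omega1To; infer_instance

theorem Omega1To.trackedMove {D : PlanarCode n} {D' : PlanarCode n'} {t : Fin (4 * n)}
    {l : List ℕ} {m : Fin (4 * n)} {m' : Fin (4 * n')} (ho : Omega1To D D' t l m m') (h : D.Valid)
    (h' : D'.Valid) : TrackedMove (D.diagram h) m (D'.diagram h') m' := by
  obtain ⟨h1, h2, h3⟩ := ho
  refine .omega1 t _ ⟨isCrossing_diagram _ _ _, h1, h2⟩ ?_ (h3.tracks h h')
  have hS : (D.diagram h).vertex t = {z | (z.1 / 4 == t.1 / 4) = true} :=
    Set.ext fun x => mem_vertex_diagram.trans beq_iff_eq.symm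
  rw [hS]
  exact h3.erases h h' _

/-- Conditions for a move `Ω₂↓` at the corners `t` and `s`. -/
def Omega2To (D : PlanarCode n) (D' : PlanarCode n') (t s : Fin (4 * n)) (l : List ℕ)
    (m : Fin (4 * n)) (m' : Fin (4 * n')) : Prop :=
  s.1 / 4 ≠ t.1 / 4 ∧ D.invFun t = rotFun s ∧ D.invFun s = rotFun t ∧
    (∀ x, D.regionFun x = D.regionFun t ↔ x = t ∨ x = s) ∧ D.overFun t = D.overFun (rotFun s) ∧
    ErasesTo D D' (fun x => x.1 / 4 == t.1 / 4 || x.1 / 4 == s.1 / 4) (rotFun (rotFun t))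
      (rotFun (rotFun s)) t (embed l t.pos) m m'

instance (D : PlanarCode n) (D' : PlanarCode n') (t s : Fin (4 * n)) (l : List ℕ)
    (m : Fin (4 * n)) (m' : Fin (4 * n')) : Decidable (Omega2To D D' t s l m m') := by
  unfold Omega2To; infer_instance

theorem Omega2To.trackedMove {D : PlanarCode n} {D' : PlanarCode n'} {t s : Fin (4 * n)}
    {l : List ℕ} {m : Fin (4 * n)} {m' : Fin (4 * n')} (ho : Omega2To D D' t s l m m')
    (h : D.Valid) (h' : D'.Valid) : TrackedMove (D.diagram h) m (D'.diagram h') m' := by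
  obtain ⟨h1, h2, h3, h4, h5, h6⟩ := ho
  refine .omega2 t s _ ⟨isCrossing_diagram _ _ _, isCrossing_diagram _ _ _,
    mt mem_vertex_diagram.1 h1, h2, h3, h4, h5⟩ ?_ (h6.tracks h h')
  have hS : (D.diagram h).vertex t ∪ (D.diagram h).vertex s =
      {z | (z.1 / 4 == t.1 / 4 || z.1 / 4 == s.1 / 4) = true} := by
    ext x
    exact (or_congr mem_vertex_diagram mem_vertex_diagram).trans (by simp)
  rw [hS]
  exact h6.erases h h' _

/-- The map on darts that describes the move at the triangle `t` along the strands. -/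
def slide (t : Fin 3 → Fin (4 * n)) (x : Fin (4 * n)) : Fin (4 * n) :=
  let f (i : Fin 3) (y : Fin (4 * n)) : Fin (4 * n) :=
    if x = t i then rotFun (rotFun (rotFun (t (i + 1))))
    else if x = rotFun (rotFun (rotFun (t (i + 1)))) then t i
    else if x = rotFun (rotFun (t i)) then rotFun (t (i + 1))
    else if x = rotFun (t (i + 1)) then rotFun (rotFun (t i)) else y
  f 0 (f 1 (f 2 x))

/-- The map on corners that describes the move at the triangle `t`. -/
def shift (t : Fin 3 → Fin (4 * n)) (x : Fin (4 * n)) : Fin (4 * n) :=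
  let f (i : Fin 3) (y : Fin (4 * n)) : Fin (4 * n) :=
    if x = t i then rotFun (rotFun (rotFun (t (i + 1))))
    else if x = rotFun (t i) then rotFun (rotFun (t (i + 2)))
    else if x = rotFun (rotFun (t i)) then t i
    else if x = rotFun (rotFun (rotFun (t i))) then rotFun (rotFun (t (i + 1))) else y
  f 0 (f 1 (f 2 x))

/-- Conditions for an `Ω₃`-type move at the triangle `t`. -/
def Omega3To (D D' : PlanarCode n) (t : Fin 3 → Fin (4 * n)) : Prop :=
  (∀ i j, i ≠ j → (t j : ℕ) / 4 ≠ t i / 4) ∧ (∀ i, D.invFun (t i) = rotFun (t (i + 1))) ∧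
  (∀ x, D.regionFun x = D.regionFun (t 0) ↔ ∃ i, x = t i) ∧
  ¬ (D.overFun (t 0) = D.overFun (t 1) ∧ D.overFun (t 1) = D.overFun (t 2)) ∧
  (∀ i, slide t (t i) = rotFun (rotFun (rotFun (t (i + 1)))) ∧
    slide t (rotFun (rotFun (rotFun (t (i + 1))))) = t i ∧
    slide t (rotFun (rotFun (t i))) = rotFun (t (i + 1)) ∧
    slide t (rotFun (t (i + 1))) = rotFun (rotFun (t i))) ∧
  (∀ i, shift t (t i) = rotFun (rotFun (rotFun (t (i + 1)))) ∧
    shift t (rotFun (t i)) = rotFun (rotFun (t (i + 2))) ∧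
    shift t (rotFun (rotFun (t i))) = t i ∧
    shift t (rotFun (rotFun (rotFun (t i)))) = rotFun (rotFun (t (i + 1)))) ∧
  (∀ x : Fin (4 * n), (∀ i, (x : ℕ) / 4 ≠ t i / 4) → slide t x = x ∧ shift t x = x) ∧
  (∀ x, D'.invFun x = slide t (D.invFun (slide t x))) ∧
  (∀ x, D'.overFun x = D.overFun x) ∧
  ∀ x, D'.regionFun x = D.regionFun (shift t x)

instance (D D' : PlanarCode n) (t : Fin 3 → Fin (4 * n)) : Decidable (Omega3To D D' t) := by
  unfold Omega3To; infer_instance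

theorem Omega3To.omega3With {D D' : PlanarCode n} {t : Fin 3 → Fin (4 * n)} (ho : Omega3To D D' t)
    (h : D.Valid) (h' : D'.Valid) :
    (D.diagram h).Omega3With (D'.diagram h') t (Equiv.refl _) (slide t) (shift t) := by
  obtain ⟨h1, h2, h3, h4, h5, h6, h7, h8, h9, h10⟩ := ho
  refine ⟨⟨fun i => isCrossing_diagram _ _ _, fun i j hij => mt mem_vertex_diagram.1 (h1 i j hij),
    h2, h3, h4⟩, h5, h6, fun x hx => h7 x fun i => mt mem_vertex_diagram.2 (hx i), fun _ => rfl,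
    h8, h9, fun x y => ?_⟩
  have key : ∀ x y : Fin (4 * n), D'.regionFun x = D'.regionFun y ↔
      D.regionFun (shift t x) = D.regionFun (shift t y) := fun x y => by rw [h10, h10]
  exact key x y

theorem Omega3To.trackedMove {D D' : PlanarCode n} {t : Fin 3 → Fin (4 * n)} {m : Fin (4 * n)}
    (ho : Omega3To D D' t)
    (hm : ∀ i, (m : ℕ) / 4 ≠ t i / 4 ∧ (D.invFun m : ℕ) / 4 ≠ t i / 4) (h : D.Valid)
    (h' : D'.Valid) : TrackedMove (D.diagram h) m (D'.diagram h') m :=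
  .omega3 t _ _ _ (ho.omega3With h h') rfl (fun i => mt mem_vertex_diagram.1 (hm i).1)
    (fun i => mt mem_vertex_diagram.1 (hm i).2)

/-! ### Verification of properties of diagrams -/

theorem isReduced_diagram {D : PlanarCode n}
    (hr : ∀ x, D.regionFun x ≠ D.regionFun (rotFun (rotFun x))) (h : D.Valid) :
    (D.diagram h).IsReduced :=
  fun x _ => hr x

/-- A diagram is prime if two different edges never have the same regions on their sides. -/
theorem isPrime_diagram {D : PlanarCode n}
    (hp : ∀ x y, D.regionFun x = D.regionFun y →
      D.regionFun (D.invFun x) = D.regionFun (D.invFun y) → x = y) (h : D.Valid) :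
    (D.diagram h).IsPrime := by
  refine ⟨isConnected_diagram D h, (crossingCount_diagram D h).symm ▸ h.1, ?_⟩
  rintro ⟨D₁, D₂, x₁, x₂, e, -, -, -, -, -, -, h1, h2, -, -, -, -, h3⟩
  -- The two edges that join the summands have the same regions on their left and right sides, so
  -- they would have to coincide.
  have h4 := (h3 x₁ x₂).2 (.inl ⟨rfl, rfl⟩)
  have h5 := (h3 (D₁.inv x₁) (D₂.inv x₂)).2 (.inr ⟨rfl, rfl⟩)
  rw [← h1, ← h2] at h5
  exact Sum.inl_ne_inr (e.injective (hp _ _ h4 h5.symm))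

end PlanarCode

namespace PlanarCode

open LinkDiagram

variable {n : ℕ}

/-! ### Verification of stability -/

/-- The diagram with the given tables, with a marked edge. -/
def marked (D : PlanarCode n) (h : D.Valid) (m : Fin (4 * n))
    (hm : D.regionFun m ≠ D.regionFun (D.invFun m)) : MarkedDiagram where
  diagram := D.diagram h
  mark := m
  crossing := isCrossing_diagram D h m
  separating := hm

/-- The next corner of the same region. -/
def next (D : PlanarCode n) (x : Fin (4 * n)) : Fin (4 * n) :=
  rotFun (rotFun (rotFun (D.invFun x)))

/-- The diagram has no edge that bounds a kink, and no bigon that can be removed. -/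
def Irreducible (D : PlanarCode n) : Prop :=
  (∀ x, D.invFun x ≠ rotFun x) ∧
    ∀ x, D.next (D.next x) = x → D.overFun x ≠ D.overFun (rotFun (D.next x))

instance (D : PlanarCode n) : Decidable D.Irreducible := by unfold Irreducible; infer_instance

/-- The corner `x` is that of a triangle with strands that are not in cyclic position. -/
def IsTriangle (D : PlanarCode n) (x : Fin (4 * n)) : Prop :=
  D.next (D.next (D.next x)) = x ∧
    ¬ (D.overFun x = D.overFun (D.next x) ∧ D.overFun (D.next x) = D.overFun (D.next (D.next x)))

instance (D : PlanarCode n) (x : Fin (4 * n)) : Decidable (D.IsTriangle x) := by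
  unfold IsTriangle; infer_instance

/-- The three corners of the triangle at `x`. -/
def triangle (D : PlanarCode n) (x : Fin (4 * n)) : Fin 3 → Fin (4 * n) :=
  ![x, D.next x, D.next (D.next x)]

/-- All `Ω₃`-type moves of the first diagram lead to the second one and do not involve the edge
of `m`. -/
def SlidesTo (D D' : PlanarCode n) (m : Fin (4 * n)) : Prop :=
  ∀ x, D.IsTriangle x → Omega3To D D' (D.triangle x) ∧
    ∀ i, (m : ℕ) / 4 ≠ D.triangle x i / 4 ∧ (D.invFun m : ℕ) / 4 ≠ D.triangle x i / 4

instance (D D' : PlanarCode n) (m : Fin (4 * n)) : Decidable (SlidesTo D D' m) := by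
  unfold SlidesTo; infer_instance

theorem next_eq {D : PlanarCode n} {x y : Fin (4 * n)} (h : D.invFun x = rotFun y) :
    D.next x = y := by
  rw [next, h, rotFun_four]

/-- `Irreducible` is a test on edges alone; it does not ask whether a region is a disk, so it
excludes every possible site. -/
theorem Irreducible.not_isOmega1Site {D : PlanarCode n} (hi : D.Irreducible) (h : D.Valid)
    (t : (D.diagram h).Dart) : ¬ (D.diagram h).IsOmega1Site t :=
  fun ht => hi.1 t ht.2.1

theorem Irreducible.not_isOmega2Site {D : PlanarCode n} (hi : D.Irreducible) (h : D.Valid)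
    (t s : (D.diagram h).Dart) : ¬ (D.diagram h).IsOmega2Site t s := by
  rintro ⟨-, -, -, h1, h2, -, h3⟩
  have h1' := next_eq (D := D) h1
  have h2' := next_eq (D := D) h2
  refine hi.2 t ?_ ?_
  · rw [h1', h2']
  · rw [h1']
    exact h3

theorem Irreducible.mark_ne {D : PlanarCode n} (hi : D.Irreducible) (h : D.Valid)
    (m : Fin (4 * n)) (hm : D.regionFun m ≠ D.regionFun (D.invFun m)) :
    (D.marked h m hm).mark' ≠ (D.diagram h).rot (D.marked h m hm).mark ∧
      (D.marked h m hm).mark ≠ (D.diagram h).rot (D.marked h m hm).mark' := by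
  refine ⟨hi.1 m, fun h' => hi.1 (D.invFun m) ?_⟩
  rw [h.2.1]
  exact h'

/-- `next` runs through the corners of a triangle, so the triangle is determined by its first
corner, and it is enough to test single darts. -/
theorem isTriangle_of_isOmega3Triangle {D : PlanarCode n} {h : D.Valid}
    {t : Fin 3 → (D.diagram h).Dart} (ht : (D.diagram h).IsOmega3Triangle t) :
    D.IsTriangle (t 0) ∧ D.triangle (t 0) = t := by
  have h0 : D.next (t 0) = t 1 := next_eq (ht.edge 0)
  have h1 : D.next (t 1) = t 2 := next_eq (ht.edge 1)
  have h2 : D.next (t 2) = t 0 := next_eq (ht.edge 2)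
  refine ⟨⟨by rw [h0, h1, h2], by rw [h0, h1]; exact ht.not_cyclic⟩, ?_⟩
  ext i
  fin_cases i
  · rfl
  · exact congrArg Fin.val h0
  · exact congrArg Fin.val ((congrArg D.next h0).trans h1)

theorem not_isOmega3Triangle {D : PlanarCode n} (hD : ∀ x, ¬ D.IsTriangle x) (h : D.Valid)
    (t : Fin 3 → (D.diagram h).Dart) : ¬ (D.diagram h).IsOmega3Triangle t :=
  fun ht => hD _ (isTriangle_of_isOmega3Triangle ht).1

theorem isStable_singleton {D : PlanarCode n} (hi : D.Irreducible) (hD : ∀ x, ¬ D.IsTriangle x)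
    (h : D.Valid) (m : Fin (4 * n)) (hm : D.regionFun m ≠ D.regionFun (D.invFun m)) :
    MarkedDiagram.IsStable {D.marked h m hm} := by
  constructor <;> rintro X rfl
  · exact hi.not_isOmega1Site h
  · exact hi.not_isOmega2Site h
  · exact fun t ht => absurd ht (not_isOmega3Triangle hD h t)
  · exact fun t ht => absurd ht (not_isOmega3Triangle hD h t)
  · exact hi.mark_ne h m hm

theorem SlidesTo.omega3 {D D' : PlanarCode n} {m : Fin (4 * n)} (hs : SlidesTo D D' m)
    (h : D.Valid) (h' : D'.Valid) {t : Fin 3 → (D.diagram h).Dart}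
    (ht : (D.diagram h).IsOmega3Triangle t) :
    (D.diagram h).Omega3With (D'.diagram h') t (Equiv.refl _) (slide t) (shift t) ∧
      ∀ i, (m : (D.diagram h).Dart) ∉ (D.diagram h).vertex (t i) ∧
        D.invFun m ∉ (D.diagram h).vertex (t i) := by
  obtain ⟨h1, h2⟩ := isTriangle_of_isOmega3Triangle ht
  obtain ⟨h3, h4⟩ := hs _ h1
  rw [h2] at h3 h4
  exact ⟨h3.omega3With h h', fun i => ⟨mt mem_vertex_diagram.1 (h4 i).1,
    mt mem_vertex_diagram.1 (h4 i).2⟩⟩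

/-- The two tables number the darts compatibly, so the moves identify darts by the identity and the
same `m` marks both diagrams. -/
theorem isStable_pair {D D' : PlanarCode n} (hi : D.Irreducible) (hi' : D'.Irreducible)
    (h : D.Valid) (h' : D'.Valid) {m : Fin (4 * n)} (hs : SlidesTo D D' m) (hs' : SlidesTo D' D m)
    (hm : D.regionFun m ≠ D.regionFun (D.invFun m))
    (hm' : D'.regionFun m ≠ D'.regionFun (D'.invFun m)) :
    MarkedDiagram.IsStable {D.marked h m hm, D'.marked h' m hm'} := by
  constructor <;> rintro X (rfl | rfl)
  · exact hi.not_isOmega1Site h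
  · exact hi'.not_isOmega1Site h'
  · exact hi.not_isOmega2Site h
  · exact hi'.not_isOmega2Site h'
  · exact fun t ht => (hs.omega3 h h' ht).2
  · exact fun t ht => (hs'.omega3 h' h ht).2
  · exact fun t ht => ⟨_, .inr rfl, _, _, _, (hs.omega3 h h' ht).1, rfl⟩
  · exact fun t ht => ⟨_, .inl rfl, _, _, _, (hs'.omega3 h' h ht).1, rfl⟩
  · exact hi.mark_ne h m hm
  · exact hi'.mark_ne h' m hm'

end PlanarCode

/-! ### The unlink diagram with 8 crossings and its reduction to overlapping circles -/

namespace PlanarCode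

open LinkDiagram

/-- A prime rigid hard diagram of the unlink with two components. -/
def unlink0 : PlanarCode 8 where
  invTable := [4, 7, 8, 11, 0, 12, 16, 1, 2, 19, 13, 3, 5, 10, 20, 24, 6, 27, 21, 9, 14, 18, 28,
    31, 15, 30, 29, 17, 22, 26, 25, 23]
  overTable := [0, 1, 1, 0, 0, 1, 0, 0]
  regionTable := [0, 1, 2, 3, 3, 4, 1, 0, 1, 5, 3, 2, 3, 5, 6, 4, 4, 7, 5, 1, 5, 7, 8, 6, 6, 9,
    7, 4, 7, 9, 6, 8]
  parentTable := [0, 4, 8, 12, 16, 20, 24, 28]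

theorem valid_unlink0 : unlink0.Valid := by decide +kernel

/-- `unlink0` with a kink on the edge between the darts 23 and 31. -/
def unlink1 : PlanarCode 9 where
  invTable := [4, 7, 8, 11, 0, 12, 16, 1, 2, 19, 13, 3, 5, 10, 20, 24, 6, 27, 21, 9, 14, 18, 28,
    34, 15, 30, 29, 17, 22, 26, 25, 35, 33, 32, 23, 31]
  overTable := [0, 1, 1, 0, 0, 1, 0, 0, 0]
  regionTable := [0, 1, 2, 3, 3, 4, 1, 0, 1, 5, 3, 2, 3, 5, 6, 4, 4, 7, 5, 1, 5, 7, 8, 6, 6, 9,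
    7, 4, 7, 9, 6, 8, 10, 6, 8, 6]
  parentTable := [0, 4, 8, 12, 16, 20, 24, 28, 34]

theorem valid_unlink1 : unlink1.Valid := by decide +kernel

def unlink2 : PlanarCode 9 where
  invTable := [4, 7, 8, 11, 0, 12, 16, 1, 2, 19, 13, 3, 5, 10, 28, 24, 6, 27, 34, 9, 30, 32, 25,
    31, 15, 22, 35, 17, 14, 33, 20, 23, 21, 29, 18, 26]
  overTable := [0, 1, 1, 0, 0, 1, 0, 0, 0]
  regionTable := [0, 1, 2, 3, 3, 4, 1, 0, 1, 5, 3, 2, 3, 5, 6, 4, 4, 7, 5, 1, 8, 9, 6, 10, 6, 9,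
    7, 4, 5, 8, 10, 6, 8, 5, 7, 9]
  parentTable := [0, 4, 8, 12, 16, 20, 24, 28, 34]

theorem valid_unlink2 : unlink2.Valid := by decide +kernel

def unlink3 : PlanarCode 9 where
  invTable := [4, 7, 8, 11, 0, 12, 34, 1, 2, 27, 13, 3, 5, 10, 28, 35, 32, 22, 21, 25, 30, 18,
    17, 31, 33, 19, 29, 9, 14, 26, 20, 23, 16, 24, 6, 15]
  overTable := [0, 1, 1, 0, 0, 1, 0, 0, 0]
  regionTable := [0, 1, 2, 3, 3, 4, 1, 0, 1, 5, 3, 2, 3, 5, 6, 4, 6, 9, 8, 7, 8, 9, 6, 10, 7, 8,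
    5, 1, 5, 8, 10, 6, 7, 1, 4, 6]
  parentTable := [0, 4, 8, 12, 16, 20, 27, 28, 34]

theorem valid_unlink3 : unlink3.Valid := by decide +kernel

def unlink4 : PlanarCode 7 where
  invTable := [4, 7, 8, 11, 0, 12, 26, 1, 2, 19, 13, 3, 5, 10, 20, 27, 25, 22, 21, 9, 14, 18,
    17, 24, 23, 16, 6, 15]
  overTable := [0, 1, 1, 0, 0, 0, 0]
  regionTable := [0, 1, 2, 3, 3, 4, 1, 0, 1, 5, 3, 2, 3, 5, 6, 4, 7, 8, 5, 1, 5, 8, 7, 6, 7, 1,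
    4, 6]
  parentTable := [0, 4, 8, 12, 19, 20, 26]

theorem valid_unlink4 : unlink4.Valid := by decide +kernel

def unlink5 : PlanarCode 7 where
  invTable := [26, 12, 8, 11, 24, 20, 23, 14, 2, 19, 27, 3, 1, 25, 7, 16, 15, 22, 21, 9, 5, 18,
    17, 6, 4, 13, 0, 10]
  overTable := [0, 1, 1, 0, 0, 0, 0]
  regionTable := [0, 1, 2, 3, 5, 6, 7, 4, 1, 5, 3, 2, 0, 4, 7, 1, 7, 8, 5, 1, 5, 8, 7, 6, 4, 0,
    3, 5]
  parentTable := [0, 4, 8, 12, 16, 20, 26]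

theorem valid_unlink5 : unlink5.Valid := by decide +kernel

def unlink6 : PlanarCode 5 where
  invTable := [18, 8, 4, 7, 2, 15, 19, 3, 1, 17, 13, 12, 11, 10, 16, 5, 14, 9, 0, 6]
  overTable := [0, 1, 0, 0, 0]
  regionTable := [0, 1, 2, 3, 1, 4, 3, 2, 0, 5, 6, 1, 6, 5, 4, 1, 5, 0, 3, 4]
  parentTable := [0, 4, 8, 14, 18]

theorem valid_unlink6 : unlink6.Valid := by decide +kernel

def unlink7 : PlanarCode 5 where
  invTable := [14, 13, 4, 7, 2, 10, 9, 3, 15, 6, 5, 19, 18, 1, 0, 8, 17, 16, 12, 11]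
  overTable := [0, 1, 0, 0, 0]
  regionTable := [0, 1, 2, 3, 1, 4, 3, 2, 3, 4, 1, 5, 1, 0, 3, 5, 6, 1, 5, 1]
  parentTable := [0, 4, 8, 14, 18]

theorem valid_unlink7 : unlink7.Valid := by decide +kernel

def unlink8 : PlanarCode 3 where
  invTable := [6, 5, 11, 7, 10, 1, 0, 3, 9, 8, 4, 2]
  overTable := [0, 0, 0]
  regionTable := [0, 1, 2, 3, 1, 0, 3, 2, 4, 1, 2, 1]
  parentTable := [0, 6, 11]

theorem valid_unlink8 : unlink8.Valid := by decide +kernel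

/-- Two circles that overlap. The sequence stops here because the `Ω₂↓` move that separates them
removes both crossings, also that of the mark. -/
def unlink9 : PlanarCode 2 where
  invTable := [6, 5, 4, 7, 2, 1, 0, 3]
  overTable := [0, 0]
  regionTable := [0, 1, 2, 3, 1, 0, 3, 2]
  parentTable := [0, 6]

theorem valid_unlink9 : unlink9.Valid := by decide +kernel

/-- Used backwards, this is the only increasing move of the sequence; a hard diagram needs at least
one. -/
theorem trackedMove_unlink1_unlink0 :
    TrackedMove (unlink1.diagram valid_unlink1) (2 : Fin (4 * 9))
      (unlink0.diagram valid_unlink0) (2 : Fin (4 * 8)) :=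
  Omega1To.trackedMove (t := 32) (l := [0, 1, 2, 3, 4, 5, 6, 7]) (by decide +kernel) _ _

theorem trackedMove_unlink1_unlink2 :
    TrackedMove (unlink1.diagram valid_unlink1) (2 : Fin (4 * 9))
      (unlink2.diagram valid_unlink2) (2 : Fin (4 * 9)) :=
  Omega3To.trackedMove (t := ![22, 31, 34]) (by decide +kernel) (by decide +kernel) _ _

theorem trackedMove_unlink2_unlink3 :
    TrackedMove (unlink2.diagram valid_unlink2) (2 : Fin (4 * 9))
      (unlink3.diagram valid_unlink3) (2 : Fin (4 * 9)) :=
  Omega3To.trackedMove (t := ![17, 26, 34]) (by decide +kernel) (by decide +kernel) _ _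

theorem trackedMove_unlink3_unlink4 :
    TrackedMove (unlink3.diagram valid_unlink3) (2 : Fin (4 * 9))
      (unlink4.diagram valid_unlink4) (2 : Fin (4 * 7)) :=
  Omega2To.trackedMove (t := 17) (s := 21) (l := [0, 1, 2, 3, 6, 7, 8])
    (by decide +kernel) _ _

theorem trackedMove_unlink4_unlink5 :
    TrackedMove (unlink4.diagram valid_unlink4) (2 : Fin (4 * 7))
      (unlink5.diagram valid_unlink5) (2 : Fin (4 * 7)) :=
  Omega3To.trackedMove (t := ![5, 15, 26]) (by decide +kernel) (by decide +kernel) _ _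

theorem trackedMove_unlink5_unlink6 :
    TrackedMove (unlink5.diagram valid_unlink5) (2 : Fin (4 * 7))
      (unlink6.diagram valid_unlink6) (2 : Fin (4 * 5)) :=
  Omega2To.trackedMove (t := 5) (s := 23) (l := [0, 2, 3, 4, 6])
    (by decide +kernel) _ _

theorem trackedMove_unlink6_unlink7 :
    TrackedMove (unlink6.diagram valid_unlink6) (2 : Fin (4 * 5))
      (unlink7.diagram valid_unlink7) (2 : Fin (4 * 5)) :=
  Omega3To.trackedMove (t := ![9, 16, 13]) (by decide +kernel) (by decide +kernel) _ _

theorem trackedMove_unlink7_unlink8 :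
    TrackedMove (unlink7.diagram valid_unlink7) (2 : Fin (4 * 5))
      (unlink8.diagram valid_unlink8) (2 : Fin (4 * 3)) :=
  Omega2To.trackedMove (t := 5) (s := 9) (l := [0, 3, 4])
    (by decide +kernel) _ _

theorem trackedMove_unlink8_unlink9 :
    TrackedMove (unlink8.diagram valid_unlink8) (2 : Fin (4 * 3))
      (unlink9.diagram valid_unlink9) (2 : Fin (4 * 2)) :=
  Omega1To.trackedMove (t := 8) (l := [0, 1]) (by decide +kernel) _ _

def markedUnlink0 : MarkedDiagram :=
  unlink0.marked valid_unlink0 2 (by decide +kernel)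

def markedUnlink1 : MarkedDiagram :=
  unlink1.marked valid_unlink1 2 (by decide +kernel)

def markedUnlink2 : MarkedDiagram :=
  unlink2.marked valid_unlink2 2 (by decide +kernel)

def markedUnlink3 : MarkedDiagram :=
  unlink3.marked valid_unlink3 2 (by decide +kernel)

def markedUnlink4 : MarkedDiagram :=
  unlink4.marked valid_unlink4 2 (by decide +kernel)

def markedUnlink5 : MarkedDiagram :=
  unlink5.marked valid_unlink5 2 (by decide +kernel)

def markedUnlink6 : MarkedDiagram :=
  unlink6.marked valid_unlink6 2 (by decide +kernel)

def markedUnlink7 : MarkedDiagram :=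
  unlink7.marked valid_unlink7 2 (by decide +kernel)

def markedUnlink8 : MarkedDiagram :=
  unlink8.marked valid_unlink8 2 (by decide +kernel)

def markedUnlink9 : MarkedDiagram :=
  unlink9.marked valid_unlink9 2 (by decide +kernel)

/-- The number of crossings rises from 8 to 9 and then falls through 7, 5, and 3 to 2. -/
theorem equivalent_markedUnlink0 : MarkedDiagram.Equivalent markedUnlink0 markedUnlink9 :=
  .trans _ _ _ (.symm _ _ (.rel markedUnlink1 markedUnlink0 trackedMove_unlink1_unlink0)) <|
  .trans _ _ _ (.rel markedUnlink1 markedUnlink2 trackedMove_unlink1_unlink2) <|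
  .trans _ _ _ (.rel markedUnlink2 markedUnlink3 trackedMove_unlink2_unlink3) <|
  .trans _ _ _ (.rel markedUnlink3 markedUnlink4 trackedMove_unlink3_unlink4) <|
  .trans _ _ _ (.rel markedUnlink4 markedUnlink5 trackedMove_unlink4_unlink5) <|
  .trans _ _ _ (.rel markedUnlink5 markedUnlink6 trackedMove_unlink5_unlink6) <|
  .trans _ _ _ (.rel markedUnlink6 markedUnlink7 trackedMove_unlink6_unlink7) <|
  .trans _ _ _ (.rel markedUnlink7 markedUnlink8 trackedMove_unlink7_unlink8) <|
  .rel markedUnlink8 markedUnlink9 trackedMove_unlink8_unlink9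

/-! ### The unknot diagram with 10 crossings and its reduction to a kink -/

/-- A prime shaky hard diagram of the unknot. -/
def unknot0 : PlanarCode 10 where
  invTable := [4, 7, 8, 11, 0, 12, 16, 1, 2, 19, 13, 3, 5, 10, 20, 24, 6, 27, 28, 9, 14, 31, 32,
    35, 15, 36, 29, 17, 18, 26, 39, 21, 22, 38, 37, 23, 25, 34, 33, 30]
  overTable := [1, 0, 0, 0, 0, 1, 1, 1, 0, 0]
  regionTable := [0, 1, 2, 3, 3, 4, 1, 0, 1, 5, 3, 2, 3, 5, 6, 4, 4, 7, 5, 1, 5, 8, 9, 6, 6, 10,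
    7, 4, 7, 10, 8, 5, 8, 11, 6, 9, 6, 11, 8, 10]
  parentTable := [0, 4, 8, 12, 16, 20, 24, 28, 32, 36]

theorem valid_unknot0 : unknot0.Valid := by decide +kernel

/-- `unknot0` with a kink on the edge between the darts 3 and 11. -/
def unknot1 : PlanarCode 11 where
  invTable := [4, 7, 8, 42, 0, 12, 16, 1, 2, 19, 13, 43, 5, 10, 20, 24, 6, 27, 28, 9, 14, 31,
    32, 35, 15, 36, 29, 17, 18, 26, 39, 21, 22, 38, 37, 23, 25, 34, 33, 30, 41, 40, 3, 11]
  overTable := [1, 0, 0, 0, 0, 1, 1, 1, 0, 0, 0]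
  regionTable := [0, 1, 2, 3, 3, 4, 1, 0, 1, 5, 3, 2, 3, 5, 6, 4, 4, 7, 5, 1, 5, 8, 9, 6, 6, 10,
    7, 4, 7, 10, 8, 5, 8, 11, 6, 9, 6, 11, 8, 10, 12, 3, 2, 3]
  parentTable := [0, 4, 8, 12, 16, 20, 24, 28, 32, 36, 42]

theorem valid_unknot1 : unknot1.Valid := by decide +kernel

def unknot2 : PlanarCode 11 where
  invTable := [10, 40, 13, 11, 8, 12, 16, 42, 4, 41, 0, 3, 5, 2, 20, 24, 6, 27, 28, 43, 14, 31,
    32, 35, 15, 36, 29, 17, 18, 26, 39, 21, 22, 38, 37, 23, 25, 34, 33, 30, 1, 9, 7, 19]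
  overTable := [1, 0, 0, 0, 0, 1, 1, 1, 0, 0, 0]
  regionTable := [2, 5, 3, 12, 3, 4, 1, 0, 0, 2, 12, 3, 3, 5, 6, 4, 4, 7, 5, 1, 5, 8, 9, 6, 6,
    10, 7, 4, 7, 10, 8, 5, 8, 11, 6, 9, 6, 11, 8, 10, 2, 0, 1, 5]
  parentTable := [0, 4, 10, 13, 19, 20, 24, 28, 32, 36, 40]

theorem valid_unknot2 : unknot2.Valid := by decide +kernel

def unknot3 : PlanarCode 11 where
  invTable := [10, 7, 13, 11, 18, 40, 28, 1, 16, 19, 0, 3, 42, 2, 20, 24, 8, 41, 4, 9, 14, 31,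
    32, 35, 15, 36, 29, 43, 6, 26, 39, 21, 22, 38, 37, 23, 25, 34, 33, 30, 5, 17, 12, 27]
  overTable := [1, 0, 0, 0, 0, 1, 1, 1, 0, 0, 0]
  regionTable := [2, 5, 3, 12, 1, 7, 5, 2, 0, 2, 12, 3, 3, 5, 6, 4, 3, 1, 2, 0, 5, 8, 9, 6, 6,
    10, 7, 4, 7, 10, 8, 5, 8, 11, 6, 9, 6, 11, 8, 10, 1, 3, 4, 7]
  parentTable := [0, 7, 10, 13, 16, 20, 24, 28, 32, 39, 40]

theorem valid_unknot3 : unknot3.Valid := by decide +kernel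

def unknot4 : PlanarCode 9 where
  invTable := [4, 7, 9, 33, 0, 32, 20, 1, 34, 2, 12, 16, 10, 23, 24, 27, 11, 28, 21, 35, 6, 18,
    31, 13, 14, 30, 29, 15, 17, 26, 25, 22, 5, 3, 8, 19]
  overTable := [1, 0, 0, 1, 1, 1, 0, 0, 0]
  regionTable := [0, 1, 2, 3, 3, 4, 1, 0, 2, 1, 5, 6, 1, 7, 8, 5, 5, 9, 4, 6, 4, 9, 7, 1, 7, 10,
    5, 8, 5, 10, 7, 9, 3, 2, 6, 4]
  parentTable := [0, 4, 9, 12, 16, 20, 24, 31, 33]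

theorem valid_unknot4 : unknot4.Valid := by decide +kernel

def unknot5 : PlanarCode 9 where
  invTable := [11, 35, 16, 19, 9, 8, 20, 33, 5, 4, 32, 0, 34, 23, 24, 27, 2, 28, 21, 3, 6, 18,
    31, 13, 14, 30, 29, 15, 17, 26, 25, 22, 10, 7, 12, 1]
  overTable := [1, 0, 0, 1, 1, 1, 0, 0, 0]
  regionTable := [2, 5, 6, 4, 3, 4, 1, 0, 3, 0, 2, 4, 1, 7, 8, 5, 5, 9, 4, 6, 4, 9, 7, 1, 7, 10,
    5, 8, 5, 10, 7, 9, 0, 1, 5, 2]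
  parentTable := [0, 5, 11, 12, 16, 21, 24, 28, 35]

theorem valid_unknot5 : unknot5.Valid := by decide +kernel

def unknot6 : PlanarCode 7 where
  invTable := [5, 4, 12, 25, 1, 0, 24, 13, 26, 15, 16, 19, 2, 7, 23, 9, 10, 22, 21, 11, 27, 18,
    17, 14, 6, 3, 8, 20]
  overTable := [0, 0, 1, 1, 0, 0, 0]
  regionTable := [0, 1, 2, 3, 0, 3, 4, 1, 2, 5, 6, 7, 1, 4, 5, 2, 5, 8, 7, 6, 7, 8, 5, 4, 3, 2,
    7, 4]
  parentTable := [0, 5, 9, 12, 18, 23, 25]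

theorem valid_unknot6 : unknot6.Valid := by decide +kernel

def unknot7 : PlanarCode 7 where
  invTable := [13, 27, 7, 20, 26, 12, 8, 2, 6, 15, 16, 19, 5, 0, 23, 9, 10, 22, 21, 11, 3, 18,
    17, 14, 25, 24, 4, 1]
  overTable := [0, 0, 1, 1, 0, 0, 0]
  regionTable := [1, 3, 7, 4, 1, 2, 7, 3, 2, 5, 6, 7, 1, 4, 5, 2, 5, 8, 7, 6, 7, 8, 5, 4, 0, 1,
    3, 1]
  parentTable := [0, 7, 9, 13, 18, 20, 27]

theorem valid_unknot7 : unknot7.Valid := by decide +kernel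

def unknot8 : PlanarCode 6 where
  invTable := [13, 4, 7, 20, 1, 12, 8, 2, 6, 15, 16, 19, 5, 0, 23, 9, 10, 22, 21, 11, 3, 18, 17,
    14]
  overTable := [0, 0, 1, 1, 0, 0]
  regionTable := [0, 1, 2, 3, 0, 4, 2, 1, 4, 5, 6, 2, 0, 3, 5, 4, 5, 7, 2, 6, 2, 7, 5, 3]
  parentTable := [0, 4, 9, 13, 18, 20]

theorem valid_unknot8 : unknot8.Valid := by decide +kernel

def unknot9 : PlanarCode 6 where
  invTable := [9, 8, 15, 6, 20, 23, 3, 14, 1, 0, 16, 19, 13, 12, 7, 2, 10, 22, 21, 11, 4, 18,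
    17, 5]
  overTable := [0, 0, 1, 1, 0, 0]
  regionTable := [4, 2, 0, 5, 3, 5, 0, 2, 4, 5, 6, 2, 1, 2, 0, 2, 5, 7, 2, 6, 2, 7, 5, 3]
  parentTable := [0, 6, 9, 15, 16, 20]

theorem valid_unknot9 : unknot9.Valid := by decide +kernel

def unknot10 : PlanarCode 4 where
  invTable := [5, 4, 11, 13, 1, 0, 12, 15, 9, 8, 14, 2, 6, 3, 10, 7]
  overTable := [0, 1, 1, 0]
  regionTable := [0, 1, 2, 3, 0, 3, 4, 1, 5, 1, 2, 1, 3, 2, 1, 4]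
  parentTable := [0, 5, 11, 13]

theorem valid_unknot10 : unknot10.Valid := by decide +kernel

def unknot11 : PlanarCode 3 where
  invTable := [5, 4, 10, 9, 1, 0, 8, 11, 6, 3, 2, 7]
  overTable := [0, 1, 0]
  regionTable := [0, 1, 2, 3, 0, 3, 4, 1, 3, 2, 1, 4]
  parentTable := [0, 5, 10]

theorem valid_unknot11 : unknot11.Valid := by decide +kernel

/-- A circle with one kink, kept as long as the mark needs a crossing at its end. -/
def unknot12 : PlanarCode 1 where
  invTable := [3, 2, 1, 0]
  overTable := [1]
  regionTable := [0, 1, 0, 2]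
  parentTable := [0]

theorem valid_unknot12 : unknot12.Valid := by decide +kernel

/-- The result of the only `Ω₃`-type move on `unknot0`. -/
def unknotSlid : PlanarCode 10 where
  invTable := [4, 7, 8, 11, 0, 12, 16, 1, 2, 19, 13, 3, 5, 10, 20, 29, 6, 36, 39, 9, 14, 26, 32,
    35, 31, 33, 21, 38, 37, 15, 34, 24, 22, 25, 30, 23, 17, 28, 27, 18]
  overTable := [1, 0, 0, 0, 0, 1, 1, 1, 0, 0]
  regionTable := [0, 1, 2, 3, 3, 4, 1, 0, 1, 5, 3, 2, 3, 5, 6, 4, 4, 7, 5, 1, 5, 8, 9, 6, 11, 8,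
    5, 10, 4, 6, 11, 10, 8, 11, 6, 9, 4, 10, 5, 7]
  parentTable := [0, 4, 8, 12, 16, 20, 26, 29, 32, 36]

theorem valid_unknotSlid : unknotSlid.Valid := by decide +kernel

theorem trackedMove_unknot1_unknot0 :
    TrackedMove (unknot1.diagram valid_unknot1) (22 : Fin (4 * 11))
      (unknot0.diagram valid_unknot0) (22 : Fin (4 * 10)) :=
  Omega1To.trackedMove (t := 40) (l := [0, 1, 2, 3, 4, 5, 6, 7, 8, 9]) (by decide +kernel) _ _

theorem trackedMove_unknot1_unknot2 :
    TrackedMove (unknot1.diagram valid_unknot1) (22 : Fin (4 * 11))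
      (unknot2.diagram valid_unknot2) (22 : Fin (4 * 11)) :=
  Omega3To.trackedMove (t := ![2, 11, 42]) (by decide +kernel) (by decide +kernel) _ _

theorem trackedMove_unknot2_unknot3 :
    TrackedMove (unknot2.diagram valid_unknot2) (22 : Fin (4 * 11))
      (unknot3.diagram valid_unknot3) (22 : Fin (4 * 11)) :=
  Omega3To.trackedMove (t := ![6, 19, 42]) (by decide +kernel) (by decide +kernel) _ _

/-- The remaining crossings, listed in `l`, are renumbered, so the marked dart 22 at the crossing 5
becomes the dart 14 at the crossing 3. -/
theorem trackedMove_unknot3_unknot4 :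
    TrackedMove (unknot3.diagram valid_unknot3) (22 : Fin (4 * 11))
      (unknot4.diagram valid_unknot4) (14 : Fin (4 * 9)) :=
  Omega2To.trackedMove (t := 8) (s := 19) (l := [0, 1, 3, 5, 6, 7, 8, 9, 10])
    (by decide +kernel) _ _

theorem trackedMove_unknot4_unknot5 :
    TrackedMove (unknot4.diagram valid_unknot4) (14 : Fin (4 * 9))
      (unknot5.diagram valid_unknot5) (14 : Fin (4 * 9)) :=
  Omega3To.trackedMove (t := ![2, 8, 33]) (by decide +kernel) (by decide +kernel) _ _

theorem trackedMove_unknot5_unknot6 :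
    TrackedMove (unknot5.diagram valid_unknot5) (14 : Fin (4 * 9))
      (unknot6.diagram valid_unknot6) (10 : Fin (4 * 7)) :=
  Omega2To.trackedMove (t := 2) (s := 19) (l := [1, 2, 3, 5, 6, 7, 8])
    (by decide +kernel) _ _

theorem trackedMove_unknot6_unknot7 :
    TrackedMove (unknot6.diagram valid_unknot6) (10 : Fin (4 * 7))
      (unknot7.diagram valid_unknot7) (10 : Fin (4 * 7)) :=
  Omega3To.trackedMove (t := ![3, 24, 5]) (by decide +kernel) (by decide +kernel) _ _

theorem trackedMove_unknot7_unknot8 :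
    TrackedMove (unknot7.diagram valid_unknot7) (10 : Fin (4 * 7))
      (unknot8.diagram valid_unknot8) (10 : Fin (4 * 6)) :=
  Omega1To.trackedMove (t := 24) (l := [0, 1, 2, 3, 4, 5]) (by decide +kernel) _ _

theorem trackedMove_unknot8_unknot9 :
    TrackedMove (unknot8.diagram valid_unknot8) (10 : Fin (4 * 6))
      (unknot9.diagram valid_unknot9) (10 : Fin (4 * 6)) :=
  Omega3To.trackedMove (t := ![0, 12, 4]) (by decide +kernel) (by decide +kernel) _ _

theorem trackedMove_unknot9_unknot10 :
    TrackedMove (unknot9.diagram valid_unknot9) (10 : Fin (4 * 6))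
      (unknot10.diagram valid_unknot10) (6 : Fin (4 * 4)) :=
  Omega2To.trackedMove (t := 4) (s := 23) (l := [0, 2, 3, 4])
    (by decide +kernel) _ _

theorem trackedMove_unknot10_unknot11 :
    TrackedMove (unknot10.diagram valid_unknot10) (6 : Fin (4 * 4))
      (unknot11.diagram valid_unknot11) (6 : Fin (4 * 3)) :=
  Omega1To.trackedMove (t := 8) (l := [0, 1, 3]) (by decide +kernel) _ _

theorem trackedMove_unknot11_unknot12 :
    TrackedMove (unknot11.diagram valid_unknot11) (6 : Fin (4 * 3))
      (unknot12.diagram valid_unknot12) (2 : Fin (4 * 1)) :=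
  Omega2To.trackedMove (t := 2) (s := 9) (l := [1])
    (by decide +kernel) _ _

def markedUnknot0 : MarkedDiagram :=
  unknot0.marked valid_unknot0 22 (by decide +kernel)

def markedUnknot1 : MarkedDiagram :=
  unknot1.marked valid_unknot1 22 (by decide +kernel)

def markedUnknot2 : MarkedDiagram :=
  unknot2.marked valid_unknot2 22 (by decide +kernel)

def markedUnknot3 : MarkedDiagram :=
  unknot3.marked valid_unknot3 22 (by decide +kernel)

def markedUnknot4 : MarkedDiagram :=
  unknot4.marked valid_unknot4 14 (by decide +kernel)

def markedUnknot5 : MarkedDiagram :=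
  unknot5.marked valid_unknot5 14 (by decide +kernel)

def markedUnknot6 : MarkedDiagram :=
  unknot6.marked valid_unknot6 10 (by decide +kernel)

def markedUnknot7 : MarkedDiagram :=
  unknot7.marked valid_unknot7 10 (by decide +kernel)

def markedUnknot8 : MarkedDiagram :=
  unknot8.marked valid_unknot8 10 (by decide +kernel)

def markedUnknot9 : MarkedDiagram :=
  unknot9.marked valid_unknot9 10 (by decide +kernel)

def markedUnknot10 : MarkedDiagram :=
  unknot10.marked valid_unknot10 6 (by decide +kernel)

def markedUnknot11 : MarkedDiagram :=
  unknot11.marked valid_unknot11 6 (by decide +kernel)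

def markedUnknot12 : MarkedDiagram :=
  unknot12.marked valid_unknot12 2 (by decide +kernel)

/-- The number of crossings rises from 10 to 11 and then falls through 9, 7, 6, 4, and 3 to 1. -/
theorem equivalent_markedUnknot0 : MarkedDiagram.Equivalent markedUnknot0 markedUnknot12 :=
  .trans _ _ _ (.symm _ _ (.rel markedUnknot1 markedUnknot0 trackedMove_unknot1_unknot0)) <|
  .trans _ _ _ (.rel markedUnknot1 markedUnknot2 trackedMove_unknot1_unknot2) <|
  .trans _ _ _ (.rel markedUnknot2 markedUnknot3 trackedMove_unknot2_unknot3) <|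
  .trans _ _ _ (.rel markedUnknot3 markedUnknot4 trackedMove_unknot3_unknot4) <|
  .trans _ _ _ (.rel markedUnknot4 markedUnknot5 trackedMove_unknot4_unknot5) <|
  .trans _ _ _ (.rel markedUnknot5 markedUnknot6 trackedMove_unknot5_unknot6) <|
  .trans _ _ _ (.rel markedUnknot6 markedUnknot7 trackedMove_unknot6_unknot7) <|
  .trans _ _ _ (.rel markedUnknot7 markedUnknot8 trackedMove_unknot7_unknot8) <|
  .trans _ _ _ (.rel markedUnknot8 markedUnknot9 trackedMove_unknot8_unknot9) <|
  .trans _ _ _ (.rel markedUnknot9 markedUnknot10 trackedMove_unknot9_unknot10) <|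
  .trans _ _ _ (.rel markedUnknot10 markedUnknot11 trackedMove_unknot10_unknot11) <|
  .rel markedUnknot11 markedUnknot12 trackedMove_unknot11_unknot12

end PlanarCode

/-! ### Computed properties of the diagrams -/

namespace PlanarCode

open LinkDiagram

theorem irreducible_unlink0 : unlink0.Irreducible := by decide +kernel

/-- There are four bigons and six quadrilaterals, and no triangles at all. -/
theorem not_isTriangle_unlink0 : ∀ x, ¬ unlink0.IsTriangle x := by decide +kernel

theorem irreducible_unknot0 : unknot0.Irreducible := by decide +kernel

theorem irreducible_unknotSlid : unknotSlid.Irreducible := by decide +kernel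

/-- Of the two triangular regions, the one with corners 17, 26, 28 is in cyclic position; only the
one with corners 25, 39, 29 admits a move. -/
theorem slidesTo_unknot0 : SlidesTo unknot0 unknotSlid 22 := by decide +kernel

/-- The triangles with corners 21, 25, 32 and 24, 30, 33 are in cyclic position, so only the move
back remains, at the corners 27, 31, 37. -/
theorem slidesTo_unknotSlid : SlidesTo unknotSlid unknot0 22 := by decide +kernel

theorem isReduced_unlink0 : (unlink0.diagram valid_unlink0).IsReduced :=
  isReduced_diagram (by decide +kernel) _

theorem isReduced_unknot0 : (unknot0.diagram valid_unknot0).IsReduced :=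
  isReduced_diagram (by decide +kernel) _

theorem isPrime_unlink0 : (unlink0.diagram valid_unlink0).IsPrime :=
  isPrime_diagram (by decide +kernel) _

theorem isPrime_unknot0 : (unknot0.diagram valid_unknot0).IsPrime :=
  isPrime_diagram (by decide +kernel) _

theorem isStable_markedUnlink0 : MarkedDiagram.IsStable {markedUnlink0} :=
  isStable_singleton irreducible_unlink0 not_isTriangle_unlink0 _ _ _

theorem isStable_markedUnknot0 :
    MarkedDiagram.IsStable
      {markedUnknot0, unknotSlid.marked valid_unknotSlid 22 (by decide +kernel)} :=
  isStable_pair irreducible_unknot0 irreducible_unknotSlid _ _ slidesTo_unknot0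
    slidesTo_unknotSlid _ _

theorem omega3With_unknot0 :
    (unknot0.diagram valid_unknot0).Omega3With (unknotSlid.diagram valid_unknotSlid)
      ![(25 : Fin (4 * 10)), (39 : Fin (4 * 10)), (29 : Fin (4 * 10))] (Equiv.refl _)
      (slide (n := 10) ![25, 39, 29]) (shift (n := 10) ![25, 39, 29]) :=
  Omega3To.omega3With (t := ![25, 39, 29]) (by decide +kernel) _ _

end PlanarCode

theorem card_quot_bool {r : Bool → Bool → Prop} (h : r false true) :
    Nat.card (Quot r) = 1 := by
  rw [card_quot_eq_of_surjective (β := Unit) fun _ => ()]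
  · simp
  · exact fun _ => ⟨false, rfl⟩
  · exact fun _ _ _ => rfl
  · rintro (_ | _) (_ | _) -
    exacts [.refl _, .rel _ _ h, .symm _ _ (.rel _ _ h), .refl _]

namespace LinkDiagram

/-! ### Free circles -/

/-- A circle without crossings. -/
def circle : LinkDiagram where
  Dart := Bool
  Region := Bool
  finite_dart := inferInstance
  rot := Equiv.boolNot
  inv := Equiv.boolNot
  isOver _ := false
  region := id
  inv_inv := by decide
  inv_ne := by decide
  rot_four := by decide
  free_circle := by decide
  isOver_rot := by decide
  isOver_free := by decide
  region_surjective := Function.surjective_id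
  region_edge := by decide
  connected := by
    have h : ∀ x : Bool, Relation.EqvGen (fun a b => b = Equiv.boolNot a ∨
        b = Equiv.boolNot a ∨ id a = id b) true x := by
      rintro (_ | _)
      exacts [.rel _ _ (.inl rfl), .refl _]
    exact fun x y => (h x).symm.trans _ _ _ (h y)
  euler := by
    rw [card_quot_bool rfl, card_quot_bool (.inl rfl), Nat.card_eq_fintype_card]
    rfl

/-- A dart of the circle. -/
def circleDart : circle.Dart := Bool.true

theorem crossingCount_circle : circle.crossingCount = 0 :=
  crossingCount_eq_zero fun x h => h (by cases x <;> rfl)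

theorem componentCount_circle : circle.componentCount = 1 :=
  card_quot_bool (.rel _ _ (.inl rfl))

variable {D D' : LinkDiagram}

/-- The diagram with a free circle added in the region of `m`. -/
def addCircle (D : LinkDiagram) (m : D.Dart) : LinkDiagram where
  Dart := D.Dart ⊕ Bool
  Region := D.Region ⊕ Unit
  finite_dart := by
    have := D.finite_dart
    infer_instance
  rot := Equiv.sumCongr D.rot Equiv.boolNot
  inv := Equiv.sumCongr D.inv Equiv.boolNot
  isOver := Sum.elim D.isOver fun _ => false
  region := Sum.elim (fun x => .inl (D.region x)) fun b => if b then .inl (D.region m) else .inr ()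
  inv_inv := by
    rintro (x | b)
    · simp [D.inv_inv]
    · simp
  inv_ne := by
    rintro (x | b)
    · simp [D.inv_ne]
    · simp
  rot_four := by
    rintro (x | b)
    · simp [D.rot_four]
    · simp
  free_circle := by
    rintro (x | b) h
    · exact congrArg Sum.inl (D.free_circle x (Sum.inl_injective h))
    · rfl
  isOver_rot := by
    rintro (x | b) h
    · exact D.isOver_rot x fun h' => h (congrArg Sum.inl h')
    · simp at h
  isOver_free := by
    rintro (x | b) h
    · exact D.isOver_free x (Sum.inl_injective h)
    · rfl
  region_surjective := by
    rintro (r | _)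
    · obtain ⟨x, rfl⟩ := D.region_surjective r
      exact ⟨.inl x, rfl⟩
    · exact ⟨.inr false, rfl⟩
  region_edge := by
    rintro (x | b)
    · exact congrArg Sum.inl (D.region_edge x)
    · simp
  connected := by
    set t := fun a b : D.Dart ⊕ Bool => b = Equiv.sumCongr D.rot Equiv.boolNot a ∨
      b = Equiv.sumCongr D.inv Equiv.boolNot a ∨
      Sum.elim (fun x => Sum.inl (D.region x))
        (fun b => if b then .inl (D.region m) else .inr ()) a =
      Sum.elim (fun x => .inl (D.region x))
        (fun b => if b then .inl (D.region m) else Sum.inr ()) b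
    have hl : ∀ x, Relation.EqvGen t (.inl m) (.inl x) := fun x => by
      refine Relation.EqvGen.map Sum.inl ?_ (D.connected m x)
      rintro a b (rfl | rfl | h)
      · exact .rel _ _ (.inl rfl)
      · exact .rel _ _ (.inr (.inl rfl))
      · exact .rel _ _ (.inr (.inr (congrArg Sum.inl h)))
    have ht : Relation.EqvGen t (.inl m) (.inr true) := .rel _ _ (.inr (.inr rfl))
    have key : ∀ w, Relation.EqvGen t (.inl m) w := by
      rintro (x | _ | _)
      exacts [hl x, ht.trans _ _ _ (.rel _ _ (.inl rfl)), ht]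
    exact fun x y => (key x).symm.trans _ _ _ (key y)
  euler := by
    have := D.finite_dart
    have := D.finite_region
    have h1 : Nat.card (Quot fun a b => b = Equiv.sumCongr D.rot Equiv.boolNot a) =
        Nat.card (Quot fun a b => b = D.rot a) + 1 := by
      rw [card_quot_sum (r := fun a b => b = D.rot a) (s := fun a b => b = !a), card_quot_bool rfl]
      rintro (x | a) (y | b) <;> simp
    have h2 : Nat.card (Quot fun a b => b = Equiv.sumCongr D.inv Equiv.boolNot a) =
        Nat.card (Quot fun a b => b = D.inv a) + 1 := by
      rw [card_quot_sum (r := fun a b => b = D.inv a) (s := fun a b => b = !a), card_quot_bool rfl]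
      rintro (x | a) (y | b) <;> simp
    have h3 : Nat.card (Quot fun a b => b = Equiv.sumCongr D.rot Equiv.boolNot a ∨
          b = Equiv.sumCongr D.inv Equiv.boolNot a) =
        Nat.card (Quot fun a b => b = D.rot a ∨ b = D.inv a) + 1 := by
      rw [card_quot_sum (r := fun a b => b = D.rot a ∨ b = D.inv a) (s := fun a b => b = !a),
        card_quot_bool rfl]
      rintro (x | a) (y | b) <;> simp
    have h4 := D.euler
    have h5 : Nat.card Unit = 1 := Nat.card_unique
    -- The circle adds one vertex (its auxiliary point), one edge, one region, and one component.
    rw [h1, h2, h3, Nat.card_sum, h5]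
    omega

/-- The darts of the original diagram. -/
def old (m : D.Dart) (x : D.Dart) : (D.addCircle m).Dart := Sum.inl x

/-- The darts of the added circle. -/
def new (m : D.Dart) (b : Bool) : (D.addCircle m).Dart := Sum.inr b

@[elab_as_elim]
theorem addCircle_cases {m : D.Dart} {P : (D.addCircle m).Dart → Prop} (ho : ∀ x, P (old m x))
    (hn : ∀ b, P (new m b)) (w : (D.addCircle m).Dart) : P w := by
  rcases w with x | b
  exacts [ho x, hn b]

section

variable {m : D.Dart} {x y : D.Dart} {b : Bool}

@[simp] theorem old_inj : old m x = old m y ↔ x = y := Sum.inl_injective.eq_iff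

@[simp] theorem old_ne_new : old m x ≠ new m b := Sum.inl_ne_inr

@[simp] theorem new_ne_old : new m b ≠ old m x := Sum.inr_ne_inl

@[simp] theorem addCircle_rot_old : (D.addCircle m).rot (old m x) = old m (D.rot x) := rfl

@[simp] theorem addCircle_inv_old : (D.addCircle m).inv (old m x) = old m (D.inv x) := rfl

@[simp] theorem addCircle_inv_new : (D.addCircle m).inv (new m b) = new m !b := rfl

@[simp] theorem addCircle_rot_new : (D.addCircle m).rot (new m b) = new m !b := rfl

@[simp] theorem addCircle_region_old_old :
    (D.addCircle m).region (old m x) = (D.addCircle m).region (old m y) ↔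
      D.region x = D.region y :=
  Sum.inl_injective.eq_iff

@[simp] theorem addCircle_region_new_true :
    (D.addCircle m).region (new m true) = (D.addCircle m).region (old m m) := rfl

@[simp] theorem addCircle_region_old_ne :
    (D.addCircle m).region (old m x) ≠ (D.addCircle m).region (new m false) := Sum.inl_ne_inr

@[simp] theorem addCircle_region_ne_old :
    (D.addCircle m).region (new m false) ≠ (D.addCircle m).region (old m x) := Sum.inr_ne_inl

@[simp] theorem addCircle_isCrossing_old :
    (D.addCircle m).IsCrossing (old m x) ↔ D.IsCrossing x := by
  simp [IsCrossing]

@[simp] theorem addCircle_not_isCrossing_new : ¬ (D.addCircle m).IsCrossing (new m b) := by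
  simp [IsCrossing]

theorem addCircle_vertex_old : (D.addCircle m).vertex (old m x) = old m '' D.vertex x := by
  simp [vertex, Set.image_insert_eq]

end

theorem crossingCount_addCircle (m : D.Dart) :
    (D.addCircle m).crossingCount = D.crossingCount := by
  rw [crossingCount, crossingCount]
  congr 1
  refine (Nat.card_congr (Equiv.ofBijective
    (fun x => ⟨old m x.1, addCircle_isCrossing_old.2 x.2⟩) ⟨?_, ?_⟩)).symm
  · intro x y h
    exact Subtype.ext (old_inj.1 (congrArg Subtype.val h))
  · rintro ⟨w, hw⟩
    induction w using addCircle_cases with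
    | ho x => exact ⟨⟨x, addCircle_isCrossing_old.1 hw⟩, rfl⟩
    | hn b => exact absurd hw addCircle_not_isCrossing_new

theorem quot_eqvGen_card {α : Type*} (r : α → α → Prop) :
    Nat.card (Quot (Relation.EqvGen r)) = Nat.card (Quot r) :=
  Nat.card_congr ⟨Quot.lift (Quot.mk r) fun _ _ => Quot.eqvGen_sound,
    Quot.map id fun _ _ => .rel _ _, by rintro ⟨_⟩; rfl, by rintro ⟨_⟩; rfl⟩

theorem componentCount_addCircle (m : D.Dart) :
    (D.addCircle m).componentCount = D.componentCount + 1 := by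
  have := D.finite_dart
  have h : (D.addCircle m).componentCount = Nat.card (Quot fun a b : (D.addCircle m).Dart =>
    b = (D.addCircle m).inv a ∨ b = (D.addCircle m).rot ((D.addCircle m).rot a)) :=
    quot_eqvGen_card _
  have h' : D.componentCount = Nat.card (Quot fun a b => b = D.inv a ∨ b = D.rot (D.rot a)) :=
    quot_eqvGen_card _
  rw [h, h', ← card_quot_bool (r := fun a b => b = (!a) ∨ b = a) (.inl rfl)]
  refine card_quot_sum (α := D.Dart) (β := Bool) ?_
  rintro (x | a) (y | b)
  · exact show (Sum.inl y : D.Dart ⊕ Bool) = .inl (D.inv x) ∨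
      (Sum.inl y : D.Dart ⊕ Bool) = .inl (D.rot (D.rot x)) ↔ _ by simp
  · exact show (Sum.inr b : D.Dart ⊕ Bool) = .inl (D.inv x) ∨
      (Sum.inr b : D.Dart ⊕ Bool) = .inl (D.rot (D.rot x)) ↔ _ by simp
  · exact show (Sum.inl y : D.Dart ⊕ Bool) = .inr (!a) ∨
      (Sum.inl y : D.Dart ⊕ Bool) = .inr (!!a) ↔ _ by simp
  · exact show (Sum.inr b : D.Dart ⊕ Bool) = .inr (!a) ∨
      (Sum.inr b : D.Dart ⊕ Bool) = .inr (!!a) ↔ _ by simp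

/-- A kink is removed, and the edge of `m` becomes that of `m'`. -/
def KinkRemoval (D : LinkDiagram) (m : D.Dart) (D' : LinkDiagram) (m' : D'.Dart) : Prop :=
  ∃ (t : D.Dart) (ι : D'.Dart → D.Dart), D.IsOmega1Site t ∧
    D.Erases D' (D.vertex t) {t, D.rot t} (D.rot t) (D.rot t) ι ∧ ι m' = m ∧
    D.region t ≠ D.region m

theorem KinkRemoval.nonincreasingMove {m : D.Dart} {m' : D'.Dart} (h : KinkRemoval D m D' m') :
    NonincreasingMove D D' :=
  have ⟨t, ι, h1, h2, _⟩ := h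
  .inr (.inl ⟨t, h1.1, h1.2.1, h1.2.2, ι, h2⟩)

theorem addCircle_sameComponent_old {m x : D.Dart} {w : (D.addCircle m).Dart}
    (h : (D.addCircle m).SameComponent (old m x) w) :
    ∃ y, w = old m y ∧ D.SameComponent x y := by
  refine (Relation.EqvGen.mem_iff (P := fun w => ∃ y, w = old m y ∧ D.SameComponent x y)
    ?_ h).1 ⟨x, rfl, .refl _⟩
  intro a b hab
  induction a using addCircle_cases with
  | ho c =>
    rcases hab with rfl | rfl
    · have : D.SameComponent c (D.inv c) := .rel _ _ (.inl rfl)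
      simp only [addCircle_inv_old, old_inj, exists_eq_left']
      exact ⟨fun h => h.trans _ _ _ this, fun h => h.trans _ _ _ this.symm⟩
    · have : D.SameComponent c (D.rot (D.rot c)) := .rel _ _ (.inr rfl)
      simp only [addCircle_rot_old, old_inj, exists_eq_left']
      exact ⟨fun h => h.trans _ _ _ this, fun h => h.trans _ _ _ this.symm⟩
  | hn c => rcases hab with rfl | rfl <;> simp

theorem addCircle_sameComponent_new {m : D.Dart} {b : Bool} {w : (D.addCircle m).Dart}
    (h : (D.addCircle m).SameComponent (new m b) w) : w = new m b ∨ w = new m !b := by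
  induction w using addCircle_cases with
  | ho y =>
    obtain ⟨z, hz, -⟩ := addCircle_sameComponent_old h.symm
    exact absurd hz new_ne_old
  | hn c => cases b <;> cases c <;> simp

theorem sameComponent_addCircle {m x y : D.Dart} (h : D.SameComponent x y) :
    (D.addCircle m).SameComponent (old m x) (old m y) := by
  refine Relation.EqvGen.map (old m) ?_ h
  rintro a b (rfl | rfl)
  exacts [.rel _ _ (.inl rfl), .rel _ _ (.inr rfl)]

/-- The circle is added in the region of `m`, which is not the disk of the kink, so the kink can
still be removed. Unlike for a tracked move, `m` may end at the removed crossing. -/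
theorem KinkRemoval.addCircle {m : D.Dart} {m' : D'.Dart} (h : KinkRemoval D m D' m') :
    KinkRemoval (D.addCircle m) (old m m) (D'.addCircle m') (old m' m') := by
  obtain ⟨t, ι, ⟨h1, h2, h3⟩, h4, h5, h6⟩ := h
  let F : (D'.addCircle m').Dart → (D.addCircle m).Dart := Sum.map ι id
  have Fo : ∀ x, F (old m' x) = old m (ι x) := fun _ => rfl
  have Fn : ∀ b, F (new m' b) = new m b := fun _ => rfl
  refine ⟨old m t, F, ⟨addCircle_isCrossing_old.2 h1, congrArg _ h2, fun w => ?_⟩, ?_,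
    by rw [Fo, h5], by simpa using h6⟩
  · induction w using addCircle_cases with
    | ho x => simp [h3]
    | hn b => cases b <;> simp [h6.symm]
  rw [addCircle_vertex_old]
  have htr : ∀ {x y}, D.Travels (D.vertex t) x y →
      (D.addCircle m).Travels (old m '' D.vertex t) (old m x) (old m y) := by
    intro x y hxy
    induction hxy with
    | edge => exact .edge
    | pass _ hy ih => exact .pass ih ⟨_, hy, rfl⟩
  constructor
  · exact Sum.map_injective.2 ⟨h4.injective, Function.injective_id⟩
  · intro w hw
    induction w using addCircle_cases with
    | ho x =>
      obtain ⟨g1, g2, g3, g4, g5⟩ := h4.crossing x (addCircle_isCrossing_old.1 hw)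
      exact ⟨addCircle_isCrossing_old.2 g1, by simpa [Fo] using g2, congrArg _ g3, g4, htr g5⟩
    | hn b => exact absurd hw addCircle_not_isCrossing_new
  · intro w hw
    induction w using addCircle_cases with
    | ho x =>
      obtain ⟨g1, g2, g3, g4⟩ := h4.circle x fun h => hw (addCircle_isCrossing_old.2 h)
      refine ⟨fun h => ⟨_, g1 (addCircle_isCrossing_old.1 h), rfl⟩, by simpa [Fo] using g2,
        congrArg _ g3, fun v hv => ?_⟩
      obtain ⟨y, hy, hxy⟩ := addCircle_sameComponent_old hv
      induction v using addCircle_cases with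
      | ho v =>
        obtain rfl := old_inj.1 hy
        simpa using g4 v hxy
      | hn b => exact absurd hy new_ne_old
    | hn b =>
      refine ⟨fun h => absurd h addCircle_not_isCrossing_new, by simp [Fn], rfl, fun v hv => ?_⟩
      induction v using addCircle_cases with
      | ho v => simpa [Fn, Fo] using addCircle_sameComponent_new hv
      | hn c => cases b <;> cases c <;> simp
  · intro w hw hS
    induction w using addCircle_cases with
    | ho x =>
      obtain ⟨x', rfl⟩ := h4.surviving x (addCircle_isCrossing_old.1 hw) fun h => hS ⟨_, h, rfl⟩
      exact ⟨old m' x', rfl⟩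
    | hn b => exact absurd hw addCircle_not_isCrossing_new
  · intro w
    induction w using addCircle_cases with
    | ho x =>
      obtain ⟨x', h⟩ := h4.components x
      exact ⟨old m' x', sameComponent_addCircle h⟩
    | hn b => exact ⟨new m' b, .refl _⟩
  · have hr := h4.regions
    intro w v
    induction w using addCircle_cases with
    | ho x =>
      induction v using addCircle_cases with
      | ho y => simp [Fo, hr]
      | hn b => cases b <;> simp [Fo, Fn, hr, h5]
    | hn b =>
      induction v using addCircle_cases with
      | ho y => cases b <;> simp [Fo, Fn, hr, h5]
      | hn c => cases b <;> cases c <;> simp [Fn]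

end LinkDiagram

namespace LinkDiagram

/-- A property that is preserved when one follows a strand holds on whole components. -/
theorem SameComponent.of_closed {D : LinkDiagram} {P : D.Dart → Prop}
    (hi : ∀ a, P a → P (D.inv a)) (hr : ∀ a, P a → P (D.rot (D.rot a))) {x y : D.Dart}
    (h : D.SameComponent x y) (hx : P x) : P y := by
  refine (Relation.EqvGen.mem_iff (P := P) ?_ h).1 hx
  rintro a b (rfl | rfl)
  · exact ⟨hi a, fun h => D.inv_inv a ▸ hi _ h⟩
  · exact ⟨hr a, fun h => D.rot_four a ▸ hr _ h⟩

theorem SameComponent.eq_of_not_isCrossing {D : LinkDiagram} {x y : D.Dart}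
    (h : D.SameComponent x y) (hx : ¬ D.IsCrossing x) : y = x ∨ y = D.inv x := by
  have hx' : D.rot (D.rot x) = x := not_not.1 hx
  have hi : D.rot (D.rot (D.inv x)) = D.inv x := not_not.1 (mt isCrossing_inv.1 hx)
  refine h.of_closed (P := fun y => y = x ∨ y = D.inv x) ?_ ?_ (.inl rfl)
  · rintro a (rfl | rfl)
    exacts [.inr rfl, .inl (D.inv_inv _)]
  · rintro a (rfl | rfl)
    exacts [.inl hx', .inr hi]

end LinkDiagram

namespace MarkedDiagram

open LinkDiagram PlanarCode

/-! ### Unlinking -/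

/-- The diagram with a free circle added in the region of the mark. -/
def markedAddCircle (X : MarkedDiagram) : MarkedDiagram where
  diagram := X.diagram.addCircle X.mark
  mark := old X.mark X.mark
  crossing := addCircle_isCrossing_old.2 X.crossing
  separating := by simpa using X.separating

/-- The darts of two overlapping circles. -/
abbrev overlapping (z : Fin 8) : markedUnlink9.diagram.Dart := z

section

variable {X : MarkedDiagram}

/-- The darts 2 and 4 are the ends of the marked edge of the overlapping circles; the other edges
are unchanged in a sum. -/
theorem glue_inv_overlapping {z w : Fin 8} (h : unlink9.invFun z = w) (h2 : z ≠ 2) (h4 : z ≠ 4) :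
    (glue X markedUnlink9).inv (inr X _ (overlapping z)) = inr X _ (overlapping w) :=
  h ▸ glue_inv_inr h2 h4

theorem glue_region_overlapping_eq_mark' {z : Fin 8}
    (h : unlink9.regionFun z = unlink9.regionFun (2 : Fin 8)) :
    (glue X markedUnlink9).region (inr X _ (overlapping z)) =
      (glue X markedUnlink9).region (inl X _ X.mark') :=
  glue_region_inr_of_eq_mark h

theorem glue_region_overlapping_eq_mark {z : Fin 8}
    (h : unlink9.regionFun z = unlink9.regionFun (4 : Fin 8)) :
    (glue X markedUnlink9).region (inr X _ (overlapping z)) =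
      (glue X markedUnlink9).region (inl X _ X.mark) :=
  glue_region_inr_of_eq_mark' h

theorem glue_region_overlapping_ne {z : Fin 8}
    (h : unlink9.regionFun z ≠ unlink9.regionFun (2 : Fin 8))
    (h' : unlink9.regionFun z ≠ unlink9.regionFun (4 : Fin 8)) (x : X.diagram.Dart) :
    (glue X markedUnlink9).region (inr X _ (overlapping z)) ≠
      (glue X markedUnlink9).region (inl X _ x) :=
  glue_region_inr_of_ne h h' x

end

/-- The even darts form the lower circle, which is marked, and the odd darts the upper one. The
circles overlap in the bigon with corners 3 and 6. -/
theorem isOmega2Site_overlapping :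
    markedUnlink9.diagram.IsOmega2Site (overlapping 3) (overlapping 6) := by
  refine ⟨isCrossing_diagram _ valid_unlink9 _, isCrossing_diagram _ valid_unlink9 _,
    mt (mem_vertex_diagram (h := valid_unlink9) (x := (3 : Fin 8)) (y := (6 : Fin 8))).1
      (by decide),
    (by decide +kernel : unlink9.invFun (3 : Fin 8) = rotFun (6 : Fin 8)),
    (by decide +kernel : unlink9.invFun (6 : Fin 8) = rotFun (3 : Fin 8)), ?_,
    (by decide +kernel : unlink9.overFun (3 : Fin 8) = unlink9.overFun (rotFun (6 : Fin 8)))⟩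
  exact (by decide +kernel : ∀ x : Fin 8, unlink9.regionFun x = unlink9.regionFun (3 : Fin 8) ↔
    x = 3 ∨ x = 6)

theorem vertex_overlapping :
    markedUnlink9.diagram.vertex (overlapping 3) ∪ markedUnlink9.diagram.vertex (overlapping 6) =
      Set.univ := by
  refine Set.eq_univ_of_forall fun z => ?_
  have : ∀ z : Fin 8, (z : ℕ) / 4 = (3 : Fin 8) / 4 ∨ (z : ℕ) / 4 = (6 : Fin 8) / 4 := by decide
  exact (this z).imp (mem_vertex_diagram (h := valid_unlink9) (x := (3 : Fin 8))).2
    (mem_vertex_diagram (h := valid_unlink9) (x := (6 : Fin 8))).2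

theorem isOmega2Site_glue_overlapping (X : MarkedDiagram) :
    (glue X markedUnlink9).IsOmega2Site (inr X _ (overlapping 3)) (inr X _ (overlapping 6)) := by
  obtain ⟨h1, h2, h3, h4, h5, h6, h7⟩ := isOmega2Site_overlapping
  refine ⟨glue_isCrossing_inr.2 h1, glue_isCrossing_inr.2 h2,
    by rw [glue_vertex_inr]; simpa using h3,
    glue_inv_overlapping h4 (by decide) (by decide),
    glue_inv_overlapping h5 (by decide) (by decide), fun w => ?_, h7⟩
  induction w using glue_cases with
  | hl x =>
    simp [(glue_region_overlapping_ne (X := X) (z := 3) (by decide +kernel) (by decide +kernel)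
      x).symm]
  | hr z => simp [h6]

/-- The map on darts for the move that separates one of the overlapping circles. -/
def separate (X : MarkedDiagram) (w : (X.diagram.addCircle X.mark).Dart) :
    (glue X markedUnlink9).Dart :=
  Sum.elim (inl X _) (fun b => inr X _ (overlapping (if b then 1 else 5))) w

@[simp] theorem separate_old {X : MarkedDiagram} (x : X.diagram.Dart) :
    separate X (old X.mark x) = inl X _ x := rfl

@[simp] theorem separate_new {X : MarkedDiagram} (b : Bool) :
    separate X (new X.mark b) = inr X _ (overlapping (if b then 1 else 5)) := rfl

/-- The marked circle runs through the darts 2, 0, 6, 4, so a strand leaving at `X.mark` passes both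
removed crossings and comes back at `X.mark'`. -/
theorem travels_glue_overlapping {X : MarkedDiagram} {S : Set (glue X markedUnlink9).Dart}
    (hS : ∀ z, inr X _ z ∈ S) :
    (glue X markedUnlink9).Travels S (inl X _ X.mark) (inl X _ X.mark') ∧
      (glue X markedUnlink9).Travels S (inl X _ X.mark') (inl X _ X.mark) := by
  have i1 : (glue X markedUnlink9).inv (inr X _ (overlapping 0)) = inr X _ (overlapping 6) :=
    glue_inv_overlapping (by decide +kernel) (by decide) (by decide)
  have i2 : (glue X markedUnlink9).inv (inr X _ (overlapping 6)) = inr X _ (overlapping 0) :=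
    glue_inv_overlapping (by decide +kernel) (by decide) (by decide)
  have i3 : (glue X markedUnlink9).inv (inl X _ X.mark) = inr X _ (overlapping 2) :=
    glue_inv_inl_mark
  have i4 : (glue X markedUnlink9).inv (inl X _ X.mark') = inr X _ (overlapping 4) :=
    glue_inv_inl_mark'
  constructor
  · have h1 : (glue X markedUnlink9).Travels S (inl X _ X.mark) (inr X _ (overlapping 2)) :=
      i3 ▸ .edge
    have h2 : (glue X markedUnlink9).Travels S (inl X _ X.mark) (inr X _ (overlapping 6)) :=
      i1 ▸ h1.pass (hS _)
    exact (glue_inv_inr_mark' (X := X) (Y := markedUnlink9)) ▸ h2.pass (hS _)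
  · have h1 : (glue X markedUnlink9).Travels S (inl X _ X.mark') (inr X _ (overlapping 4)) :=
      i4 ▸ .edge
    have h2 : (glue X markedUnlink9).Travels S (inl X _ X.mark') (inr X _ (overlapping 0)) :=
      i2 ▸ h1.pass (hS _)
    exact (glue_inv_inr_mark (X := X) (Y := markedUnlink9)) ▸ h2.pass (hS _)

/-- The odd darts form the unmarked circle, whose edges are not affected by the sum. -/
theorem odd_of_sameComponent {X : MarkedDiagram} {z : Fin 8} {w : (glue X markedUnlink9).Dart}
    (h : (glue X markedUnlink9).SameComponent (inr X _ (overlapping z)) w) (hz : z.1 % 2 = 1) :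
    ∃ z : Fin 8, z.1 % 2 = 1 ∧ w = inr X _ (overlapping z) := by
  refine h.of_closed (P := fun w => ∃ z : Fin 8, z.1 % 2 = 1 ∧ w = inr X _ (overlapping z)) ?_ ?_
    ⟨z, hz, rfl⟩
  · rintro _ ⟨z, hz, rfl⟩
    have key : ∀ z : Fin 8, z.1 % 2 = 1 → (unlink9.invFun z).1 % 2 = 1 ∧ z ≠ 2 ∧ z ≠ 4 := by
      decide +kernel
    obtain ⟨h1, h2, h3⟩ := key z hz
    exact ⟨_, h1, glue_inv_overlapping rfl h2 h3⟩
  · rintro _ ⟨z, hz, rfl⟩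
    exact ⟨rotFun (n := 2) (rotFun (n := 2) z),
      (by decide +kernel : ∀ z : Fin 8, z.1 % 2 = 1 →
        (rotFun (n := 2) (rotFun (n := 2) z)).1 % 2 = 1) z hz, rfl⟩

/-- The unmarked circle becomes free and is represented by its edge with ends 1 and 5, which does
not bound the bigon. The regions at 1 and 4 already coincide with that of `X.mark`, so the move
unites no different regions. -/
theorem erases_glue_overlapping (X : MarkedDiagram) {S I : Set (glue X markedUnlink9).Dart}
    (hS : ∀ w, w ∈ S ↔ ∃ z, w = inr X _ z)
    (hI : ∀ w, w ∈ I ↔ ∃ z : Fin 8, (z = 3 ∨ z = 0 ∨ z = 6 ∨ z = 7) ∧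
      w = inr X _ (overlapping z)) :
    (glue X markedUnlink9).Erases (X.diagram.addCircle X.mark) S I (inr X _ (overlapping 1))
      (inr X _ (overlapping 4)) (separate X) := by
  have r1 : (glue X markedUnlink9).region (inr X _ (overlapping 1)) =
      (glue X markedUnlink9).region (inl X _ X.mark) :=
    glue_region_overlapping_eq_mark (by decide +kernel)
  have r4 : (glue X markedUnlink9).region (inr X _ (overlapping 4)) =
      (glue X markedUnlink9).region (inl X _ X.mark) :=
    glue_region_overlapping_eq_mark rfl
  have r5 := glue_region_overlapping_ne (X := X) (z := 5) (by decide +kernel) (by decide +kernel)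
  constructor
  · intro w v h
    induction w using addCircle_cases with
    | ho x =>
      induction v using addCircle_cases with
      | ho y => simpa using h
      | hn b => simp at h
    | hn b =>
      induction v using addCircle_cases with
      | ho y => simp at h
      | hn c =>
        have h' := (by decide : ∀ b c : Bool, (if b then 1 else 5 : Fin 8) = (if c then 1 else 5) →
          b = c) b c (inr_inj.1 h)
        rw [h']
  · intro w hw
    induction w using addCircle_cases with
    | ho x =>
      refine ⟨glue_isCrossing_inl.2 (addCircle_isCrossing_old.1 hw), by simp [hS], rfl, rfl, ?_⟩
      obtain ⟨t1, t2⟩ := travels_glue_overlapping (S := S) fun z => (hS _).2 ⟨z, rfl⟩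
      by_cases h1 : x = X.mark
      · rw [h1]
        exact t1
      by_cases h2 : x = X.mark'
      · rw [h2, addCircle_inv_old, X.inv_mark']
        exact t2
      · rw [addCircle_inv_old, separate_old, separate_old, ← glue_inv_inl h1 h2]
        exact .edge
    | hn b => exact absurd hw addCircle_not_isCrossing_new
  · intro w hw
    induction w using addCircle_cases with
    | ho x =>
      have hx : ¬ X.diagram.IsCrossing x := fun h => hw (addCircle_isCrossing_old.2 h)
      have hx1 : x ≠ X.mark := fun h => hx (h ▸ X.crossing)
      have hx2 : x ≠ X.mark' := fun h => hx (by rw [h]; exact isCrossing_inv.2 X.crossing)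
      refine ⟨fun h => absurd (glue_isCrossing_inl.1 h) hx, by simp [hI],
        (glue_inv_inl hx1 hx2).symm, fun v hv => ?_⟩
      have h := hv.eq_of_not_isCrossing fun h => hx (glue_isCrossing_inl.1 h)
      rw [separate_old, glue_inv_inl hx1 hx2] at h
      induction v using addCircle_cases with
      | ho y => simpa using h
      | hn b => simp at h
    | hn b =>
      refine ⟨fun _ => (hS _).2 ⟨_, rfl⟩, ?_, ?_, fun v hv => ?_⟩
      · rw [hI]
        rintro ⟨z, hz, h⟩
        have h' : (if b then 1 else 5 : Fin 8) = z := inr_inj.1 h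
        subst h'
        exact (by decide : ∀ b : Bool, ¬ ((if b then 1 else 5 : Fin 8) = 3 ∨
          (if b then 1 else 5 : Fin 8) = 0 ∨ (if b then 1 else 5 : Fin 8) = 6 ∨
          (if b then 1 else 5 : Fin 8) = 7)) b hz
      · cases b
        · exact (glue_inv_overlapping (by decide +kernel) (by decide) (by decide)).symm
        · exact (glue_inv_overlapping (by decide +kernel) (by decide) (by decide)).symm
      · obtain ⟨z, -, hz⟩ := odd_of_sameComponent hv (by cases b <;> rfl)
        induction v using addCircle_cases with
        | ho y => simp at hz
        | hn c => cases b <;> cases c <;> simp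
  · intro w _ hw
    induction w using glue_cases with
    | hl x => exact ⟨old _ x, rfl⟩
    | hr z => exact absurd ((hS _).2 ⟨z, rfl⟩) hw
  · intro w
    induction w using glue_cases with
    | hl x => exact ⟨old _ x, .refl _⟩
    | hr z =>
      have hrot : ∀ z : Fin 8, (glue X markedUnlink9).SameComponent (inr X _ (overlapping z))
          (inr X _ (overlapping (rotFun (n := 2) (rotFun (n := 2) z)))) :=
        fun z => .rel _ _ (.inr rfl)
      have h2 : (glue X markedUnlink9).SameComponent (inr X _ (overlapping 2))
          (inl X _ X.mark) := .rel _ _ (.inl glue_inv_inr_mark.symm)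
      have h4 : (glue X markedUnlink9).SameComponent (inr X _ (overlapping 4))
          (inl X _ X.mark') := .rel _ _ (.inl glue_inv_inr_mark'.symm)
      have key : ∀ z : Fin 8, ∃ v, (glue X markedUnlink9).SameComponent (inr X _ (overlapping z))
          (separate X v) := by
        intro z
        fin_cases z
        · exact ⟨old _ _, (hrot 0).trans _ _ _ h2⟩
        · exact ⟨new _ true, .refl _⟩
        · exact ⟨old _ _, h2⟩
        · exact ⟨new _ true, hrot 3⟩
        · exact ⟨old _ _, h4⟩
        · exact ⟨new _ false, .refl _⟩
        · exact ⟨old _ _, (hrot 6).trans _ _ _ h4⟩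
        · exact ⟨new _ false, hrot 7⟩
      exact key z
  · intro w v
    rw [r1, r4]
    induction w using addCircle_cases with
    | ho x =>
      induction v using addCircle_cases with
      | ho y =>
        simp only [separate_old, addCircle_region_old_old, glue_region_inl_inl]
        exact ⟨.inl, by rintro (h | ⟨h | h, h' | h'⟩) <;> first | exact h | exact h.trans h'.symm⟩
      | hn b => cases b <;> simp [r1, r5, (r5 _).symm]
    | hn b =>
      induction v using addCircle_cases with
      | ho y => cases b <;> simp [r1, r5, eq_comm]
      | hn c => cases b <;> cases c <;> simp [r1, r5, (r5 _).symm]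

/-- Both crossings of the overlapping circles vanish, but the mark survives because it is taken at
the end in `X` of the joining edge. -/
theorem trackedMove_glue_overlapping (X : MarkedDiagram) :
    TrackedMove (glue X markedUnlink9) (inl X _ X.mark) (X.diagram.addCircle X.mark)
      (old X.mark X.mark) := by
  have hS : ∀ w, w ∈ (glue X markedUnlink9).vertex (inr X _ (overlapping 3)) ∪
      (glue X markedUnlink9).vertex (inr X _ (overlapping 6)) ↔ ∃ z, w = inr X _ z := by
    intro w
    rw [glue_vertex_inr, glue_vertex_inr, ← Set.image_union, vertex_overlapping, Set.image_univ]
    exact exists_congr fun z => eq_comm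
  have hE := erases_glue_overlapping X hS
    (I := {inr X _ (overlapping 3), inr X _ (overlapping 0), inr X _ (overlapping 6),
      inr X _ (overlapping 7)}) fun w => by simp
  have r2 : (glue X markedUnlink9).region (inr X _ (overlapping 2)) =
      (glue X markedUnlink9).region (inl X _ X.mark') :=
    glue_region_overlapping_eq_mark' rfl
  have r3 := glue_region_overlapping_ne (X := X) (z := 3) (by decide +kernel) (by decide +kernel)
  have hi : (glue X markedUnlink9).inv (inl X _ X.mark) = inr X _ (overlapping 2) :=
    glue_inv_inl_mark
  refine .omega2 _ _ (separate X) (isOmega2Site_glue_overlapping X) hE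
    ⟨rfl, fun w => ?_, r3 _, by rw [hi, r2]; exact r3 _⟩
  rw [addCircle_inv_old, hE.regions, hi, separate_old, LinkDiagram.United, r2]
  rfl

theorem equivalent_glue_overlapping (X : MarkedDiagram) :
    Equivalent (markedGlue X markedUnlink9) (markedAddCircle X) :=
  .rel _ _ (trackedMove_glue_overlapping X)

theorem circle_not_isCrossing (x : circle.Dart) : ¬ circle.IsCrossing x :=
  fun h => h (Equiv.boolNot.left_inv x)

/-- The darts of a kink that are kept when it is replaced by a circle. -/
def unkink (b : Bool) : Fin 4 := if b then 2 else 1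

/-- The loop at the corner 3 is removed; the other edge, with ends 1 and 2, represents the remaining
circle. -/
theorem kinkRemoval_markedUnknot12 :
    KinkRemoval markedUnknot12.diagram markedUnknot12.mark circle circleDart := by
  have hv : (unknot12.diagram valid_unknot12).vertex (3 : Fin 4) = Set.univ :=
    Set.eq_univ_of_forall fun z => (mem_vertex_diagram (h := valid_unknot12) (x := (3 : Fin 4))).2
      ((by decide : ∀ z : Fin 4, (z : ℕ) / 4 = (3 : Fin 4) / 4) z)
  have hs : ∀ x : Fin 4, (unknot12.diagram valid_unknot12).SameComponent x
      (rotFun (n := 1) (rotFun (n := 1) x)) := fun x => .rel _ _ (.inr rfl)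
  refine ⟨(3 : Fin 4), unkink, ⟨isCrossing_diagram _ valid_unknot12 _,
    (by decide +kernel : unknot12.invFun (3 : Fin 4) = rotFun (3 : Fin 4)),
    (by decide +kernel : ∀ x : Fin 4, unknot12.regionFun x = unknot12.regionFun (3 : Fin 4) ↔
      x = 3)⟩, ?_, rfl,
    (by decide +kernel : unknot12.regionFun (3 : Fin 4) ≠ unknot12.regionFun (2 : Fin 4))⟩
  constructor
  · exact (by decide : ∀ a b : Bool, unkink a = unkink b → a = b)
  · exact fun x hx => absurd hx (circle_not_isCrossing x)
  · exact fun x _ => ⟨fun _ => hv.symm ▸ Set.mem_univ _,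
      (by decide : ∀ b : Bool, ¬ (unkink b = 3 ∨ unkink b = rotFun (n := 1) 3)) x,
      (by decide +kernel : ∀ b : Bool, unkink (!b) = unknot12.invFun (unkink b)) x,
      fun y _ => (by decide : ∀ a b : Bool, b = a ∨ b = !a) x y⟩
  · exact fun x _ h => absurd (hv.symm ▸ Set.mem_univ x) h
  · have : ∀ x : Fin 4, ∃ b : Bool,
        (unknot12.diagram valid_unknot12).SameComponent x (unkink b) := by
      intro x
      fin_cases x
      exacts [⟨true, hs 0⟩, ⟨false, .refl _⟩, ⟨true, .refl _⟩, ⟨false, hs 3⟩]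
    exact this
  · exact (by decide +kernel : ∀ a b : Bool, a = b ↔
      unknot12.United (rotFun (3 : Fin 4)) (rotFun (3 : Fin 4)) (unkink a) (unkink b))

/-- The darts of two overlapping circles that are kept when the circles are separated. -/
def split (w : Bool ⊕ Bool) : Fin 8 :=
  w.elim (fun b => if b then 4 else 2) fun b => if b then 1 else 5

/-- Here both circles become free, represented by the edges with ends 2, 4 and 1, 5. The parity of
the darts tells the two components apart. -/
theorem omega2Down_overlapping :
    NonincreasingMove markedUnlink9.diagram (circle.addCircle circleDart) := by
  have hs : ∀ x : Fin 8, markedUnlink9.diagram.SameComponent (overlapping x)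
      (overlapping (rotFun (n := 2) (rotFun (n := 2) x))) := fun x => .rel _ _ (.inr rfl)
  have hn : ∀ x, ¬ (circle.addCircle circleDart).IsCrossing x := by
    intro x
    induction x using addCircle_cases with
    | ho x => exact mt addCircle_isCrossing_old.1 (circle_not_isCrossing x)
    | hn b => exact addCircle_not_isCrossing_new
  have hp : ∀ {x y : Fin 8}, markedUnlink9.diagram.SameComponent (overlapping x) (overlapping y) →
      (x : ℕ) % 2 = y % 2 := by
    intro x y h
    refine h.of_closed (P := fun z : Fin 8 => (x : ℕ) % 2 = z % 2) ?_ ?_ rfl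
    · exact fun z hz => hz.trans ((by decide +kernel : ∀ z : Fin 8, (z : ℕ) % 2 =
        unlink9.invFun z % 2) z)
    · exact fun z hz => hz.trans ((by decide +kernel : ∀ z : Fin 8, (z : ℕ) % 2 =
        rotFun (n := 2) (rotFun (n := 2) z) % 2) z)
  obtain ⟨h1, h2, h3, h4, h5, h6, h7⟩ := isOmega2Site_overlapping
  refine .inr (.inr (.inl ⟨_, _, h1, h2, h3, h4, h5, h6, h7, split, ?_⟩))
  rw [vertex_overlapping]
  constructor
  · exact (by decide : ∀ a b : Bool ⊕ Bool, split a = split b → a = b)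
  · exact fun x hx => absurd hx (hn x)
  · exact fun x _ => ⟨fun _ => Set.mem_univ _,
      (by decide : ∀ w : Bool ⊕ Bool, ¬ (split w = 3 ∨ split w = rotFun (n := 2) 3 ∨ split w = 6 ∨
        split w = rotFun (n := 2) 6)) x,
      (by decide +kernel : ∀ w : Bool ⊕ Bool, split (w.map not not) = unlink9.invFun (split w)) x,
      fun y h => (by decide : ∀ v w : Bool ⊕ Bool, (split v : ℕ) % 2 = split w % 2 →
        w = v ∨ w = v.map not not) x y (hp h)⟩
  · exact fun x _ h => absurd (Set.mem_univ x) h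
  · have : ∀ x : Fin 8, ∃ w : Bool ⊕ Bool,
        markedUnlink9.diagram.SameComponent (overlapping x) (overlapping (split w)) := by
      intro x
      fin_cases x
      exacts [⟨.inl false, hs 0⟩, ⟨.inr true, .refl _⟩, ⟨.inl false, .refl _⟩, ⟨.inr true, hs 3⟩,
        ⟨.inl true, .refl _⟩, ⟨.inr false, .refl _⟩, ⟨.inl true, hs 6⟩, ⟨.inr false, hs 7⟩]
    exact this
  · exact (by decide +kernel : ∀ v w : Bool ⊕ Bool,
      (v.elim .inl (fun b => if b then .inl true else .inr ()) : Bool ⊕ Unit) =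
        w.elim .inl (fun b => if b then .inl true else .inr ()) ↔
      unlink9.United (rotFun (rotFun (3 : Fin 8))) (rotFun (rotFun (6 : Fin 8)))
        (split v) (split w))

/-- In the induction step the part built so far is simplified first, then the new summand is reduced
to overlapping circles, and finally its unmarked circle is set free. -/
theorem equivalent_iterate_markedGlue (n : ℕ) :
    Equivalent ((markedGlue · markedUnlink0)^[n] markedUnknot0)
      (markedAddCircle^[n] markedUnknot12) := by
  induction n with
  | zero => exact equivalent_markedUnknot0
  | succ n ih =>
    rw [Function.iterate_succ_apply', Function.iterate_succ_apply']
    exact (ih.glue_left _).trans _ _ _ (.trans _ _ _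
      (equivalent_markedUnlink0.glue_right _) (equivalent_glue_overlapping _))

/-- The kink carries the mark, so it is removed only after all circles are free; they do not
obstruct its removal. -/
theorem exists_kinkRemoval (n : ℕ) : ∃ (U : LinkDiagram) (m : U.Dart),
    KinkRemoval (markedAddCircle^[n] markedUnknot12).diagram
      (markedAddCircle^[n] markedUnknot12).mark U m ∧
    U.crossingCount = 0 ∧ U.componentCount = n + 1 := by
  induction n with
  | zero => exact ⟨_, _, kinkRemoval_markedUnknot12, crossingCount_circle, componentCount_circle⟩
  | succ n ih =>
    obtain ⟨U, m, h1, h2, h3⟩ := ih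
    rw [Function.iterate_succ_apply']
    exact ⟨U.addCircle m, old m m, h1.addCircle, by rw [crossingCount_addCircle, h2],
      by rw [componentCount_addCircle, h3]⟩

theorem exists_unlink (n : ℕ) : ∃ U : LinkDiagram, U.crossingCount = 0 ∧
    U.componentCount = n + 1 ∧
    SameLink ((markedGlue · markedUnlink0)^[n] markedUnknot0).diagram U := by
  obtain ⟨U, m, h1, h2, h3⟩ := exists_kinkRemoval n
  exact ⟨U, h2, h3, (equivalent_iterate_markedGlue n).sameLink.trans _ _ _
    (.rel _ _ h1.nonincreasingMove)⟩

/-! ### Hardness of the sums -/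

/-- The family starts as the pair of `unknot0` and `unknotSlid`; each sum with `unlink0`, which
admits no moves, replaces its members by their sums. -/
theorem exists_isStable_iterate (n : ℕ) : ∃ 𝒮 : Set MarkedDiagram, IsStable 𝒮 ∧
    (markedGlue · markedUnlink0)^[n] markedUnknot0 ∈ 𝒮 := by
  induction n with
  | zero => exact ⟨_, isStable_markedUnknot0, .inl rfl⟩
  | succ n ih =>
    obtain ⟨𝒮, h1, h2⟩ := ih
    rw [Function.iterate_succ_apply']
    exact ⟨_, h1.image_markedGlue (Y := markedUnlink0)
      (irreducible_unlink0.not_isOmega1Site valid_unlink0)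
      (irreducible_unlink0.not_isOmega2Site valid_unlink0)
      (not_isOmega3Triangle not_isTriangle_unlink0 valid_unlink0)
      (irreducible_unlink0.mark_ne valid_unlink0 _ _), _, h2, rfl⟩

theorem isReduced_iterate (n : ℕ) :
    ((markedGlue · markedUnlink0)^[n] markedUnknot0).diagram.IsReduced := by
  induction n with
  | zero => exact isReduced_unknot0
  | succ n ih =>
    rw [Function.iterate_succ_apply']
    exact isReduced_glue ih isReduced_unlink0

/-- The triangle of `unknot0` persists because stability keeps all triangles away from the marked
edge. -/
theorem exists_isOmega3Triangle_iterate (n : ℕ) :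
    ∃ t, ((markedGlue · markedUnlink0)^[n] markedUnknot0).diagram.IsOmega3Triangle t := by
  induction n with
  | zero => exact ⟨_, omega3With_unknot0.1⟩
  | succ n ih =>
    obtain ⟨𝒮, h1, h2⟩ := exists_isStable_iterate n
    obtain ⟨t, ht⟩ := ih
    have hm := h1.mark_notMem _ h2 t ht
    rw [Function.iterate_succ_apply']
    exact ⟨_, isOmega3Triangle_glue ht (fun i => (hm i).1) fun i => (hm i).2⟩

theorem isShakyHard_iterate (n : ℕ) :
    ((markedGlue · markedUnlink0)^[n] markedUnknot0).diagram.IsShakyHard := by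
  obtain ⟨𝒮, h1, h2⟩ := exists_isStable_iterate n
  obtain ⟨U, h3, -, h4⟩ := exists_unlink n
  obtain ⟨t, ht⟩ := exists_isOmega3Triangle_iterate n
  -- The result of a move at the triangle is supplied by stability.
  obtain ⟨X, -, e, ρ, π, h5, -⟩ := h1.omega3 _ h2 t ht
  exact ⟨h1.isHard h2 (isReduced_iterate n) h3 h4, X.diagram, t, e, ρ, π, h5⟩

theorem isUnlinkDiagram_iterate (n : ℕ) :
    ((markedGlue · markedUnlink0)^[n] markedUnknot0).diagram.IsUnlinkDiagram (n + 1) :=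
  have ⟨U, h1, h2, h3⟩ := exists_unlink n
  ⟨U, h1, h2, h3⟩

theorem isIteratedSum_iterate (n : ℕ) : IsIteratedSum markedUnknot0.diagram markedUnlink0.diagram n
    ((markedGlue · markedUnlink0)^[n] markedUnknot0).diagram := by
  induction n with
  | zero => exact .zero
  | succ n ih =>
    rw [Function.iterate_succ_apply']
    exact .succ ih (isConnectedSum_glue _ _)

theorem sameLink_markedUnlink0 : SameLink markedUnlink0.diagram (circle.addCircle circleDart) :=
  equivalent_markedUnlink0.sameLink.trans _ _ _ (.rel _ _ omega2Down_overlapping)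

theorem crossingCount_addCircle_circle : (circle.addCircle circleDart).crossingCount = 0 :=
  (crossingCount_addCircle _).trans crossingCount_circle

theorem isUnlinkDiagram_markedUnlink0 : markedUnlink0.diagram.IsUnlinkDiagram 2 :=
  ⟨_, crossingCount_addCircle_circle, by rw [componentCount_addCircle, componentCount_circle],
    sameLink_markedUnlink0⟩

theorem isRigidHard_markedUnlink0 : markedUnlink0.diagram.IsRigidHard := by
  refine ⟨isStable_markedUnlink0.isHard rfl isReduced_unlink0 crossingCount_addCircle_circle
    sameLink_markedUnlink0, ?_⟩
  rintro ⟨D', t, -, -, -, ht, -⟩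
  exact not_isOmega3Triangle not_isTriangle_unlink0 valid_unlink0 t ht

end MarkedDiagram

open MarkedDiagram PlanarCode in
theorem mainTheorem3 :
    (∀ n : ℕ, 1 ≤ n → ∃ D : LinkDiagram, D.IsUnlinkDiagram n ∧ D.IsShakyHard) ∧
    ∃ K H : LinkDiagram,
      (K.IsUnlinkDiagram 1 ∧ K.IsShakyHard ∧ K.IsPrime ∧ K.crossingCount = 10) ∧
      (H.IsUnlinkDiagram 2 ∧ H.IsRigidHard ∧ H.IsPrime ∧ H.crossingCount = 8) ∧
      ∀ n : ℕ, 1 ≤ n → ∃ D : LinkDiagram, LinkDiagram.IsIteratedSum K H n D ∧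
        D.IsUnlinkDiagram (n + 1) ∧ D.IsShakyHard := by
  refine ⟨fun n hn => ?_, markedUnknot0.diagram, markedUnlink0.diagram,
    ⟨isUnlinkDiagram_iterate 0, isShakyHard_iterate 0, isPrime_unknot0,
      crossingCount_diagram _ valid_unknot0⟩,
    ⟨isUnlinkDiagram_markedUnlink0, isRigidHard_markedUnlink0, isPrime_unlink0,
      crossingCount_diagram _ valid_unlink0⟩,
    fun n _ => ⟨_, isIteratedSum_iterate n, isUnlinkDiagram_iterate n, isShakyHard_iterate n⟩⟩
  -- A link with `n` components needs `n - 1` sums; for `n = 1` it is the diagram `unknot0` itself.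
  obtain ⟨n, rfl⟩ := Nat.exists_eq_add_of_le' hn
  exact ⟨_, isUnlinkDiagram_iterate n, isShakyHard_iterate n⟩
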